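/- Let $F\in\mathcal S^\sharp_1$, that is: $F(s)=\sum_{n\ge1}a(n)n^{-s}$ is a Dirichlet series, absolutely convergent and not identically zero for $\Re s>1$; for some integer $m\ge 0$ the function $(s-1)^mF(s)$ extends to an entire function of finite order; and, as an identity of meromorphic functions, $$\Phi(s)=\omega\,\overline{\Phi(1-\overline{s})},\qquad \Phi(s)=Q^s\prod_{j=1}^r\Gamma(\lambda_js+\mu_j)F(s),$$ where $Q>0$, $\lambda_j>0$, $\Re\mu_j\ge0$, $|\omega|=1$ and the degree is $2\sum_j\lambda_j=1$. Put $$\beta_F=\prod_j\lambda_j^{2\lambda_j},\quad q=2\pi Q^2\beta_F,\quad \xi=2\sum_j\Big(\mu_j-\tfrac12\Big)=\eta+i\theta\ (\eta,\theta\in\mathbb R),\quad \omega^*=\omega\,(\beta_FQ^2)^{i\theta}\prod_j\lambda_j^{-2i\Im\mu_j},\quad \mathfrak a=\eta+1 .$$ Then $q$ is a positive integer, $\mathfrak a\in\{0,1\}$, and $\widetilde a(n)=a(n)n^{i\theta}$ $(n\ge1)$ is periodic of period $q$; extend $\widetilde a$ to $\mathbb Z$ by periodicity. Write $e(x)=e^{2\pi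 ix}$ and, for $\Re s>1$ and $\alpha,\beta\in\mathbb R$, $$F(s,\alpha)=\sum_{n\ge1}\frac{a(n)}{n^s}e(-n\alpha),\qquad F_*(s,\alpha,\beta)=\sum_{\substack{n\in\mathbb Z\\ n+\beta>0}}\frac{\widetilde a(n)}{(n+\beta)^{s+i\theta}}e(-n\alpha),\qquad \overline F_*(s,\alpha,\beta)=\overline{F_*(\overline s,\alpha,\beta)} .$$ Let $\alpha\in(0,1]$. The series defining $F_*(s,0,\pm\alpha q)$ converge absolutely for $\Re s>1$; $F(s,\alpha)$ extends to a meromorphic function on $\mathbb C$, holomorphic except for at most a simple pole at $s=1-i\theta$; $\overline F_*(s,0,\pm\alpha q)$ extend to meromorphic functions on $\mathbb C$, holomorphic except for at most a simple pole at $s=1+i\theta$; and these functions satisfy $$F(1-s,\alpha)=\frac{\omega^*\,\Gamma(s-i\theta)\,q^{s-i\theta-\frac12}}{i^{\mathfrak a}(2\pi)^{s-i\theta}}\Big(e^{i\frac\pi2(s-i\theta)}\,\overline F_*(s,0,-\alpha q)+(-1)^{\mathfrak a}e^{-i\frac\pi2(s-i\theta)}\,\overline F_*(s,0,\alpha q)\Big)$$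 for all $s\in\mathbb C$ with $s\ne1+i\theta$ and $s-i\theta\notin\{0,-1,-2,\dots\}$. -/

import Mathlib

open Complex Filter

noncomputable section

/-- The parameters of a functional equation of Selberg type
`Φ(s) = ω conj (Φ (1 - conj s))`, `Φ(s) = Q ^ s ∏ j, Γ(lam j * s + mu j) * F(s)`. -/
structure SelbergData where
  r : ℕ
  Q : ℝ
  lam : Fin r → ℝ
  mu : Fin r → ℂ
  omega : ℂ
  Q_pos : 0 < Q
  lam_pos : ∀ j, 0 < lam j
  mu_re_nonneg : ∀ j, 0 ≤ (mu j).re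
  norm_omega : ‖omega‖ = 1

namespace SelbergData

/-- The degree `d = 2 ∑ λ_j`. -/
def degree (D : SelbergData) : ℝ := 2 * ∑ j, D.lam j

/-- `γ(s) = Q ^ s ∏ Γ(λ_j s + μ_j)`. -/
def gammaFactor (D : SelbergData) (s : ℂ) : ℂ :=
  (D.Q : ℂ) ^ s * ∏ j, Complex.Gamma (D.lam j * s + D.mu j)

/-- `s` is not a pole of any of the factors `Γ(λ_j s + μ_j)`. -/
def GammaRegularAt (D : SelbergData) (s : ℂ) : Prop :=
  ∀ (j : Fin D.r) (k : ℕ), (D.lam j : ℂ) * s + D.mu j ≠ -(k : ℂ)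

/-- `β = ∏ λ_j ^ (2 λ_j)`. -/
def beta (D : SelbergData) : ℝ := ∏ j, D.lam j ^ (2 * D.lam j)

/-- The conductor `q = (2π) ^ d Q ^ 2 β`. -/
def conductor (D : SelbergData) : ℝ := (2 * Real.pi) ^ D.degree * D.Q ^ 2 * D.beta

/-- The invariant `ξ = 2 ∑ (μ_j - 1/2) = η + iθ`. -/
def xi (D : SelbergData) : ℂ := 2 * ∑ j, (D.mu j - 1 / 2)

/-- `η = Re ξ`. -/
def eta (D : SelbergData) : ℝ := D.xi.re

/-- `θ = Im ξ`. -/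
def theta (D : SelbergData) : ℝ := D.xi.im

/-- The root number `ω* = ω (β Q ^ 2) ^ (iθ) ∏ λ_j ^ (-2 i Im μ_j)`. -/
def rootNumber (D : SelbergData) : ℂ :=
  D.omega * ((D.beta * D.Q ^ 2 : ℝ) : ℂ) ^ (I * (D.theta : ℂ)) *
    ∏ j, (D.lam j : ℂ) ^ (-2 * I * ((D.mu j).im : ℂ))

end SelbergData

/-- An entire function of finite order. -/
def IsEntireOfFiniteOrder (H : ℂ → ℂ) : Prop :=
  Differentiable ℂ H ∧ ∃ A : ℝ, H =O[cocompact ℂ] fun s => Real.exp (‖s‖ ^ A)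

/-- `F`, with Dirichlet coefficients `a n` for `n ≥ 1`, belongs to the extended Selberg class and
satisfies the functional equation with parameters `D`. The value of `F` at the possible pole
`s = 1` is irrelevant, and the functional equation is required at all points where neither side
is evaluated at a possible pole of `F` or at a pole of a Gamma factor. -/
structure IsExtendedSelberg (a : ℕ → ℂ) (F : ℂ → ℂ) (D : SelbergData) : Prop where
  ne_zero : ∃ s : ℂ, 1 < s.re ∧ F s ≠ 0
  summable : ∀ s : ℂ, 1 < s.re → LSeriesSummable a s
  eq_LSeries : ∀ s : ℂ, 1 < s.re → F s = LSeries a s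
  continuation : ∃ (m : ℕ) (H : ℂ → ℂ), IsEntireOfFiniteOrder H ∧
    ∀ s : ℂ, s ≠ 1 → H s = (s - 1) ^ m * F s
  functional_equation : ∀ s : ℂ, s ≠ 0 → s ≠ 1 →
    D.GammaRegularAt s → D.GammaRegularAt (1 - starRingEnd ℂ s) →
    D.gammaFactor s * F s =
      D.omega * starRingEnd ℂ
        (D.gammaFactor (1 - starRingEnd ℂ s) * F (1 - starRingEnd ℂ s))

/-- `e(x) = exp(2πix)`. -/
def expTwoPiI (x : ℝ) : ℂ := Complex.exp (2 * Real.pi * I * x)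

/-- The linear twist `F(s, α) = ∑_{n ≥ 1} a(n) n ^ (-s) e(-nα)` (for `Re s > 1`). -/
def linearTwist (a : ℕ → ℂ) (s : ℂ) (α : ℝ) : ℂ :=
  LSeries (fun n => a n * expTwoPiI (-(n * α))) s

/-- The terms of the series `F_*(s, α, β)`, indexed by the integers `n` with `n + β > 0`. -/
def starTerm (ta : ℤ → ℂ) (θ : ℝ) (s : ℂ) (α β : ℝ) (n : {n : ℤ // 0 < (n : ℝ) + β}) : ℂ :=
  ta n / ((((n : ℤ) : ℝ) + β : ℝ) : ℂ) ^ (s + I * (θ : ℂ)) * expTwoPiI (-((n : ℤ) * α))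

/-- `F_*(s, α, β) = ∑_{n + β > 0} ã(n) (n + β) ^ (-(s + iθ)) e(-nα)` (for `Re s > 1`). -/
def starSeries (ta : ℤ → ℂ) (θ : ℝ) (s : ℂ) (α β : ℝ) : ℂ :=
  ∑' n, starTerm ta θ s α β n

/-- The conjugate function `conj (F_*(conj s, α, β))`. -/
def starSeriesConj (ta : ℤ → ℂ) (θ : ℝ) (s : ℂ) (α β : ℝ) : ℂ :=
  starRingEnd ℂ (starSeries ta θ (starRingEnd ℂ s) α β)

/-- `G` is the continuation to `ℂ` of the function `f` on `Re s > 1`, holomorphic except for at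
most a simple pole at `p`. -/
structure IsContinuationWithSimplePole (f G : ℂ → ℂ) (p : ℂ) : Prop where
  eqOn : ∀ s : ℂ, 1 < s.re → G s = f s
  holomorphic : DifferentiableOn ℂ G {p}ᶜ
  meromorphicAt : MeromorphicAt G p
  order_ge : (-1 : WithTop ℤ) ≤ meromorphicOrderAt G p

end

/-!
The proof identifies `F` with a shifted L-function of a periodic arithmetic function, following the
classical description of Dirichlet series of degree one, and then reads off the linear twists from
the Hurwitz zeta function.

*Periodicity.* The exponential series `f(z) = ∑ a(n) e(nz)` (`expSeries`) is, in the upper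
half-plane, the Mellin integral of `Γ(s) F(s) (-2πiz) ^ (-s)`. Near a point `α > 0` of the real axis
only the part of the integral with `Im s → -∞` matters. There the line of integration is moved to
`Re s = -1` (`integral_shift`; the growth of `F` is controlled by the Phragmén–Lindelöf principle),
the functional equation is applied, and the Gamma factors are evaluated by Stirling's formula. In
degree one the oscillations of the form `t log t` cancel, and what is left is the Laplace transform of a
trigonometric series with frequencies `log n`, in which only `n = qα` contributes to the leading
order: `y ^ (1 - iθ) f(α + iy)` tends to a nonzero constant times the conjugate of `a(n) n ^ (iθ)`
if `qα = n` is an integer, and to `0` otherwise (`tendsto_expSeries`). Since `f(z + 1) = f(z)`, the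
conductor `q` is an integer (`exists_natCast_eq_conductor`) and `a(n) n ^ (iθ)` has period `q`
(`twistedCoeff_add_conductor`). Hence `F(s) = L(Φ, s + iθ)` for a function `Φ` on `ℤ/qℤ`
(`eq_LFunction`).

*Shape of the functional equation.* The functional equation of `F` is compared with the one of
periodic L-functions on the two halves of the line `Re s = 2`. Stirling's formula and the uniqueness
of absolutely convergent trigonometric series show that the discrete Fourier transform of `Φ` is a
multiple of the conjugate of `Φ` (`dft_eq`); consequently `Φ` is even or odd (`exists_parity`), and
the quotient of Gamma factors of `F` is exactly that of a Dirichlet L-function of the same parity `𝔞`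
(`funRatio_eq_dirichletTerm`). The quotient of the two Gamma factors therefore extends by reflection
to an entire function without zeros, which grows like `s ^ ((η + 1 - 𝔞) / 2)` in every direction. A
nonzero exponent is impossible, because the function or its inverse would tend to `0` at infinity
(`eq_zero_of_reflection`), so `𝔞 = η + 1` (`natCast_eq_eta_add_one`). This also evaluates the constant
in the Fourier transform of `Φ` in terms of the root number (`limitConst_one_eq`).

*Linear twists.* By Fourier inversion modulo `q`, the twist `F(s, α)` is a finite combination of
exponential zeta functions (`twistContinuation_eq`), and the dual series `F_*(s, 0, ±αq)` are finite
combinations of Hurwitz zeta functions (`starContinuation_eq`). The asserted functional equation is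
that of the exponential zeta functions, combined with the Fourier transform and the parity of `Φ`
(`twistContinuation_one_sub`).
-/

noncomputable section

open Topology

/-! ### Stirling's formula for the complex Gamma function -/

lemma tendsto_of_tendsto_of_eq {α β : Type*} [TopologicalSpace β] {f : α → β} {l : Filter α}
    {a b : β} (h : Tendsto f l (𝓝 a)) (hab : a = b) : Tendsto f l (𝓝 b) := hab ▸ h

/-- The Gudermann term `(z + 1/2) log (1 + 1/z) - 1`, whose sum over `z, z + 1, z + 2, …` is the
remainder in Stirling's formula for `log Γ(z)`. -/
def gudermann (z : ℂ) : ℂ := (z + 1 / 2) * log (1 + 1 / z) - 1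

lemma norm_gudermann_le {z : ℂ} (hz : 2 ≤ ‖z‖) : ‖gudermann z‖ ≤ 2 * (‖z‖ ^ 2)⁻¹ := by
  have hz0 : z ≠ 0 := by
    rintro rfl
    norm_num at hz
  have hzp : 0 < ‖z‖ := by linarith
  have hu : ‖1 / z‖ ≤ 1 / 2 := by
    rw [norm_div, norm_one]
    exact one_div_le_one_div_of_le (by norm_num) hz
  have hr := norm_log_sub_logTaylor_le 2 (z := 1 / z) (by linarith)
  set r := log (1 + 1 / z) - logTaylor (2 + 1) (1 / z) with hrdef
  have hT : logTaylor (2 + 1) (1 / z) = 1 / z - (1 / z) ^ 2 / 2 := by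
    simp [logTaylor_succ, logTaylor_zero]
    ring
  have hg : gudermann z = -(1 / z) ^ 2 / 4 + (z + 1 / 2) * r := by
    rw [gudermann, hrdef, hT]
    field_simp
    ring
  have hinv : (1 - ‖1 / z‖)⁻¹ ≤ 2 := by
    rw [inv_le_comm₀ (by linarith) (by norm_num)]
    linarith
  have hr' : ‖r‖ ≤ ‖1 / z‖ ^ 3 * 2 / 3 := by
    refine hr.trans ?_
    norm_num
    norm_num at hinv
    gcongr
  have h1 : ‖z + 1 / 2‖ ≤ ‖z‖ + 1 / 2 := by
    refine (norm_add_le _ _).trans ?_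
    norm_num
  rw [hg]
  calc ‖-(1 / z) ^ 2 / 4 + (z + 1 / 2) * r‖
      ≤ ‖1 / z‖ ^ 2 / 4 + (‖z‖ + 1 / 2) * (‖1 / z‖ ^ 3 * 2 / 3) := by
        refine (norm_add_le _ _).trans ?_
        rw [norm_mul]
        refine add_le_add ?_ (mul_le_mul h1 hr' (norm_nonneg _) (by positivity))
        rw [norm_div, norm_neg, norm_pow]
        norm_num
    _ = (‖z‖ ^ 2)⁻¹ * (11 / 12 + (1 / ‖z‖) / 3) := by
        rw [norm_div, norm_one]
        field_simp
        ring
    _ ≤ (‖z‖ ^ 2)⁻¹ * 2 := by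
        have : 1 / ‖z‖ ≤ 1 / 2 := one_div_le_one_div_of_le (by norm_num) hz
        gcongr
        linarith
    _ = _ := by ring

lemma log_one_add_one_div {w : ℂ} (hw : 0 ≤ w.re) (hw0 : w ≠ 0) :
    log (1 + 1 / w) = log (w + 1) - log w := by
  have hw1 : w + 1 ≠ 0 := by
    intro h
    have := congrArg re h
    simp at this
    linarith
  have h1 : |arg w| ≤ Real.pi / 2 := abs_arg_le_pi_div_two_iff.2 hw
  have h2 : |arg (w + 1)| < Real.pi / 2 := by
    rw [abs_arg_lt_pi_div_two_iff]
    left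
    simp
    linarith
  rw [abs_le] at h1
  rw [abs_lt] at h2
  rw [← log_exp (x := log (w + 1) - log w) (by simp [log_im]; linarith) (by simp [log_im]; linarith),
    exp_sub, exp_log hw1, exp_log hw0]
  congr 1
  field_simp

/-- Exponentiated partial sums of `gudermann`: the logarithms telescope, since `log (1 + 1/w) = log
(w + 1) - log w` in the right half-plane. -/
lemma exp_sum_gudermann_mul_prod {z : ℂ} (hz : 0 ≤ z.re) (hz0 : z ≠ 0) (N : ℕ) :
    exp (∑ k ∈ Finset.range N, gudermann (z + k)) * ∏ k ∈ Finset.range N, (z + k) =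
      exp ((z + N - 1 / 2) * log (z + N) - (z - 1 / 2) * log z - N) := by
  induction N with
  | zero => simp
  | succ N ih =>
    have hN0 : z + N ≠ 0 := by
      intro h
      have h1 := congrArg re h
      have h2 := congrArg im h
      simp at h1 h2
      apply hz0
      apply Complex.ext
      · simp
        have : (0 : ℝ) ≤ N := Nat.cast_nonneg N
        linarith
      · simpa using h2
    have hN : 0 ≤ (z + N).re := by
      simp
      positivity
    rw [Finset.sum_range_succ, Finset.prod_range_succ, exp_add,
      show ∀ a b c d : ℂ, a * b * (c * d) = (a * c) * (b * d) by intros; ring, ih]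
    rw [show exp (gudermann (z + N)) * (z + N) = exp (gudermann (z + N)) * exp (log (z + N)) by
      rw [exp_log hN0], ← exp_add, ← exp_add, gudermann, log_one_add_one_div hN hN0]
    congr 1
    push_cast
    rw [add_assoc z (N : ℂ) 1]
    ring

lemma normSq_add_natCast_ge {z : ℂ} (hz : 0 ≤ z.re) (k : ℕ) :
    ‖z‖ ^ 2 + k ^ 2 ≤ ‖z + k‖ ^ 2 := by
  rw [Complex.sq_norm, Complex.sq_norm, normSq_apply, normSq_apply]
  simp
  have : 0 ≤ z.re * k := by positivity
  nlinarith

lemma norm_gudermann_add_natCast_le {z : ℂ} (hz : 0 ≤ z.re) (hz2 : 2 ≤ ‖z‖) (k : ℕ) :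
    ‖gudermann (z + k)‖ ≤ 2 * (1 + (k : ℝ) ^ 2)⁻¹ := by
  have h := normSq_add_natCast_ge hz k
  have h2 : (2 : ℝ) ^ 2 ≤ ‖z + k‖ ^ 2 := by nlinarith
  have h3 : 2 ≤ ‖z + k‖ := le_of_sq_le_sq h2 (norm_nonneg _)
  refine (norm_gudermann_le h3).trans ?_
  gcongr
  nlinarith

lemma summable_inv_one_add_sq : Summable fun k : ℕ => 2 * (1 + (k : ℝ) ^ 2)⁻¹ := by
  apply Summable.mul_left
  refine Summable.of_norm_bounded_eventually_nat
    (Real.summable_nat_pow_inv.2 (by norm_num : 1 < 2)) ?_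
  filter_upwards [eventually_gt_atTop 0] with k hk
  have : (0 : ℝ) < k := by exact_mod_cast hk
  rw [Real.norm_of_nonneg (by positivity)]
  gcongr
  linarith

lemma summable_gudermann {z : ℂ} (hz : 0 ≤ z.re) (hz2 : 2 ≤ ‖z‖) :
    Summable fun k : ℕ => gudermann (z + k) :=
  Summable.of_norm_bounded summable_inv_one_add_sq (norm_gudermann_add_natCast_le hz hz2)

/-- The remainder in Stirling's formula tends to zero at infinity in the right half-plane. -/
lemma tendsto_tsum_gudermann :
    Tendsto (fun z : ℂ => ∑' k : ℕ, gudermann (z + k))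
      (Bornology.cobounded ℂ ⊓ 𝓟 {z | 0 ≤ z.re}) (𝓝 0) := by
  have hnorm : Tendsto (fun z : ℂ => ‖z‖) (Bornology.cobounded ℂ ⊓ 𝓟 {z | 0 ≤ z.re}) atTop :=
    tendsto_norm_cobounded_atTop.mono_left inf_le_left
  have hre : ∀ᶠ z : ℂ in Bornology.cobounded ℂ ⊓ 𝓟 {z | 0 ≤ z.re}, 0 ≤ z.re :=
    eventually_inf_principal.2 (Eventually.of_forall fun _ h => h)
  rw [← tsum_zero (α := ℂ) (β := ℕ)]
  refine tendsto_tsum_of_dominated_convergence summable_inv_one_add_sq (fun k => ?_) ?_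
  · have h2 : Tendsto (fun z : ℂ => 2 * (‖z‖ ^ 2)⁻¹)
        (Bornology.cobounded ℂ ⊓ 𝓟 {z | 0 ≤ z.re}) (𝓝 0) := by
      have := (tendsto_inv_atTop_zero.comp
        ((tendsto_pow_atTop two_ne_zero).comp hnorm)).const_mul (2 : ℝ)
      rwa [mul_zero] at this
    refine squeeze_zero_norm' ?_ h2
    filter_upwards [hre, hnorm.eventually_ge_atTop 2] with z hz hz2
    have h := normSq_add_natCast_ge hz k
    have hk : (0 : ℝ) ≤ (k : ℝ) ^ 2 := by positivity
    have h3 : 2 ≤ ‖z + k‖ := le_of_sq_le_sq (by nlinarith) (norm_nonneg _)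
    refine (norm_gudermann_le h3).trans ?_
    have : 0 < ‖z‖ ^ 2 := by positivity
    have h4 : ‖z‖ ^ 2 ≤ ‖z + k‖ ^ 2 := by linarith
    exact mul_le_mul_of_nonneg_left (inv_anti₀ this h4) zero_le_two
  · filter_upwards [hre, hnorm.eventually_ge_atTop 2] with z hz hz2 k
    exact norm_gudermann_add_natCast_le hz hz2 k

/-- Stirling's formula for factorials, in the form in which it enters Euler's limit for `Γ(z)` after
the product `z (z + 1) ⋯ (z + n)` has been replaced by the telescoped sum. -/
lemma tendsto_stirling_prefactor (z : ℂ) (hz : 0 ≤ z.re) :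
    Tendsto (fun n : ℕ => (n : ℂ) ^ z * (n.factorial : ℂ) *
        exp ((n + 1 : ℕ) - (z + (n + 1 : ℕ) - 1 / 2) * log (z + (n + 1 : ℕ))))
      atTop (𝓝 ((Real.sqrt (2 * Real.pi) : ℂ) * exp (-z))) := by
  have hS : Tendsto (fun n : ℕ => (Real.sqrt 2 : ℂ) * (Stirling.stirlingSeq n : ℂ)) atTop
      (𝓝 ((Real.sqrt (2 * Real.pi) : ℂ))) := by
    rw [Real.sqrt_mul (by norm_num), ofReal_mul]
    exact ((continuous_ofReal.tendsto _).comp Stirling.tendsto_stirlingSeq_sqrt_pi).const_mul _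
  have hn1 : Tendsto (fun n : ℕ => (n : ℂ) * ((z + 1) / n)) atTop (𝓝 (z + 1)) := by
    refine tendsto_const_nhds.congr' ?_
    filter_upwards [eventually_gt_atTop 0] with n hn
    have : (n : ℂ) ≠ 0 := by exact_mod_cast hn.ne'
    field_simp
  have hlim0 : Tendsto (fun n : ℕ => (z + 1) / (n : ℂ)) atTop (𝓝 0) :=
    tendsto_const_div_atTop_nhds_zero_nat (z + 1)
  have hlog0 : Tendsto (fun n : ℕ => log (1 + (z + 1) / (n : ℂ))) atTop (𝓝 0) := by
    have := (continuousAt_clog (x := 1 + 0) (by simp)).tendsto.comp (hlim0.const_add 1)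
    rw [add_zero, log_one] at this
    exact this
  have hmul : Tendsto (fun n : ℕ => (n : ℂ) * log (1 + (z + 1) / (n : ℂ))) atTop (𝓝 (z + 1)) := by
    have h := tendsto_const_nhds (x := (1:ℂ)) (f := (atTop : Filter ℕ))
    have hd : Tendsto (fun u : ℂ => u⁻¹ * log (1 + u)) (𝓝[≠] 0) (𝓝 1) := by
      have : HasDerivAt (fun u : ℂ => log (1 + u)) 1 0 := by
        have h1 : HasDerivAt (fun u : ℂ => 1 + u) 1 0 := (hasDerivAt_id 0).const_add 1
        simpa using h1.clog (by simp)
      simpa [hasDerivAt_iff_tendsto_slope, slope_fun_def] using this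
    have hz1 : z + 1 ≠ 0 := by
      intro h
      have := congrArg re h
      simp at this
      linarith
    have hne : Tendsto (fun n : ℕ => (z + 1) / (n : ℂ)) atTop (𝓝[≠] 0) := by
      refine tendsto_nhdsWithin_iff.2 ⟨hlim0, ?_⟩
      filter_upwards [eventually_gt_atTop 0] with n hn
      have : (n : ℂ) ≠ 0 := by exact_mod_cast hn.ne'
      exact div_ne_zero hz1 this
    have h3 := (hd.comp hne).const_mul (z + 1)
    rw [mul_one] at h3
    refine h3.congr' ?_
    filter_upwards [eventually_gt_atTop 0] with n hn
    have : (n : ℂ) ≠ 0 := by exact_mod_cast hn.ne'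
    simp only [Function.comp]
    field_simp
  have hE : Tendsto (fun n : ℕ => exp (1 - ((n : ℂ) * log (1 + (z + 1) / (n : ℂ)) +
      (z + 1 / 2) * log (1 + (z + 1) / (n : ℂ))))) atTop (𝓝 (exp (-z))) := by
    refine (continuous_exp.tendsto _).comp ?_
    have h4 := (hmul.add (hlog0.const_mul (z + 1 / 2))).const_sub 1
    refine tendsto_of_tendsto_of_eq h4 ?_
    ring
  refine (hS.mul hE).congr' ?_
  filter_upwards [eventually_gt_atTop 0] with n hn
  have hn0 : (n : ℂ) ≠ 0 := by exact_mod_cast hn.ne'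
  have hnr : (0 : ℝ) < n := by exact_mod_cast hn
  have hne : 1 + (z + 1) / n ≠ 0 := by
    intro h
    field_simp at h
    have := congrArg re h
    simp at this
    linarith
  have hlog : log (z + (n + 1 : ℕ)) = Real.log n + log (1 + (z + 1) / n) := by
    rw [← log_ofReal_mul hnr hne]
    congr 1
    push_cast
    field_simp
    ring
  have hfac : (n.factorial : ℂ) = (Real.sqrt 2 : ℂ) * (Stirling.stirlingSeq n : ℂ) *
      exp (1 / 2 * Real.log n + n * Real.log n - n) := by
    have hh : (n.factorial : ℝ) = Real.sqrt 2 * Stirling.stirlingSeq n *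
        Real.exp (1 / 2 * Real.log n + n * Real.log n - n) := by
      rw [Stirling.stirlingSeq, Real.exp_sub, Real.exp_add, Real.sqrt_mul (by norm_num), div_pow,
        ← Real.exp_nat_mul, mul_one, ← Real.log_pow, Real.exp_log (by positivity),
        show (1 / 2 * Real.log n : ℝ) = Real.log n * (1 / 2) by ring, Real.exp_mul,
        Real.exp_log hnr, ← Real.sqrt_eq_rpow]
      field_simp
    rw [← ofReal_natCast, hh]
    push_cast
    rfl
  rw [hfac, cpow_def_of_ne_zero hn0, hlog, show log (n : ℂ) = Real.log n by simp,
    show ∀ a b c d e : ℂ, a * (b * c * d) * e = b * c * (a * d * e) by intros; ring,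
    ← exp_add, ← exp_add]
  congr 2
  push_cast
  ring

/-- Stirling's formula with its exact remainder, obtained by inserting the telescoped Gudermann sum
into Euler's limit for the Gamma function. -/
lemma Gamma_eq_stirling {z : ℂ} (hz : 0 ≤ z.re) (hz2 : 2 ≤ ‖z‖) :
    Gamma z = Real.sqrt (2 * Real.pi) * exp ((z - 1 / 2) * log z - z) *
      exp (∑' k : ℕ, gudermann (z + k)) := by
  have hz0 : z ≠ 0 := by
    rintro rfl
    norm_num at hz2
  refine tendsto_nhds_unique (GammaSeq_tendsto_Gamma z) ?_
  have h1 := (tendsto_stirling_prefactor z hz).mul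
    (((continuous_exp.tendsto _).comp
      ((summable_gudermann hz hz2).hasSum.tendsto_sum_nat.comp (tendsto_add_atTop_nat 1))).mul_const
        (exp ((z - 1 / 2) * log z)))
  refine tendsto_of_tendsto_of_eq (h1.congr fun n => ?_) ?_
  · have hp : ∏ k ∈ Finset.range (n + 1), (z + k) ≠ 0 := by
      refine Finset.prod_ne_zero_iff.2 fun k _ h => ?_
      have := normSq_add_natCast_ge hz k
      rw [h] at this
      have hk : (0 : ℝ) ≤ (k : ℝ) ^ 2 := by positivity
      rw [norm_zero] at this
      nlinarith
    rw [GammaSeq, eq_div_iff hp]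
    have h := exp_sum_gudermann_mul_prod hz hz0 (n + 1)
    simp only [Function.comp]
    rw [show ∀ a b c d e p : ℂ, a * b * c * (d * e) * p = a * b * (c * e * (d * p)) by intros; ring,
      h, ← exp_add, ← exp_add,
      show (n + 1 : ℕ) - (z + (n + 1 : ℕ) - 1 / 2) * log (z + (n + 1 : ℕ)) + (z - 1 / 2) * log z +
        ((z + (n + 1 : ℕ) - 1 / 2) * log (z + (n + 1 : ℕ)) - (z - 1 / 2) * log z - (n + 1 : ℕ))
        = 0 by ring, exp_zero, mul_one]
  · rw [sub_eq_add_neg _ z, exp_add]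
    ring

/-- The filter of points tending to infinity in the half-plane `Re z ≥ -M`. -/
def atInftyHalfPlane (M : ℝ) : Filter ℂ := Bornology.cobounded ℂ ⊓ 𝓟 {z | -M ≤ z.re}

lemma tendsto_norm_atInftyHalfPlane (M : ℝ) :
    Tendsto (fun z : ℂ => ‖z‖) (atInftyHalfPlane M) atTop :=
  tendsto_norm_cobounded_atTop.mono_left inf_le_left

lemma eventually_re_atInftyHalfPlane (M : ℝ) : ∀ᶠ z : ℂ in atInftyHalfPlane M, -M ≤ z.re :=
  eventually_inf_principal.2 (Eventually.of_forall fun _ h => h)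

lemma tendsto_atInftyHalfPlane {α : Type*} {l : Filter α} {f : α → ℂ} {M : ℝ}
    (h1 : Tendsto (fun x => ‖f x‖) l atTop) (h2 : ∀ᶠ x in l, -M ≤ (f x).re) :
    Tendsto f l (atInftyHalfPlane M) :=
  tendsto_inf.2 ⟨tendsto_norm_atTop_iff_cobounded.1 h1, tendsto_principal.2 h2⟩

lemma tendsto_const_div_atInftyHalfPlane (ν : ℂ) (M : ℝ) :
    Tendsto (fun z : ℂ => ν / z) (atInftyHalfPlane M) (𝓝 0) := by
  refine squeeze_zero_norm (a := fun z : ℂ => ‖ν‖ * ‖z‖⁻¹) (fun z => ?_) ?_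
  · rw [norm_div, div_eq_mul_inv]
  · have := (tendsto_inv_atTop_zero.comp (tendsto_norm_atInftyHalfPlane M)).const_mul ‖ν‖
    rwa [mul_zero] at this

/-- The main term `√(2π) z ^ (z + μ - 1/2) e ^ (-z)` of Stirling's formula for `Γ(z + μ)`. -/
def stirlingMain (μ z : ℂ) : ℂ := Real.sqrt (2 * Real.pi) * exp ((z + μ - 1 / 2) * log z - z)

lemma stirlingMain_ne_zero (μ z : ℂ) : stirlingMain μ z ≠ 0 := by
  refine mul_ne_zero ?_ (exp_ne_zero _)
  rw [Ne, ofReal_eq_zero, Real.sqrt_eq_zero']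
  have := Real.pi_pos
  linarith

/-- No branch cut is crossed when `log z` is compared with `log (z + ν)` for `ν` small against `z`
and `z + ν` in the right half-plane; `z` itself may lie slightly to the left of the imaginary axis.
-/
lemma log_add_eq {z ν : ℂ} (hz : z ≠ 0) (h : ‖ν / z‖ ≤ 1 / 2) (hu : 0 ≤ (z + ν).re) :
    log (z + ν) = log z + log (1 + ν / z) := by
  have h1 : 0 < (1 + ν / z).re := by
    have := (abs_le.1 ((abs_re_le_norm (ν / z)).trans h)).1
    rw [add_re, one_re]
    linarith
  have hne : 1 + ν / z ≠ 0 := by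
    intro h0
    rw [h0] at h1
    simp at h1
  have hprod : z + ν = z * (1 + ν / z) := by field_simp
  have hune : z + ν ≠ 0 := hprod ▸ mul_ne_zero hz hne
  have hexp : exp (log (z + ν)) = exp (log z + log (1 + ν / z)) := by
    rw [exp_add, exp_log hz, exp_log hne, exp_log hune, hprod]
  obtain ⟨n, hn⟩ := exp_eq_exp_iff_exists_int.1 hexp
  have him := congrArg im hn
  simp only [add_im, log_im, mul_im, intCast_re, intCast_im, re_ofNat, im_ofNat, ofReal_re,
    ofReal_im, I_re, I_im, mul_re] at him
  have b1 := abs_le.1 (abs_arg_le_pi_div_two_iff.2 hu)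
  have b2 := abs_lt.1 (abs_arg_lt_pi_div_two_iff.2 (Or.inl h1))
  have b3 := neg_pi_lt_arg z
  have b4 := arg_le_pi z
  have hπ := Real.pi_pos
  have hn0 : n = 0 := by
    by_contra hne0
    rcases lt_or_gt_of_ne hne0 with h | h
    · have : (n : ℝ) ≤ -1 := by exact_mod_cast Int.le_sub_one_of_lt h
      nlinarith
    · have : (1 : ℝ) ≤ n := by exact_mod_cast h
      nlinarith
  rw [hn, hn0]
  simp

lemma tendsto_add_mul_log (ν : ℂ) (M : ℝ) :
    Tendsto (fun z : ℂ => (z + ν - 1 / 2) * log (1 + ν / z)) (atInftyHalfPlane M) (𝓝 ν) := by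
  have h0 := tendsto_const_div_atInftyHalfPlane ν M
  have hn := tendsto_norm_atInftyHalfPlane M
  have hlog : Tendsto (fun z : ℂ => log (1 + ν / z)) (atInftyHalfPlane M) (𝓝 0) := by
    have := (continuousAt_clog (x := 1 + 0) (by simp)).tendsto.comp (h0.const_add 1)
    rw [add_zero, log_one] at this
    exact this
  have hz : Tendsto (fun z : ℂ => z * (log (1 + ν / z) - ν / z)) (atInftyHalfPlane M) (𝓝 0) := by
    refine squeeze_zero_norm' (a := fun z : ℂ => ‖ν‖ ^ 2 * ‖z‖⁻¹) ?_ ?_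
    · filter_upwards [(tendsto_zero_iff_norm_tendsto_zero.1 h0).eventually_le_const
        (by norm_num : (0 : ℝ) < 1 / 2), hn.eventually_gt_atTop 0] with z hz hz0
      have h1 := norm_log_one_add_sub_self_le (z := ν / z) (by linarith)
      have hinv : (1 - ‖ν / z‖)⁻¹ ≤ 2 := by
        rw [inv_le_comm₀ (by linarith) (by norm_num)]
        linarith
      rw [norm_mul]
      calc ‖z‖ * ‖log (1 + ν / z) - ν / z‖ ≤ ‖z‖ * (‖ν / z‖ ^ 2 * 2 / 2) := by
            gcongr
            exact h1.trans (by gcongr)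
        _ = _ := by
            rw [norm_div]
            field_simp
    · have := (tendsto_inv_atTop_zero.comp hn).const_mul (‖ν‖ ^ 2)
      rwa [mul_zero] at this
  have := (hz.add_const ν).add (hlog.const_mul (ν - 1 / 2))
  rw [zero_add, mul_zero, add_zero] at this
  refine this.congr' ?_
  filter_upwards [hn.eventually_gt_atTop 0] with z hz0
  have : z ≠ 0 := norm_pos_iff.1 hz0
  field_simp
  ring

/-- Stirling's formula when `z + ν` stays in the right half-plane. -/
lemma tendsto_Gamma_div_stirlingMain_aux {ν : ℂ} {M : ℝ} (hν : M ≤ ν.re) :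
    Tendsto (fun z : ℂ => Gamma (z + ν) / stirlingMain ν z) (atInftyHalfPlane M) (𝓝 1) := by
  have h0 := tendsto_const_div_atInftyHalfPlane ν M
  have hn := tendsto_norm_atInftyHalfPlane M
  have hre := eventually_re_atInftyHalfPlane M
  have hnu : Tendsto (fun z : ℂ => ‖z + ν‖) (atInftyHalfPlane M) atTop := by
    refine tendsto_atTop_mono (fun z => ?_) (tendsto_atTop_add_const_right _ (-‖ν‖) hn)
    have := norm_sub_le (z + ν) ν
    rw [add_sub_cancel_right] at this
    linarith
  have hu : Tendsto (fun z : ℂ => z + ν) (atInftyHalfPlane M)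
      (Bornology.cobounded ℂ ⊓ 𝓟 {z | 0 ≤ z.re}) := by
    refine tendsto_inf.2 ⟨tendsto_norm_atTop_iff_cobounded.1 hnu, tendsto_principal.2 ?_⟩
    filter_upwards [hre] with z hz
    simp
    linarith
  have h1 := (tendsto_add_mul_log ν M).sub_const ν |>.add (tendsto_tsum_gudermann.comp hu)
  rw [sub_self, zero_add] at h1
  have h2 := (continuous_exp.tendsto _).comp h1
  rw [exp_zero] at h2
  refine h2.congr' ?_
  filter_upwards [(tendsto_zero_iff_norm_tendsto_zero.1 h0).eventually_le_const
    (by norm_num : (0 : ℝ) < 1 / 2), hn.eventually_gt_atTop 0, hnu.eventually_ge_atTop 2, hre]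
    with z hz1 hz0 hz2 hz3
  have hz : z ≠ 0 := norm_pos_iff.1 hz0
  have hre : 0 ≤ (z + ν).re := by
    simp
    linarith
  rw [eq_div_iff (stirlingMain_ne_zero _ _), Gamma_eq_stirling hre hz2, stirlingMain,
    log_add_eq hz hz1 hre]
  simp only [Function.comp]
  rw [show ∀ a b c : ℂ, a * (b * c) = b * (a * c) by intros; ring, ← exp_add, mul_assoc, ← exp_add]
  congr 2
  ring

/-- **Stirling's formula** in a half-plane: `Γ(z + μ) ∼ √(2π) z ^ (z + μ - 1/2) e ^ (-z)` as
`z → ∞` with `Re z ≥ -M`. -/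
lemma tendsto_Gamma_div_stirlingMain (μ : ℂ) (M : ℝ) :
    Tendsto (fun z : ℂ => Gamma (z + μ) / stirlingMain μ z) (atInftyHalfPlane M) (𝓝 1) := by
  obtain ⟨k, hk⟩ := exists_nat_ge (M - μ.re)
  induction k generalizing μ with
  | zero => exact tendsto_Gamma_div_stirlingMain_aux (by simpa using hk)
  | succ k ih =>
    -- pass from `μ + 1` to `μ` by `Γ(z + μ + 1) = (z + μ) Γ(z + μ)`
    have h1 := ih (μ + 1) (by simp at hk ⊢; linarith)
    have h2 : Tendsto (fun z : ℂ => (1 + μ / z)⁻¹) (atInftyHalfPlane M) (𝓝 1) := by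
      have := ((tendsto_const_div_atInftyHalfPlane μ M).const_add 1).inv₀ (by simp)
      simpa using this
    have h3 := h1.mul h2
    rw [mul_one] at h3
    refine h3.congr' ?_
    filter_upwards [(tendsto_norm_atInftyHalfPlane M).eventually_gt_atTop ‖μ‖] with z hz
    have hz0 : z ≠ 0 := norm_pos_iff.1 ((norm_nonneg _).trans_lt hz)
    have hzμ : z + μ ≠ 0 := by
      intro h
      rw [eq_neg_of_add_eq_zero_left h, norm_neg] at hz
      exact lt_irrefl _ hz
    have hS : stirlingMain (μ + 1) z = stirlingMain μ z * z := by
      nth_rewrite 3 [← exp_log hz0]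
      rw [stirlingMain, stirlingMain, mul_assoc, ← exp_add]
      congr 2
      ring
    have := stirlingMain_ne_zero μ z
    rw [hS, ← add_assoc, Gamma_add_one _ hzμ]
    field_simp

/-- Stirling's formula for a product of Gamma factors. -/
lemma tendsto_prod_Gamma {r : ℕ} (lam : Fin r → ℝ) (mu : Fin r → ℂ) (hlam : ∀ j, 0 < lam j)
    (M : ℝ) :
    Tendsto (fun s : ℂ => (∏ j, Gamma (lam j * s + mu j)) *
        exp (-(((∑ j, (lam j : ℂ)) * s + ∑ j, (mu j - 1 / 2)) * log s +
          s * (∑ j, (lam j : ℂ) * Real.log (lam j) - ∑ j, (lam j : ℂ)) +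
          ∑ j, (mu j - 1 / 2) * Real.log (lam j))))
      (atInftyHalfPlane M) (𝓝 ((Real.sqrt (2 * Real.pi) : ℂ) ^ r)) := by
  have hn := tendsto_norm_atInftyHalfPlane M
  have h1 : ∀ j, Tendsto (fun s : ℂ => Gamma (lam j * s + mu j) / stirlingMain (mu j) (lam j * s))
      (atInftyHalfPlane M) (𝓝 1) := fun j => by
    refine (tendsto_Gamma_div_stirlingMain (mu j) (lam j * M)).comp
      (tendsto_atInftyHalfPlane ?_ ?_)
    · simp only [norm_mul, norm_real, Real.norm_of_nonneg (hlam j).le]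
      exact hn.const_mul_atTop (hlam j)
    · filter_upwards [eventually_re_atInftyHalfPlane M] with s hs
      rw [re_ofReal_mul]
      nlinarith [hlam j]
  have h2 := (tendsto_finsetProd Finset.univ fun j _ => h1 j).mul_const
    ((Real.sqrt (2 * Real.pi) : ℂ) ^ r)
  rw [Finset.prod_const_one, one_mul] at h2
  refine h2.congr' ?_
  filter_upwards [hn.eventually_gt_atTop 0] with s hs0
  have hs : s ≠ 0 := norm_pos_iff.1 hs0
  have hS : ∏ j, stirlingMain (mu j) (lam j * s) = (Real.sqrt (2 * Real.pi) : ℂ) ^ r *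
      exp (((∑ j, (lam j : ℂ)) * s + ∑ j, (mu j - 1 / 2)) * log s +
          s * (∑ j, (lam j : ℂ) * Real.log (lam j) - ∑ j, (lam j : ℂ)) +
          ∑ j, (mu j - 1 / 2) * Real.log (lam j)) := by
    simp only [stirlingMain]
    rw [Finset.prod_mul_distrib, Finset.prod_const, Finset.card_fin, ← exp_sum]
    congr 2
    simp only [mul_sub, Finset.mul_sum, Finset.sum_mul, add_mul, ← Finset.sum_add_distrib,
      ← Finset.sum_sub_distrib]
    refine Finset.sum_congr rfl fun j _ => ?_
    rw [log_ofReal_mul (hlam j) hs]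
    ring
  have : (Real.sqrt (2 * Real.pi) : ℂ) ^ r ≠ 0 := by
    refine pow_ne_zero _ ?_
    rw [Ne, ofReal_eq_zero, Real.sqrt_eq_zero']
    have := Real.pi_pos
    linarith
  rw [Finset.prod_div_distrib, hS, exp_neg, div_mul_eq_mul_div,
    mul_comm ((Real.sqrt (2 * Real.pi) : ℂ) ^ r) (exp _), mul_div_mul_right _ _ this,
    div_eq_mul_inv]

/-! ### The quotient of the Gamma factors -/

lemma ofReal_cpow_eq_exp {x : ℝ} (hx : 0 < x) (s : ℂ) : (x : ℂ) ^ s = exp (Real.log x * s) := by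
  rw [cpow_def_of_ne_zero (ofReal_ne_zero.2 hx.ne'), ofReal_log hx.le]

namespace SelbergData

/-- The quotient `R(s) = ω conj (γ (conj s)) / γ (1 - s)`, with which the functional equation reads
`F (1 - s) = R(s) conj (F (conj s))`. -/
def funRatio (D : SelbergData) (s : ℂ) : ℂ :=
  D.omega * (D.Q : ℂ) ^ (2 * s - 1) * (∏ j, Gamma (D.lam j * s + starRingEnd ℂ (D.mu j))) /
    ∏ j, Gamma (D.lam j * (1 - s) + D.mu j)

lemma conj_gammaFactor_conj (D : SelbergData) (s : ℂ) :
    starRingEnd ℂ (D.gammaFactor (starRingEnd ℂ s)) =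
      (D.Q : ℂ) ^ s * ∏ j, Gamma (D.lam j * s + starRingEnd ℂ (D.mu j)) := by
  rw [gammaFactor, map_mul, map_prod]
  congr 1
  · have := cpow_conj (D.Q : ℂ) (starRingEnd ℂ s)
      (by rw [arg_ofReal_of_nonneg D.Q_pos.le]; exact Real.pi_pos.ne)
    rw [conj_conj, conj_ofReal] at this
    exact this.symm
  · refine Finset.prod_congr rfl fun j _ => ?_
    rw [← Gamma_conj]
    simp

lemma Q_ne_zero (D : SelbergData) : (D.Q : ℂ) ≠ 0 := ofReal_ne_zero.2 D.Q_pos.ne'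

lemma gammaFactor_ne_zero (D : SelbergData) {s : ℂ} (hs : D.GammaRegularAt s) :
    D.gammaFactor s ≠ 0 := by
  refine mul_ne_zero (fun h => D.Q_ne_zero (cpow_eq_zero_iff _ _ |>.1 h).1) ?_
  exact Finset.prod_ne_zero_iff.2 fun j _ => Gamma_ne_zero fun m => hs j m

lemma funRatio_eq (D : SelbergData) (s : ℂ) :
    D.funRatio s = D.omega * starRingEnd ℂ (D.gammaFactor (starRingEnd ℂ s)) /
      D.gammaFactor (1 - s) := by
  rw [conj_gammaFactor_conj, gammaFactor, funRatio, show 2 * s - 1 = s - (1 - s) by ring,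
    cpow_sub _ _ D.Q_ne_zero]
  simp only [div_eq_mul_inv, mul_inv]
  ring

lemma exists_gammaRegularAt (D : SelbergData) :
    ∃ T : ℝ, 0 < T ∧ ∀ s : ℂ, T ≤ |s.im| → D.GammaRegularAt s := by
  refine ⟨1 + ∑ j, |(D.mu j).im| / D.lam j, ?_, fun s hs j k h => ?_⟩
  · have : 0 ≤ ∑ j, |(D.mu j).im| / D.lam j :=
      Finset.sum_nonneg fun j _ => div_nonneg (abs_nonneg _) (D.lam_pos j).le
    linarith
  · have h1 := congrArg im h
    simp at h1
    have h2 : |(D.mu j).im| / D.lam j ≤ ∑ j, |(D.mu j).im| / D.lam j :=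
      Finset.single_le_sum (f := fun j => |(D.mu j).im| / D.lam j)
        (fun j _ => div_nonneg (abs_nonneg _) (D.lam_pos j).le) (Finset.mem_univ j)
    have h3 : |(D.mu j).im| = D.lam j * |s.im| := by
      rw [eq_neg_of_add_eq_zero_right h1, abs_neg, abs_mul, abs_of_pos (D.lam_pos j)]
    rw [h3, mul_div_cancel_left₀ _ (D.lam_pos j).ne'] at h2
    linarith

lemma beta_pos (D : SelbergData) : 0 < D.beta :=
  Finset.prod_pos fun j _ => Real.rpow_pos_of_pos (D.lam_pos j) _

lemma conductor_pos (D : SelbergData) : 0 < D.conductor := by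
  have := D.beta_pos
  have := D.Q_pos
  have := Real.pi_pos
  unfold conductor
  positivity

lemma conductor_eq (D : SelbergData) (hd : D.degree = 1) :
    D.conductor = 2 * Real.pi * D.Q ^ 2 * D.beta := by
  rw [conductor, hd, Real.rpow_one]

lemma log_beta (D : SelbergData) : Real.log D.beta = 2 * ∑ j, D.lam j * Real.log (D.lam j) := by
  rw [beta, Real.log_prod (fun j _ => (Real.rpow_pos_of_pos (D.lam_pos j) _).ne'), Finset.mul_sum]
  refine Finset.sum_congr rfl fun j _ => ?_
  rw [Real.log_rpow (D.lam_pos j)]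
  ring

lemma log_conductor (D : SelbergData) (hd : D.degree = 1) :
    Real.log D.conductor = Real.log (2 * Real.pi) + 2 * Real.log D.Q +
      2 * ∑ j, D.lam j * Real.log (D.lam j) := by
  have := D.beta_pos
  have := D.Q_pos
  have := Real.pi_pos
  rw [conductor_eq D hd, Real.log_mul (by positivity) (by positivity),
    Real.log_mul (by positivity) (by positivity), Real.log_pow, log_beta]
  push_cast
  ring

lemma rootNumber_eq (D : SelbergData) :
    D.rootNumber = D.omega * exp ((2 * ∑ j, (D.lam j : ℂ) * Real.log (D.lam j) +
      2 * Real.log D.Q) * (I * D.theta) -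
      2 * I * ∑ j, ((D.mu j).im : ℂ) * Real.log (D.lam j)) := by
  have hb := D.beta_pos
  have hQ := D.Q_pos
  rw [rootNumber, ofReal_cpow_eq_exp (by positivity), Real.log_mul hb.ne' (by positivity),
    Real.log_pow, log_beta, mul_assoc, sub_eq_add_neg, exp_add]
  congr 2
  · congr 1
    push_cast
    ring
  · rw [Finset.prod_congr rfl fun j _ => ofReal_cpow_eq_exp (D.lam_pos j) _, ← exp_sum]
    congr 1
    rw [Finset.mul_sum, ← Finset.sum_neg_distrib]
    refine Finset.sum_congr rfl fun j _ => ?_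
    ring

lemma sum_mu_sub_half (D : SelbergData) :
    ∑ j, (D.mu j - 1 / 2) = (D.eta + I * D.theta) / 2 := by
  rw [eta, theta, mul_comm I, re_add_im, xi]
  ring

lemma sum_conj_mu_sub_half (D : SelbergData) :
    ∑ j, (starRingEnd ℂ (D.mu j) - 1 / 2) = (D.eta - I * D.theta) / 2 := by
  have := congrArg (starRingEnd ℂ) D.sum_mu_sub_half
  simp only [map_sum, map_sub, map_div₀, map_one, map_add, map_mul, conj_I, conj_ofReal,
    map_ofNat] at this
  rw [this]
  ring

/-- The branches of `log (-s)` and `log s` differ by `κπi`, with `κ` minus the sign of `Im s`. -/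
lemma log_neg_of_im {s : ℂ} {κ : ℝ} (hκ : κ = 1 ∨ κ = -1) (hs : 0 < -κ * s.im) :
    log (-s) = log s + κ * Real.pi * I := by
  rcases hκ with rfl | rfl
  · have : s.im < 0 := by linarith
    rw [log, log, norm_neg, arg_neg_eq_arg_add_pi_of_im_neg this]
    push_cast
    ring
  · have : 0 < s.im := by linarith
    rw [log, log, norm_neg, arg_neg_eq_arg_sub_pi_of_im_pos this]
    push_cast
    ring

/-- The model for `funRatio` on the half-lines `Re s = 2`, `κ Im s < 0`: one of the two terms of
the functional equation of a Dirichlet series with coefficients of period `q`. -/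
def dirichletTerm (D : SelbergData) (κ : ℝ) (w : ℂ) : ℂ :=
  (D.conductor : ℂ) ^ (w - 1) * ((2 * Real.pi : ℝ) : ℂ) ^ (-w) * Gamma w *
    exp (κ * Real.pi * I * w / 2)

/-- The limit of the quotient of `funRatio` and `dirichletTerm`. -/
def limitConst (D : SelbergData) (κ : ℝ) : ℂ :=
  D.rootNumber * (D.conductor : ℂ) ^ (1 / 2 : ℂ) * exp (-κ * Real.pi * I * (D.eta + 1) / 2)

/-- The Stirling main terms of `funRatio` add up to `limitConst` times those of `dirichletTerm`. The
powers of `Q` and of the `λ_j` combine to the conductor and the root number; the exponents of `s`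
match because the degree is `1`. -/
lemma stirling_exponent_identity (D : SelbergData) (hd : D.degree = 1) {s : ℂ} {κ : ℝ}
    (hκ : κ = 1 ∨ κ = -1) (hs : 0 < -κ * s.im) :
    D.omega * (D.Q : ℂ) ^ (2 * s - 1) *
      exp (((∑ j, (D.lam j : ℂ)) * s + ∑ j, (starRingEnd ℂ (D.mu j) - 1 / 2)) * log s +
          s * (∑ j, (D.lam j : ℂ) * Real.log (D.lam j) - ∑ j, (D.lam j : ℂ)) +
          ∑ j, (starRingEnd ℂ (D.mu j) - 1 / 2) * Real.log (D.lam j)) *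
      exp (-(((∑ j, (D.lam j : ℂ)) * (-s) + ∑ j, (D.lam j + D.mu j - 1 / 2)) * log (-s) +
          (-s) * (∑ j, (D.lam j : ℂ) * Real.log (D.lam j) - ∑ j, (D.lam j : ℂ)) +
          ∑ j, (D.lam j + D.mu j - 1 / 2) * Real.log (D.lam j))) =
    D.limitConst κ * ((D.conductor : ℂ) ^ (s - I * D.theta - 1) *
      ((2 * Real.pi : ℝ) : ℂ) ^ (-(s - I * D.theta)) * stirlingMain (-(I * D.theta)) s *
        exp (κ * Real.pi * I * (s - I * D.theta) / 2)) := by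
  have hΛ : ∑ j, (D.lam j : ℂ) = 1 / 2 := by
    have h1 : ∑ j, D.lam j = 1 / 2 := by
      rw [degree] at hd
      linarith
    rw [← ofReal_sum, h1]
    norm_num
  have hA : ∑ j, (D.lam j + D.mu j - 1 / 2) = 1 / 2 + (D.eta + I * D.theta) / 2 := by
    rw [← sum_mu_sub_half, ← hΛ, ← Finset.sum_add_distrib]
    exact Finset.sum_congr rfl fun j _ => by ring
  have hC : ∑ j, (D.lam j + D.mu j - 1 / 2) * Real.log (D.lam j) =
      ∑ j, (starRingEnd ℂ (D.mu j) - 1 / 2) * Real.log (D.lam j) +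
        ∑ j, (D.lam j : ℂ) * Real.log (D.lam j) +
        2 * I * ∑ j, ((D.mu j).im : ℂ) * Real.log (D.lam j) := by
    rw [Finset.mul_sum, ← Finset.sum_add_distrib, ← Finset.sum_add_distrib]
    refine Finset.sum_congr rfl fun j _ => ?_
    have : D.mu j = starRingEnd ℂ (D.mu j) + 2 * I * (D.mu j).im := by
      apply Complex.ext <;> simp
      ring
    nth_rewrite 1 [this]
    ring
  have hπ : (0 : ℝ) < 2 * Real.pi := by
    have := Real.pi_pos
    linarith
  have hsq : (Real.sqrt (2 * Real.pi) : ℂ) = exp (Real.log (2 * Real.pi) * (1 / 2)) := by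
    rw [← ofReal_cpow_eq_exp hπ, Real.sqrt_eq_rpow, ofReal_cpow hπ.le]
    norm_num
  rw [hΛ, hA, hC, sum_conj_mu_sub_half, log_neg_of_im hκ hs, limitConst, rootNumber_eq,
    stirlingMain, hsq, ofReal_cpow_eq_exp D.Q_pos, ofReal_cpow_eq_exp D.conductor_pos,
    ofReal_cpow_eq_exp D.conductor_pos, ofReal_cpow_eq_exp hπ, log_conductor D hd]
  simp only [mul_assoc, ← exp_add]
  congr 2
  push_cast
  generalize ∑ j, (starRingEnd ℂ (D.mu j) - 1 / 2) * (Real.log (D.lam j) : ℂ) = c1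
  generalize ∑ j, (D.lam j : ℂ) * (Real.log (D.lam j) : ℂ) = c2
  generalize ∑ j, ((D.mu j).im : ℂ) * (Real.log (D.lam j) : ℂ) = c3
  ring

/-- The half-line `Re s = 2`, `κ Im s < 0`, parametrized by `t > 0`. -/
def halfLine (κ t : ℝ) : ℂ := 2 - κ * t * I

@[simp] lemma halfLine_re (κ t : ℝ) : (halfLine κ t).re = 2 := by simp [halfLine]

@[simp] lemma halfLine_im (κ t : ℝ) : (halfLine κ t).im = -(κ * t) := by simp [halfLine]

lemma tendsto_norm_halfLine {κ : ℝ} (hκ : κ = 1 ∨ κ = -1) :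
    Tendsto (fun t => ‖halfLine κ t‖) atTop atTop := by
  refine tendsto_atTop_mono (fun t => ?_) tendsto_id
  refine le_trans ?_ (abs_im_le_norm _)
  rw [halfLine_im]
  rcases hκ with rfl | rfl
  · simpa using le_abs_self t
  · simpa using le_abs_self t

/-- On the half-line `Re s = 2`, `κ Im s < 0`, the quotient of the Gamma factors is asymptotically
that of a Dirichlet L-function, shifted by `iθ`. -/
lemma tendsto_funRatio_div_dirichletTerm (D : SelbergData) (hd : D.degree = 1) {κ : ℝ}
    (hκ : κ = 1 ∨ κ = -1) :
    Tendsto (fun t : ℝ => D.funRatio (halfLine κ t) /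
      D.dirichletTerm κ (halfLine κ t - I * D.theta)) atTop (𝓝 (D.limitConst κ)) := by
  have hn := tendsto_norm_halfLine hκ
  have hs : Tendsto (halfLine κ) atTop (atInftyHalfPlane 2) :=
    tendsto_atInftyHalfPlane hn (Eventually.of_forall fun t => by simp)
  have hs' : Tendsto (fun t => -halfLine κ t) atTop (atInftyHalfPlane 2) :=
    tendsto_atInftyHalfPlane (by simpa using hn) (Eventually.of_forall fun t => by simp)
  have h1 := (tendsto_prod_Gamma D.lam (fun j => starRingEnd ℂ (D.mu j)) D.lam_pos 2).comp hs
  have h2 := (tendsto_prod_Gamma D.lam (fun j => D.lam j + D.mu j) D.lam_pos 2).comp hs'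
  have h3 := (tendsto_Gamma_div_stirlingMain (-(I * D.theta)) 2).comp hs
  have hc : (Real.sqrt (2 * Real.pi) : ℂ) ^ D.r ≠ 0 := by
    refine pow_ne_zero _ ?_
    rw [Ne, ofReal_eq_zero, Real.sqrt_eq_zero']
    have := Real.pi_pos
    linarith
  have h4 := ((h1.div h2 hc).div h3 one_ne_zero).const_mul (D.limitConst κ)
  rw [div_self hc, div_one, mul_one] at h4
  refine h4.congr' ?_
  filter_upwards [eventually_gt_atTop 0] with t ht
  have him : 0 < -κ * (halfLine κ t).im := by
    rw [halfLine_im]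
    rcases hκ with rfl | rfl <;> linarith
  have key := D.stirling_exponent_identity hd hκ him
  simp only [Function.comp, Pi.div_apply]
  generalize halfLine κ t = s at *
  rw [funRatio, dirichletTerm, sub_eq_add_neg s (I * D.theta), ← sub_eq_add_neg]
  have e1 : ∏ j, Gamma (D.lam j * (1 - s) + D.mu j) =
      ∏ j, Gamma (D.lam j * (-s) + (D.lam j + D.mu j)) :=
    Finset.prod_congr rfl fun j _ => by ring_nf
  rw [e1]
  have hS := stirlingMain_ne_zero (-(I * D.theta)) s
  have hq : (D.conductor : ℂ) ^ (s - I * D.theta - 1) ≠ 0 := by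
    rw [ofReal_cpow_eq_exp D.conductor_pos]
    exact exp_ne_zero _
  have hπ : ((2 * Real.pi : ℝ) : ℂ) ^ (-(s - I * D.theta)) ≠ 0 := by
    rw [ofReal_cpow_eq_exp (by have := Real.pi_pos; linarith)]
    exact exp_ne_zero _
  have hx := exp_ne_zero (κ * Real.pi * I * (s - I * D.theta) / 2)
  have key' := (eq_div_iff (mul_ne_zero (mul_ne_zero (mul_ne_zero hq hπ) hS) hx)).2 key.symm
  rw [key', exp_neg, exp_neg]
  have hE1 := exp_ne_zero (((∑ j, (D.lam j : ℂ)) * s +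
    ∑ j, (starRingEnd ℂ (D.mu j) - 1 / 2)) * log s +
          s * (∑ j, (D.lam j : ℂ) * Real.log (D.lam j) - ∑ j, (D.lam j : ℂ)) +
          ∑ j, (starRingEnd ℂ (D.mu j) - 1 / 2) * Real.log (D.lam j))
  have hE2 := exp_ne_zero (((∑ j, (D.lam j : ℂ)) * (-s) +
    ∑ j, (D.lam j + D.mu j - 1 / 2)) * log (-s) +
          (-s) * (∑ j, (D.lam j : ℂ) * Real.log (D.lam j) - ∑ j, (D.lam j : ℂ)) +
          ∑ j, (D.lam j + D.mu j - 1 / 2) * Real.log (D.lam j))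
  revert hE1 hE2 hS hq hπ hx
  generalize exp (((∑ j, (D.lam j : ℂ)) * s +
    ∑ j, (starRingEnd ℂ (D.mu j) - 1 / 2)) * log s +
          s * (∑ j, (D.lam j : ℂ) * Real.log (D.lam j) - ∑ j, (D.lam j : ℂ)) +
          ∑ j, (starRingEnd ℂ (D.mu j) - 1 / 2) * Real.log (D.lam j)) = E1
  generalize exp (((∑ j, (D.lam j : ℂ)) * (-s) +
    ∑ j, (D.lam j + D.mu j - 1 / 2)) * log (-s) +
          (-s) * (∑ j, (D.lam j : ℂ) * Real.log (D.lam j) - ∑ j, (D.lam j : ℂ)) +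
          ∑ j, (D.lam j + D.mu j - 1 / 2) * Real.log (D.lam j)) = E2
  generalize exp (κ * Real.pi * I * (s - I * D.theta) / 2) = X
  generalize stirlingMain (-(I * D.theta)) s = S
  generalize (D.conductor : ℂ) ^ (s - I * D.theta - 1) = q
  generalize ((2 * Real.pi : ℝ) : ℂ) ^ (-(s - I * D.theta)) = p
  intro hS hq hπ hx hE1 hE2
  field_simp

end SelbergData

open MeasureTheory Set

/-! ### Abelian means of trigonometric series -/

lemma integrableOn_cpow_mul_exp_neg_mul {a r : ℂ} (ha : 0 < a.re) (hr : 0 < r.re) :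
    IntegrableOn (fun t : ℝ => (t : ℂ) ^ (a - 1) * exp (-(r * t))) (Ioi 0) := by
  have h := integrableOn_rpow_mul_exp_neg_mul_rpow (p := 1) (s := a.re - 1) (b := r.re)
    (by linarith) one_pos hr
  refine Integrable.mono' h ?_ ?_
  · refine ContinuousOn.aestronglyMeasurable (fun t ht => ?_) measurableSet_Ioi
    refine ContinuousAt.continuousWithinAt (ContinuousAt.mul ?_ (by fun_prop))
    exact continuousAt_ofReal_cpow_const t _ (Or.inr (ne_of_gt ht))
  · refine (ae_restrict_mem measurableSet_Ioi).mono fun t ht => le_of_eq ?_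
    rw [norm_mul, norm_cpow_eq_rpow_re_of_pos ht, norm_exp]
    simp

lemma differentiableOn_integral_cpow_mul_exp_neg_mul {a : ℂ} (ha : 0 < a.re) :
    DifferentiableOn ℂ (fun r : ℂ => ∫ t : ℝ in Ioi 0, (t : ℂ) ^ (a - 1) * exp (-(r * t)))
      {r | 0 < r.re} := by
  intro r₀ (hr₀ : 0 < r₀.re)
  have hs : {r : ℂ | r₀.re / 2 < r.re} ∈ 𝓝 r₀ :=
    (isOpen_lt continuous_const continuous_re).mem_nhds (by simp; linarith)
  have hF' : ∀ r : ℂ, (fun t : ℝ => (t : ℂ) ^ (a - 1) * (-t * exp (-(r * t)))) =ᵐ[volume.restrict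
      (Ioi 0)] fun t : ℝ => -((t : ℂ) ^ (a + 1 - 1) * exp (-(r * t))) := fun r => by
    refine (ae_restrict_mem measurableSet_Ioi).mono fun t ht => ?_
    have ht0 : (t : ℂ) ≠ 0 := ofReal_ne_zero.2 (ne_of_gt ht)
    simp only
    rw [add_sub_right_comm, cpow_add _ _ ht0, cpow_one]
    ring
  refine (hasDerivAt_integral_of_dominated_loc_of_deriv_le
    (F := fun r t => (t : ℂ) ^ (a - 1) * exp (-(r * t)))
    (F' := fun r t => (t : ℂ) ^ (a - 1) * (-t * exp (-(r * t))))
    (bound := fun t : ℝ => t ^ a.re * Real.exp (-(r₀.re / 2) * t ^ (1 : ℝ))) hs ?_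
    (integrableOn_cpow_mul_exp_neg_mul ha hr₀) ?_ ?_ ?_ ?_).2.differentiableAt.differentiableWithinAt
  · filter_upwards [hs] with r hr
    exact (integrableOn_cpow_mul_exp_neg_mul ha (lt_trans (by positivity) hr)).1
  · exact ((integrableOn_cpow_mul_exp_neg_mul (a := a + 1) (by simp; linarith)
      hr₀).neg.congr (hF' r₀).symm).1
  · refine (ae_restrict_mem measurableSet_Ioi).mono fun t ht r hr => ?_
    have ht' : 0 < t := ht
    have hr' : r₀.re / 2 < r.re := hr
    rw [norm_mul, norm_mul, norm_cpow_eq_rpow_re_of_pos ht', norm_exp, norm_neg, norm_real,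
      Real.norm_of_nonneg ht'.le, ← mul_assoc]
    have : t ^ (a - 1).re * t = t ^ a.re := by
      rw [← Real.rpow_add_one ht'.ne']
      simp
    rw [this]
    gcongr
    simp
    nlinarith
  · exact integrableOn_rpow_mul_exp_neg_mul_rpow (by linarith) one_pos (by positivity)
  · refine Eventually.of_forall fun t r _ => ?_
    have h1 : HasDerivAt (fun r : ℂ => -(r * t)) (-(1 * t)) r :=
      ((hasDerivAt_id r).mul_const _).neg
    have := h1.cexp.const_mul ((t : ℂ) ^ (a - 1))
    exact this.congr_deriv (by ring)

/-- Euler's integral for the Gamma function, with a complex scaling parameter `r`. -/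
lemma integral_cpow_mul_exp_neg_mul {a r : ℂ} (ha : 0 < a.re) (hr : 0 < r.re) :
    ∫ t : ℝ in Ioi 0, (t : ℂ) ^ (a - 1) * exp (-(r * t)) = r ^ (-a) * Gamma a := by
  have hopen : IsOpen {r : ℂ | 0 < r.re} := isOpen_lt continuous_const continuous_re
  have h1 := (differentiableOn_integral_cpow_mul_exp_neg_mul ha).analyticOnNhd hopen
  have h2 : AnalyticOnNhd ℂ (fun r : ℂ => r ^ (-a) * Gamma a) {r | 0 < r.re} := by
    refine DifferentiableOn.analyticOnNhd (fun r hr => ?_) hopen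
    refine DifferentiableAt.differentiableWithinAt ?_
    exact (differentiableAt_id.cpow_const (Or.inl hr)).mul_const _
  have hconv : IsPreconnected {r : ℂ | 0 < r.re} := (convex_halfSpace_re_gt 0).isPreconnected
  refine h1.eqOn_of_preconnected_of_frequently_eq h2 hconv (z₀ := 1) (by simp) ?_ hr
  have hlim : Tendsto (fun n : ℕ => ((1 + 1 / ((n : ℝ) + 1) : ℝ) : ℂ)) atTop (𝓝[≠] 1) := by
    refine tendsto_nhdsWithin_iff.2 ⟨?_, Eventually.of_forall fun n => ?_⟩
    · have := (continuous_ofReal.tendsto _).comp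
        (tendsto_one_div_add_atTop_nhds_zero_nat.const_add (1 : ℝ))
      simpa [Function.comp_def] using this
    · have : (0 : ℝ) < 1 / ((n : ℝ) + 1) := by positivity
      rw [mem_compl_singleton_iff, ← ofReal_one, Ne, ofReal_inj]
      linarith
  refine hlim.frequently (Frequently.of_forall fun n => ?_)
  have hpos : (0 : ℝ) < 1 + 1 / ((n : ℝ) + 1) := by positivity
  rw [Complex.integral_cpow_mul_exp_neg_mul_Ioi ha hpos, cpow_neg, one_div, inv_cpow]
  rw [arg_ofReal_of_nonneg hpos.le]
  exact Real.pi_pos.ne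

lemma norm_cpow_neg_le (θ : ℝ) {z : ℂ} (hz : z ≠ 0) :
    ‖z ^ (-(1 - I * θ))‖ ≤ ‖z‖⁻¹ * Real.exp (Real.pi * |θ|) := by
  rw [norm_cpow_of_ne_zero hz]
  simp only [neg_re, sub_re, one_re, mul_re, I_re, ofReal_re, I_im, ofReal_im, neg_im, sub_im,
    one_im, mul_im]
  ring_nf
  rw [Real.rpow_neg_one, ← Real.exp_neg]
  gcongr
  have h := abs_arg_le_pi z
  calc -(θ * z.arg) ≤ |θ * z.arg| := neg_le_abs _
    _ = |z.arg| * |θ| := by rw [abs_mul, mul_comm]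
    _ ≤ Real.pi * |θ| := by gcongr

/-- An Abelian theorem: as `P → -iδ₀` along a curve in the right half-plane, only the terms of
frequency `δ₀` contribute to the leading order of the Laplace transform. -/
lemma tendsto_abel_sum (θ : ℝ) {b : ℕ → ℂ} (hb : Summable fun n => ‖b n‖) (ρ : ℕ → ℝ) (δ₀ : ℝ)
    {P : ℝ → ℂ} {c : ℝ} (hc : 0 < c) (hP : ∀ᶠ y in 𝓝[>] (0 : ℝ), c * y ≤ (P y).re)
    {v : ℂ} (hv : 0 < v.re)
    (hlim : Tendsto (fun y : ℝ => (P y + I * δ₀) / y) (𝓝[>] 0) (𝓝 v)) :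
    Tendsto (fun y : ℝ => (y : ℂ) ^ (1 - I * θ) * ∑' n, b n * (P y + I * ρ n) ^ (-(1 - I * θ)))
      (𝓝[>] 0) (𝓝 (∑' n, if ρ n = δ₀ then b n * v ^ (-(1 - I * θ)) else 0)) := by
  have hpos : ∀ᶠ y in 𝓝[>] (0 : ℝ), 0 < y := eventually_mem_nhdsWithin
  have hy0 : Tendsto (fun y : ℝ => (y : ℂ)) (𝓝[>] 0) (𝓝 0) := by
    have := continuous_ofReal.tendsto (0 : ℝ)
    rw [ofReal_zero] at this
    exact this.mono_left nhdsWithin_le_nhds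
  have hPlim : Tendsto P (𝓝[>] 0) (𝓝 (-(I * δ₀))) := by
    have := (hlim.mul hy0).sub_const (I * δ₀)
    rw [mul_zero, zero_sub] at this
    refine this.congr' ?_
    filter_upwards [hpos] with y hy
    have : (y : ℂ) ≠ 0 := ofReal_ne_zero.2 hy.ne'
    field_simp
    ring
  have hnorm : ∀ᶠ y : ℝ in 𝓝[>] (0 : ℝ), ∀ n, ‖(y : ℂ) ^ (1 - I * θ) *
      (P y + I * ρ n) ^ (-(1 - I * θ))‖ ≤ c⁻¹ * Real.exp (Real.pi * |θ|) := by
    filter_upwards [hpos, hP] with y hy hPy n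
    have h1 : c * y ≤ ‖P y + I * ρ n‖ := by
      refine le_trans ?_ (re_le_norm _)
      simpa using hPy
    have hcy : 0 < c * y := by positivity
    have hne : P y + I * ρ n ≠ 0 := norm_pos_iff.1 (hcy.trans_le h1)
    rw [norm_mul, norm_cpow_eq_rpow_re_of_pos hy]
    simp only [sub_re, one_re, mul_re, I_re, zero_mul, I_im, ofReal_im, mul_zero, sub_zero,
      Real.rpow_one]
    calc y * ‖(P y + I * ρ n) ^ (-(1 - I * θ))‖ ≤
        y * ((c * y)⁻¹ * Real.exp (Real.pi * |θ|)) := by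
          gcongr
          exact (norm_cpow_neg_le θ hne).trans (by gcongr)
      _ = _ := by field_simp
  simp_rw [← tsum_mul_left]
  refine tendsto_tsum_of_dominated_convergence
    (bound := fun n => ‖b n‖ * (c⁻¹ * Real.exp (Real.pi * |θ|))) (hb.mul_right _) (fun n => ?_) ?_
  · split_ifs with hn
    · have h1 : Tendsto (fun y : ℝ => b n * ((P y + I * δ₀) / y) ^ (-(1 - I * θ))) (𝓝[>] 0)
          (𝓝 (b n * v ^ (-(1 - I * θ)))) :=
        ((continuousAt_cpow_const (Or.inl hv)).tendsto.comp hlim).const_mul _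
      refine h1.congr' ?_
      filter_upwards [hpos, hlim.eventually (isOpen_ne.mem_nhds
        (show v ≠ 0 by rintro rfl; simp at hv))] with y hy hne
      have hyc : (y : ℂ) ≠ 0 := ofReal_ne_zero.2 hy.ne'
      have h2 : P y + I * δ₀ = y * ((P y + I * δ₀) / y) := by field_simp
      rw [hn]
      nth_rewrite 2 [h2]
      rw [cpow_def_of_ne_zero (mul_ne_zero hyc hne), log_ofReal_mul hy hne,
        cpow_def_of_ne_zero hyc, cpow_def_of_ne_zero hne, ← ofReal_log hy.le, mul_left_comm,
        ← exp_add]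
      congr 2
      ring
    -- for `ρ n ≠ δ₀` the base `P + iρ n` stays away from `0`, and `y ^ (1 - iθ)` tends to `0`
    · have h1 : Tendsto (fun y : ℝ => (y : ℂ) ^ (1 - I * θ)) (𝓝[>] 0) (𝓝 0) := by
        refine squeeze_zero_norm' (a := fun y : ℝ => y) ?_
          (tendsto_id.mono_left nhdsWithin_le_nhds)
        filter_upwards [hpos] with y hy
        rw [norm_cpow_eq_rpow_re_of_pos hy]
        simp
      have hsl : -(I * δ₀) + I * ρ n ∈ slitPlane := by
        refine Or.inr ?_
        simp
        intro h
        apply hn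
        linarith
      have h2 := (continuousAt_cpow_const (b := -(1 - I * θ)) hsl).tendsto.comp
        (hPlim.add_const (I * ρ n))
      have h3 := h1.mul (h2.const_mul (b n))
      rw [zero_mul] at h3
      exact h3
  · filter_upwards [hnorm] with y hy n
    rw [mul_left_comm, norm_mul]
    gcongr
    exact hy n

/-- The Laplace transform of `t ^ (-iθ)` times an absolutely convergent trigonometric series. -/
lemma integral_abel_sum (θ : ℝ) {b : ℕ → ℂ} (hb : Summable fun n => ‖b n‖) (ρ : ℕ → ℝ)
    {P : ℂ} (hP : 0 < P.re) :
    ∫ t : ℝ in Ioi 0, (t : ℂ) ^ (-(I * θ)) * (∑' n, b n * exp (-(I * ρ n * t))) * exp (-(P * t)) =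
      Gamma (1 - I * θ) * ∑' n, b n * (P + I * ρ n) ^ (-(1 - I * θ)) := by
  have hre : ∀ n, 0 < (P + I * ρ n).re := fun n => by simpa using hP
  have ha : 0 < (1 - I * θ : ℂ).re := by simp
  have hint : ∀ n, IntegrableOn (fun t : ℝ => b n * ((t : ℂ) ^ (1 - I * θ - 1) *
      exp (-((P + I * ρ n) * t)))) (Ioi 0) := fun n =>
    (integrableOn_cpow_mul_exp_neg_mul ha (hre n)).const_mul (b n)
  have hsum : HasSum _ _ := hasSum_integral_of_summable_integral_norm hint (by
    have : ∀ n, ∫ t in Ioi (0 : ℝ), ‖b n * ((t : ℂ) ^ (1 - I * θ - 1) *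
        exp (-((P + I * ρ n) * t)))‖ =
        ‖b n‖ * ∫ t in Ioi (0 : ℝ), Real.exp (-(P.re * t)) := fun n => by
      rw [← integral_const_mul]
      refine setIntegral_congr_fun measurableSet_Ioi fun t ht => ?_
      rw [norm_mul, norm_mul, norm_cpow_eq_rpow_re_of_pos ht, norm_exp]
      simp
    simp_rw [this]
    exact hb.mul_right _)
  rw [← tsum_mul_left]
  have h2 : ∀ n, Gamma (1 - I * θ) * (b n * (P + I * ρ n) ^ (-(1 - I * θ))) =
      ∫ t in Ioi (0 : ℝ), b n * ((t : ℂ) ^ (1 - I * θ - 1) * exp (-((P + I * ρ n) * t))) :=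
    fun n => by
      rw [integral_const_mul, integral_cpow_mul_exp_neg_mul ha (hre n)]
      ring
  simp_rw [h2]
  rw [hsum.tsum_eq]
  refine setIntegral_congr_fun measurableSet_Ioi fun t _ => ?_
  rw [← tsum_mul_left, ← tsum_mul_right]
  refine tsum_congr fun n => ?_
  rw [add_mul, neg_add, exp_add]
  ring_nf

/-- The Laplace mean of a bounded function tending to zero tends to zero. -/
lemma tendsto_mul_integral_of_le {f : ℝ → ℝ → ℂ} {g : ℝ → ℝ} {M c : ℝ} (hc : 0 < c)
    (hM : ∀ t, 0 < t → g t ≤ M) (hg : Tendsto g atTop (𝓝 0))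
    (hf : ∀ᶠ y in 𝓝[>] (0 : ℝ), ∀ t, 0 < t → ‖f y t‖ ≤ g t * Real.exp (-(c * y * t))) :
    Tendsto (fun y : ℝ => (y : ℂ) * ∫ t in Ioi (0 : ℝ), f y t) (𝓝[>] 0) (𝓝 0) := by
  have hpos : ∀ᶠ y in 𝓝[>] (0 : ℝ), 0 < y := eventually_mem_nhdsWithin
  rw [Metric.tendsto_nhds]
  intro ε hε
  obtain ⟨T, hT0, hT⟩ : ∃ T : ℝ, 0 < T ∧ ∀ t, T ≤ t → g t ≤ c * ε / 2 := by
    obtain ⟨T, hT⟩ := eventually_atTop.1 (hg.eventually_le_const (by positivity : 0 < c * ε / 2))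
    exact ⟨max T 1, by positivity, fun t ht => hT t ((le_max_left _ _).trans ht)⟩
  -- on `(0, T]` the integrand is bounded, beyond `T` it is at most `cε/2 e ^ (-cyt)`
  have hM' : 0 ≤ max M 0 := le_max_right _ _
  have hsmall : ∀ᶠ y in 𝓝[>] (0 : ℝ), y * (max M 0 * T) < ε / 2 := by
    have : Tendsto (fun y : ℝ => y * (max M 0 * T)) (𝓝[>] 0) (𝓝 (0 * (max M 0 * T))) :=
      (tendsto_id.mono_left nhdsWithin_le_nhds).mul_const _
    rw [zero_mul] at this
    exact this.eventually_lt_const (by positivity)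
  filter_upwards [hpos, hf, hsmall] with y hy hfy hs
  rw [dist_zero_right, norm_mul, norm_real, Real.norm_of_nonneg hy.le]
  have hcy : 0 < c * y := by positivity
  have hint1 : IntegrableOn (fun t : ℝ => (Iic T).indicator (fun _ => max M 0) t) (Ioi 0) := by
    rw [integrableOn_indicator_iff measurableSet_Iic]
    exact integrableOn_const (by rw [Iic_inter_Ioi]; simp)
  have hint2 : IntegrableOn (fun t : ℝ => c * ε / 2 * Real.exp (-(c * y * t))) (Ioi 0) := by
    have := (integrableOn_exp_mul_Ioi (neg_neg_of_pos hcy) 0).const_mul (c * ε / 2)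
    simpa [neg_mul, IntegrableOn] using this
  have hbound : ‖∫ t in Ioi (0 : ℝ), f y t‖ ≤ ∫ t in Ioi (0 : ℝ),
      ((Iic T).indicator (fun _ => max M 0) t + c * ε / 2 * Real.exp (-(c * y * t))) := by
    refine norm_integral_le_of_norm_le (hint1.add hint2) ?_
    refine (ae_restrict_mem measurableSet_Ioi).mono fun t ht => (hfy t ht).trans ?_
    have ht' : 0 < t := ht
    by_cases htT : t ≤ T
    · rw [indicator_of_mem (show t ∈ Iic T from htT)]
      have h1 : Real.exp (-(c * y * t)) ≤ 1 := by
        rw [Real.exp_le_one_iff]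
        have : 0 < c * y * t := by positivity
        linarith
      have h2 : g t * Real.exp (-(c * y * t)) ≤ max M 0 * 1 :=
        mul_le_mul ((hM t ht').trans (le_max_left _ _)) h1 (Real.exp_pos _).le hM'
      have h3 : 0 ≤ c * ε / 2 * Real.exp (-(c * y * t)) := by positivity
      linarith
    · rw [indicator_of_notMem (show t ∉ Iic T from htT), zero_add]
      gcongr
      exact hT t (not_le.1 htT).le
  have hval : ∫ t in Ioi (0 : ℝ),
      ((Iic T).indicator (fun _ => max M 0) t + c * ε / 2 * Real.exp (-(c * y * t))) =
      T * max M 0 + c * ε / 2 * (1 / (c * y)) := by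
    rw [integral_add hint1 hint2, integral_indicator measurableSet_Iic, Measure.restrict_restrict
      measurableSet_Iic, Iic_inter_Ioi, setIntegral_const, integral_const_mul]
    congr 2
    · simp [hT0.le]
    · have := integral_exp_mul_Ioi (neg_neg_of_pos hcy) 0
      simp only [neg_mul, mul_zero, Real.exp_zero] at this
      rw [this]
      field_simp
  calc y * ‖∫ t in Ioi (0 : ℝ), f y t‖ ≤ y * (T * max M 0 + c * ε / 2 * (1 / (c * y))) := by
        gcongr
        exact hbound.trans hval.le
    _ = y * (max M 0 * T) + ε / 2 := by field_simp
    _ < ε := by linarith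

/-- Uniqueness for absolutely convergent trigonometric series: if the series tends to zero at
`+∞`, then the coefficients of each frequency add up to zero. -/
lemma tsum_ite_eq_zero_of_tendsto_zero {b : ℕ → ℂ} (hb : Summable fun n => ‖b n‖) (ρ : ℕ → ℝ)
    (h : Tendsto (fun t : ℝ => ∑' n, b n * exp (-(I * ρ n * t))) atTop (𝓝 0)) (δ₀ : ℝ) :
    ∑' n, (if ρ n = δ₀ then b n else 0) = 0 := by
  have hpos : ∀ᶠ y in 𝓝[>] (0 : ℝ), 0 < y := eventually_mem_nhdsWithin
  have h1 := tendsto_abel_sum 0 hb ρ δ₀ (P := fun y => y - I * δ₀) (c := 1) one_pos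
    (Eventually.of_forall fun y => by simp) (v := 1) (by simp)
    (tendsto_const_nhds.congr' (by
      filter_upwards [hpos] with y hy
      have : (y : ℂ) ≠ 0 := ofReal_ne_zero.2 hy.ne'
      field_simp
      ring))
  simp only [one_cpow, mul_one] at h1
  refine tendsto_nhds_unique h1 ?_
  have hterm : ∀ (t : ℝ) (n : ℕ), ‖b n * exp (-(I * ρ n * t))‖ = ‖b n‖ := fun t n => by
    rw [norm_mul, norm_exp]
    simp
  have h2 := tendsto_mul_integral_of_le (f := fun y t =>
    (∑' n, b n * exp (-(I * ρ n * t))) * exp (-((y - I * δ₀) * t)))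
    (g := fun t => ‖∑' n, b n * exp (-(I * ρ n * t))‖) (M := ∑' n, ‖b n‖) (c := 1) one_pos
    (fun t _ => (norm_tsum_le_tsum_norm (by simpa only [hterm] using hb)).trans_eq
      (tsum_congr fun n => hterm t n))
    (tendsto_zero_iff_norm_tendsto_zero.1 h) (Eventually.of_forall fun y t _ => by
      rw [norm_mul, norm_exp]
      simp)
  refine h2.congr' ?_
  filter_upwards [hpos] with y hy
  have h3 := integral_abel_sum 0 hb ρ (P := y - I * δ₀) (by simpa using hy)
  simp only [ofReal_zero, mul_zero, neg_zero, cpow_zero, one_mul, sub_zero, Gamma_one] at h3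
  simp only [ofReal_zero, mul_zero, sub_zero, cpow_one]
  rw [h3]

/-! ### Growth of the Gamma function in vertical strips -/

/-- Far from the real axis in a vertical strip, `|Im z| |arg z|` is `π/2 |Im z|` up to a bounded
error; this is the source of the exponential decay of the Gamma function. -/
lemma pi_div_two_sub_le_abs_arg {z : ℂ} (hz : z.im ≠ 0) :
    Real.pi / 2 * |z.im| - Real.pi / 2 * |z.re| ≤ |z.im| * |arg z| := by
  have hz0 : 0 < ‖z‖ := norm_pos_iff.2 (by rintro rfl; simp at hz)
  have harg : |arg z| = Real.arccos (z.re / ‖z‖) := by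
    rcases lt_or_gt_of_ne hz with h | h
    · rw [arg_of_im_neg h, abs_neg, abs_of_nonneg (Real.arccos_nonneg _)]
    · rw [arg_of_im_pos h, abs_of_nonneg (Real.arccos_nonneg _)]
  have hasin : Real.arcsin (z.re / ‖z‖) ≤ Real.pi / 2 * (|z.re| / ‖z‖) := by
    rcases le_total 0 z.re with h | h
    · have h0 : 0 ≤ Real.arcsin (z.re / ‖z‖) := Real.arcsin_nonneg.2 (by positivity)
      have h1 := Real.mul_le_sin h0 (Real.arcsin_le_pi_div_two _)
      rw [Real.sin_arcsin (by linarith [show 0 ≤ z.re / ‖z‖ by positivity])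
        ((div_le_one hz0).2 (re_le_norm z))] at h1
      rw [abs_of_nonneg h]
      have hπ := Real.pi_pos
      calc Real.arcsin (z.re / ‖z‖) =
          Real.pi / 2 * (2 / Real.pi * Real.arcsin (z.re / ‖z‖)) := by field_simp
        _ ≤ _ := by gcongr
    · have : Real.arcsin (z.re / ‖z‖) ≤ 0 :=
        Real.arcsin_nonpos.2 (div_nonpos_of_nonpos_of_nonneg h hz0.le)
      have hπ := Real.pi_pos
      have : 0 ≤ Real.pi / 2 * (|z.re| / ‖z‖) := by positivity
      linarith
  rw [harg, Real.arccos]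
  have h2 : |z.im| * (|z.re| / ‖z‖) ≤ |z.re| := by
    rw [← mul_div_assoc, div_le_iff₀ hz0, mul_comm]
    exact mul_le_mul_of_nonneg_left (abs_im_le_norm z) (abs_nonneg _)
  have hπ := Real.pi_pos
  have h3 := mul_le_mul_of_nonneg_left hasin (abs_nonneg z.im)
  nlinarith

/-- Exponential decay of the Gamma function in the strip `-1 ≤ Re z ≤ 2`. -/
lemma exists_norm_Gamma_le : ∃ C Y : ℝ, 0 < C ∧ 1 ≤ Y ∧ ∀ z : ℂ, -1 ≤ z.re → z.re ≤ 2 →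
    Y ≤ |z.im| → ‖Gamma z‖ ≤ C * ‖z‖ ^ 2 * Real.exp (-(Real.pi / 2 * |z.im|)) := by
  have h1 := (tendsto_Gamma_div_stirlingMain 0 1).norm
  rw [norm_one] at h1
  obtain ⟨R, hR⟩ := ((hasBasis_cobounded_norm (E := ℂ)).inf_principal _).eventually_iff.1
    (h1.eventually_le_const one_lt_two)
  refine ⟨2 * Real.sqrt (2 * Real.pi) * Real.exp (Real.pi + 1), max R 1, ?_, le_max_right _ _,
    fun z hz1 hz2 hz => ?_⟩
  · have := Real.pi_pos
    positivity
  · have hn : max R 1 ≤ ‖z‖ := hz.trans (abs_im_le_norm z)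
    have hn1 : 1 ≤ ‖z‖ := (le_max_right _ _).trans hn
    have hz0 : z ≠ 0 := norm_pos_iff.1 (by linarith)
    have him : z.im ≠ 0 := by
      intro h
      rw [h, abs_zero] at hz
      have := (le_max_right R 1).trans hz
      linarith
    have h2 := hR.2 ⟨(le_max_left _ _).trans hn, hz1⟩
    rw [add_zero, norm_div, div_le_iff₀ (norm_pos_iff.2 (stirlingMain_ne_zero _ _))] at h2
    refine h2.trans ?_
    rw [stirlingMain, norm_mul, norm_real, Real.norm_of_nonneg (Real.sqrt_nonneg _), norm_exp]
    have h3 : ((z + 0 - 1 / 2) * log z - z).re =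
        (z.re - 1 / 2) * Real.log ‖z‖ - z.im * arg z - z.re := by
      simp [log_re, log_im]
    have h4 : z.im * arg z = |z.im| * |arg z| := by
      rw [← abs_mul, abs_of_nonneg]
      rcases lt_or_gt_of_ne him with h | h
      · exact mul_nonneg_of_nonpos_of_nonpos h.le (arg_neg_iff.2 h).le
      · exact mul_nonneg h.le (arg_nonneg_iff.2 h.le)
    have h5 := pi_div_two_sub_le_abs_arg him
    have h6 : 0 ≤ Real.log ‖z‖ := Real.log_nonneg hn1
    have h7 : |z.re| ≤ 2 := abs_le.2 ⟨by linarith, hz2⟩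
    have hπ := Real.pi_pos
    have h8 : ((z + 0 - 1 / 2) * log z - z).re ≤
        Real.log ‖z‖ * 2 + (Real.pi + 1) + -(Real.pi / 2 * |z.im|) := by
      rw [h3, h4]
      nlinarith
    calc 2 * (Real.sqrt (2 * Real.pi) * Real.exp ((z + 0 - 1 / 2) * log z - z).re)
        ≤ 2 * (Real.sqrt (2 * Real.pi) * Real.exp
          (Real.log ‖z‖ * 2 + (Real.pi + 1) + -(Real.pi / 2 * |z.im|))) := by gcongr
      _ = _ := by
          rw [Real.exp_add, Real.exp_add, Real.exp_mul, Real.exp_log (by linarith)]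
          norm_num
          ring

/-! ### The functional equation on vertical lines -/

namespace SelbergData

/-- The factor `Γ(s) R(1 - s)` on the half-line `s = -1 - it`, stripped of its exponential decay
and of its oscillation. -/
def oscFactor (D : SelbergData) (t : ℝ) : ℂ :=
  Gamma (-1 - t * I) * D.funRatio (halfLine (-1) t) * (-I * Real.exp (Real.pi / 2 * t)) *
    ((2 * Real.pi : ℝ) : ℂ) ^ (1 + t * I) * (D.conductor : ℂ) ^ (-(1 + t * I)) *
    (t : ℂ) ^ (I * D.theta)

/-- The shift by `iθ` changes the Gamma function on the upper half of the line `Re s = 2` by `(it) ^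
(-iθ)`. -/
lemma tendsto_Gamma_ratio (θ : ℝ) :
    Tendsto (fun t : ℝ => Gamma (2 + t * I - I * θ) / Gamma (2 + t * I) * (t : ℂ) ^ (I * θ))
      atTop (𝓝 (exp (Real.pi / 2 * θ))) := by
  have hhl : ∀ t : ℝ, halfLine (-1) t = 2 + t * I := fun t => by
    simp [halfLine]
  have hn := tendsto_norm_halfLine (κ := -1) (Or.inr rfl)
  have hs : Tendsto (halfLine (-1)) atTop (atInftyHalfPlane 2) :=
    tendsto_atInftyHalfPlane hn (Eventually.of_forall fun t => by simp)
  have h1 := (tendsto_Gamma_div_stirlingMain (-(I * θ)) 2).comp hs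
  have h2 := (tendsto_Gamma_div_stirlingMain 0 2).comp hs
  have hl : Tendsto (fun t : ℝ => log (1 + 2 / (t * I))) atTop (𝓝 0) := by
    have h3 : Tendsto (fun t : ℝ => 2 / (t * I)) atTop (𝓝 0) := by
      refine squeeze_zero_norm' (a := fun t : ℝ => 2 * t⁻¹) ?_ ?_
      · filter_upwards [eventually_gt_atTop 0] with t ht
        simp [abs_of_pos ht, div_eq_mul_inv]
      · have := tendsto_inv_atTop_zero.const_mul (2 : ℝ)
        rwa [mul_zero] at this
    have := (continuousAt_clog (x := 1 + 0) (by simp)).tendsto.comp (h3.const_add 1)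
    rw [add_zero, log_one] at this
    exact this
  have h4 : Tendsto (fun t : ℝ => exp (-(I * θ) * log (1 + 2 / (t * I))) * exp (Real.pi / 2 * θ))
      atTop (𝓝 (exp (Real.pi / 2 * θ))) := by
    have := ((continuous_exp.tendsto _).comp (hl.const_mul (-(I * θ)))).mul_const
      (exp (Real.pi / 2 * θ))
    rw [mul_zero, exp_zero, one_mul] at this
    exact this
  have h5 := (h1.div h2 one_ne_zero).mul h4
  rw [div_one, one_mul] at h5
  refine h5.congr' ?_
  filter_upwards [eventually_ge_atTop 4] with t ht
  simp only [Pi.div_apply, Function.comp, hhl]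
  have ht0 : 0 < t := by linarith
  have htc : (t : ℂ) ≠ 0 := ofReal_ne_zero.2 ht0.ne'
  have hlog : log (2 + t * I) = Real.log t + Real.pi / 2 * I + log (1 + 2 / (t * I)) := by
    rw [add_comm 2, log_add_eq (mul_ne_zero htc I_ne_zero), log_ofReal_mul ht0 I_ne_zero, log_I]
    · rw [norm_div, norm_mul, norm_I, mul_one, norm_real, Real.norm_of_nonneg ht0.le]
      simp
      rw [div_le_iff₀ ht0]
      linarith
    · simp
  have key : stirlingMain (-(I * θ)) (2 + t * I) = stirlingMain 0 (2 + t * I) *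
      (exp (-(I * θ) * log (1 + 2 / (t * I))) * exp (Real.pi / 2 * θ)) * exp (-(Real.log t * (I * θ)))
      := by
    rw [stirlingMain, stirlingMain, mul_assoc, mul_assoc, ← exp_add, ← exp_add, ← exp_add, hlog]
    congr 2
    ring_nf
    rw [I_sq]
    ring
  have hS := stirlingMain_ne_zero 0 (2 + t * I)
  have hS' := stirlingMain_ne_zero (-(I * θ)) (2 + t * I)
  rw [ofReal_cpow_eq_exp ht0, sub_eq_add_neg, add_zero, eq_comm]
  have hE := exp_ne_zero (Real.log t * (I * θ))
  rw [exp_neg] at key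
  have h0 := exp_ne_zero (-(I * θ) * log (1 + 2 / (t * I)))
  have h0' := exp_ne_zero (Real.pi / 2 * θ : ℂ)
  generalize exp (Real.log t * (I * θ)) = E at *
  generalize exp (-(I * θ) * log (1 + 2 / (t * I))) = A at *
  generalize exp (Real.pi / 2 * θ : ℂ) = B at *
  rw [key]
  field_simp

/-- The limit of `oscFactor`. -/
def oscConst (D : SelbergData) : ℂ :=
  D.limitConst (-1) * (2 * Real.pi * (((2 * Real.pi : ℝ) : ℂ) ^ (-1 + I * D.theta) *
    (D.conductor : ℂ) ^ (-(I * D.theta))))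

lemma limitConst_ne_zero (D : SelbergData) (κ : ℝ) : D.limitConst κ ≠ 0 := by
  rw [limitConst, rootNumber_eq, ofReal_cpow_eq_exp D.conductor_pos]
  have : D.omega ≠ 0 := norm_pos_iff.1 (by rw [D.norm_omega]; exact one_pos)
  simp [this, exp_ne_zero]

lemma oscConst_ne_zero (D : SelbergData) : D.oscConst ≠ 0 := by
  have hπ : 0 < 2 * Real.pi := by have := Real.pi_pos; linarith
  rw [oscConst, ofReal_cpow_eq_exp D.conductor_pos, ofReal_cpow_eq_exp hπ]
  simp [exp_ne_zero, limitConst_ne_zero, Real.pi_ne_zero]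

lemma dirichletTerm_ne_zero (D : SelbergData) (κ : ℝ) {w : ℂ} (hw : 0 < w.re) :
    D.dirichletTerm κ w ≠ 0 := by
  have hπ : 0 < 2 * Real.pi := by have := Real.pi_pos; linarith
  rw [dirichletTerm, ofReal_cpow_eq_exp D.conductor_pos, ofReal_cpow_eq_exp hπ]
  simp [exp_ne_zero, Gamma_ne_zero_of_re_pos hw]

/-- By the reflection formula `Γ(-1 - it)` is expressed through `Γ(2 + it)`, whose quotient by the
Gamma function in `dirichletTerm` is a power of `t`; the exponentials cancel. -/
lemma tendsto_oscFactor (D : SelbergData) (hd : D.degree = 1) :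
    Tendsto D.oscFactor atTop (𝓝 D.oscConst) := by
  have h1 := D.tendsto_funRatio_div_dirichletTerm hd (κ := -1) (Or.inr rfl)
  have h2 := tendsto_Gamma_ratio D.theta
  have h3 : Tendsto (fun t : ℝ => (1 - Real.exp (-(2 * Real.pi * t)))⁻¹) atTop (𝓝 1) := by
    have : Tendsto (fun t : ℝ => Real.exp (-(2 * Real.pi * t))) atTop (𝓝 0) := by
      refine Real.tendsto_exp_neg_atTop_nhds_zero.comp (tendsto_id.const_mul_atTop ?_)
      have := Real.pi_pos
      linarith
    have := (this.const_sub 1).inv₀ (by norm_num)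
    simpa using this
  have h3' : Tendsto (fun t : ℝ => (1 - exp (-(2 * Real.pi * t)))⁻¹) atTop (𝓝 1) := by
    have := (continuous_ofReal.tendsto _).comp h3
    simpa [Function.comp_def] using this
  have h4 := h1.mul ((h2.mul h3').mul_const (exp (-(Real.pi / 2 * D.theta)) * (2 * Real.pi *
    (((2 * Real.pi : ℝ) : ℂ) ^ (-1 + I * D.theta) * (D.conductor : ℂ) ^ (-(I * D.theta))))))
  rw [mul_one, ← mul_assoc (exp _) (exp _), ← exp_add, add_neg_cancel, exp_zero, one_mul] at h4
  refine h4.congr' ?_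
  filter_upwards [eventually_gt_atTop 0] with t ht
  have hhl : halfLine (-1) t = 2 + t * I := by simp [halfLine]
  rw [oscFactor, hhl]
  have hw : 0 < (2 + t * I - I * D.theta).re := by simp
  have hD := D.dirichletTerm_ne_zero (-1) hw
  have hG : Gamma (2 + t * I) ≠ 0 := Gamma_ne_zero_of_re_pos (by simp)
  have hrefl : Gamma (2 + t * I) * Gamma (-1 - t * I) = Real.pi / sin (Real.pi * (2 + t * I)) := by
    have := Gamma_mul_Gamma_one_sub (2 + t * I)
    rwa [show (1 : ℂ) - (2 + t * I) = -1 - t * I by ring] at this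
  have hsin : sin (Real.pi * (2 + t * I)) =
      I / 2 * exp (Real.pi * t) * (1 - exp (-(2 * Real.pi * t))) := by
    have e1 : (Real.pi : ℂ) * (2 + t * I) = Real.pi * t * I + 2 * Real.pi := by ring
    rw [e1, sin_add_two_pi, sin_mul_I, sinh, mul_sub, mul_one, mul_assoc, ← exp_add,
      show (Real.pi * t + -(2 * Real.pi * t) : ℂ) = -(Real.pi * t) by ring]
    ring
  have hne : (1 - exp (-(2 * Real.pi * t)) : ℂ) ≠ 0 := by
    have h5 : Real.exp (-(2 * Real.pi * t)) < 1 := by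
      rw [Real.exp_lt_one_iff]
      have := Real.pi_pos
      have : 0 < 2 * Real.pi * t := by positivity
      linarith
    intro h
    have : ((1 - Real.exp (-(2 * Real.pi * t)) : ℝ) : ℂ) = 0 := by
      push_cast
      exact h
    rw [ofReal_eq_zero] at this
    linarith
  have hG' : Gamma (-1 - t * I) =
      Real.pi / (I / 2 * exp (Real.pi * t) * (1 - exp (-(2 * Real.pi * t)))) / Gamma (2 + t * I) := by
    rw [eq_div_iff hG, mul_comm, hrefl, hsin]
  have hπ : 0 < 2 * Real.pi := by have := Real.pi_pos; linarith
  obtain ⟨r, hr⟩ : ∃ r, D.funRatio (2 + t * I) /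
    D.dirichletTerm (-1) (2 + t * I - I * D.theta) = r := ⟨_, rfl⟩
  have hR := (div_eq_iff hD).1 hr
  have hexp : (D.conductor : ℂ) ^ (2 + t * I - I * D.theta - 1) *
      ((2 * Real.pi : ℝ) : ℂ) ^ (-(2 + t * I - I * D.theta)) *
      exp ((-1 : ℝ) * Real.pi * I * (2 + t * I - I * D.theta) / 2) *
      (-I * Real.exp (Real.pi / 2 * t)) * ((2 * Real.pi : ℝ) : ℂ) ^ (1 + t * I) *
      (D.conductor : ℂ) ^ (-(1 + t * I)) =
      I * exp (Real.pi * t) * (exp (-(Real.pi / 2 * D.theta)) *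
        (((2 * Real.pi : ℝ) : ℂ) ^ (-1 + I * D.theta) * (D.conductor : ℂ) ^ (-(I * D.theta)))) := by
    have e1 : exp ((-1 : ℝ) * Real.pi * I * (2 + t * I - I * D.theta) / 2) =
        -exp (Real.pi / 2 * t - Real.pi / 2 * D.theta) := by
      rw [show ((-1 : ℝ) * Real.pi * I * (2 + t * I - I * D.theta) / 2 : ℂ) =
        (Real.pi / 2 * t - Real.pi / 2 * D.theta) - Real.pi * I by
          push_cast; ring_nf; rw [I_sq]; ring, exp_sub_pi_mul_I]
    rw [e1, ofReal_cpow_eq_exp D.conductor_pos, ofReal_cpow_eq_exp D.conductor_pos,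
      ofReal_cpow_eq_exp D.conductor_pos, ofReal_cpow_eq_exp hπ, ofReal_cpow_eq_exp hπ,
      ofReal_cpow_eq_exp hπ, ofReal_exp]
    rw [show ∀ a b c d e f : ℂ, a * b * -c * (-I * d) * e * f = I * (a * b * c * d * e * f) by
      intros; ring]
    simp only [mul_assoc, ← exp_add]
    congr 2
    push_cast
    ring
  rw [hr, hG', hR, dirichletTerm]
  have hE := exp_ne_zero (Real.pi * t : ℂ)
  rw [show ∀ g r a b c e d f h k : ℂ, g * (r * (a * b * c * e)) * d * f * h * k =
    (a * b * e * d * f * h) * (g * r * c * k) by intros; ring, hexp]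
  generalize ((2 * Real.pi : ℝ) : ℂ) ^ (-1 + I * D.theta) * (D.conductor : ℂ) ^ (-(I * D.theta)) = A
  generalize (t : ℂ) ^ (I * D.theta) = B
  field_simp

end SelbergData

/-! ### Polynomial growth in the critical strip -/

lemma norm_term_of_re_eq (a : ℕ → ℂ) {s s' : ℂ} (h : s.re = s'.re) (n : ℕ) :
    ‖LSeries.term a s n‖ = ‖LSeries.term a s' n‖ := by
  rw [LSeries.norm_term_eq, LSeries.norm_term_eq, h]

namespace IsExtendedSelberg

variable {a : ℕ → ℂ} {F : ℂ → ℂ} {D : SelbergData}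

lemma differentiableAt (hF : IsExtendedSelberg a F D) {s : ℂ} (hs : s ≠ 1) :
    DifferentiableAt ℂ F s := by
  obtain ⟨m, H, hH, hHF⟩ := hF.continuation
  have h1 : DifferentiableAt ℂ (fun s => H s / (s - 1) ^ m) s :=
    hH.1.differentiableAt.div (by fun_prop) (pow_ne_zero _ (sub_ne_zero.2 hs))
  refine h1.congr_of_eventuallyEq ?_
  filter_upwards [isOpen_ne.mem_nhds hs] with z hz
  rw [hHF z hz, mul_div_cancel_left₀ _ (pow_ne_zero _ (sub_ne_zero.2 hz))]

/-- The functional equation in the form `F(1 - s) = R(s) conj (F(conj s))`. -/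
lemma one_sub_eq (hF : IsExtendedSelberg a F D) {s : ℂ} (hs0 : s ≠ 0) (hs1 : s ≠ 1)
    (h1 : D.GammaRegularAt (1 - s)) (h2 : D.GammaRegularAt (starRingEnd ℂ s)) :
    F (1 - s) = D.funRatio s * starRingEnd ℂ (F (starRingEnd ℂ s)) := by
  have he : 1 - starRingEnd ℂ (1 - s) = starRingEnd ℂ s := by simp
  have h := hF.functional_equation (1 - s) (sub_ne_zero.2 hs1.symm) (by simpa using hs0) h1
    (by rwa [he])
  rw [he, map_mul] at h
  rw [D.funRatio_eq]
  have := D.gammaFactor_ne_zero h1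
  field_simp
  rw [mul_comm, h]
  ring

lemma summable_norm_term (hF : IsExtendedSelberg a F D) :
    Summable fun n => ‖LSeries.term a 2 n‖ := (hF.summable 2 (by simp)).norm

lemma norm_le_of_re_eq_two (hF : IsExtendedSelberg a F D) {s : ℂ} (hs : s.re = 2) :
    ‖F s‖ ≤ ∑' n, ‖LSeries.term a 2 n‖ := by
  have h : ∀ n, ‖LSeries.term a s n‖ = ‖LSeries.term a 2 n‖ := fun n =>
    norm_term_of_re_eq a (by simpa using hs) n
  rw [hF.eq_LSeries s (by linarith), LSeries]
  refine (norm_tsum_le_tsum_norm ?_).trans_eq (tsum_congr h)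
  simpa only [h] using hF.summable_norm_term

end IsExtendedSelberg

namespace SelbergData

/-- On the half-line `Re s = 2`, `κ Im s < 0`, the exponential growth of `e ^ (κπis/2)` in
`dirichletTerm` is compensated by the decay of the Gamma function. -/
lemma exists_norm_funRatio_le (D : SelbergData) (hd : D.degree = 1) {κ : ℝ}
    (hκ : κ = 1 ∨ κ = -1) : ∃ C T : ℝ, 0 < C ∧ 1 ≤ T ∧ ∀ t, T ≤ t →
      ‖D.funRatio (halfLine κ t)‖ ≤ C * t ^ 2 := by
  obtain ⟨C, Y, hC, hY, hG⟩ := exists_norm_Gamma_le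
  have h1 := (D.tendsto_funRatio_div_dirichletTerm hd hκ).norm
  obtain ⟨T, hT⟩ := eventually_atTop.1 (h1.eventually_le_const (lt_add_one _))
  have hq := D.conductor_pos
  have hπ := Real.pi_pos
  refine ⟨(‖D.limitConst κ‖ + 1) * (D.conductor * (2 * Real.pi) ^ (-2 : ℝ) *
    (C * 16)), max T (Y + |D.theta| + 2), by positivity, ?_,
    fun t ht => ?_⟩
  · have := abs_nonneg D.theta
    exact le_max_of_le_right (by linarith)
  have hθ := abs_nonneg D.theta
  have ht1 : T ≤ t := (le_max_left _ _).trans ht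
  have ht2 : Y + |D.theta| + 2 ≤ t := (le_max_right _ _).trans ht
  set w := halfLine κ t - I * D.theta with hw
  have hwre : w.re = 2 := by simp [hw]
  have hwim : w.im = -(κ * t) - D.theta := by simp [hw]
  have hκt : |κ * t| = t := by
    rcases hκ with rfl | rfl <;> simp <;> linarith
  have hlow : t - |D.theta| ≤ |w.im| := by
    have := abs_sub_abs_le_abs_sub (-(κ * t)) D.theta
    rw [abs_neg, hκt] at this
    rw [hwim]
    exact this
  have hup : |w.im| ≤ t + |D.theta| := by
    rw [hwim]
    refine (abs_sub _ _).trans ?_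
    rw [abs_neg, hκt]
  have hGw := hG w (by linarith) hwre.le (by linarith)
  have hnw : ‖w‖ ≤ 4 * t := by
    have := norm_le_abs_re_add_abs_im w
    rw [hwre, abs_two] at this
    linarith
  have hD := D.dirichletTerm_ne_zero κ (w := w) (by linarith)
  have h2 := hT t ht1
  rw [norm_div, div_le_iff₀ (norm_pos_iff.2 hD)] at h2
  refine h2.trans ?_
  have hexp : ‖exp (κ * Real.pi * I * w / 2)‖ ≤
      Real.exp (Real.pi / 2 * |w.im|) := by
    rw [norm_exp]
    gcongr
    have : (κ * Real.pi * I * w / 2).re = Real.pi / 2 * (-κ * w.im) := by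
      simp
      ring
    rw [this]
    gcongr
    rcases hκ with rfl | rfl
    · simpa using neg_le_abs w.im
    · simpa using le_abs_self w.im
  have hd1 : ‖D.dirichletTerm κ w‖ ≤ D.conductor * (2 * Real.pi) ^ (-2 : ℝ) *
      (C * ‖w‖ ^ 2 * Real.exp (-(Real.pi / 2 * |w.im|))) * Real.exp (Real.pi / 2 * |w.im|) := by
    rw [dirichletTerm, norm_mul, norm_mul, norm_mul, norm_cpow_eq_rpow_re_of_pos hq,
      norm_cpow_eq_rpow_re_of_pos (by positivity), sub_re, neg_re, hwre]
    norm_num only [one_re]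
    rw [Real.rpow_one]
    gcongr
  have hd2 : ‖D.dirichletTerm κ w‖ ≤ D.conductor * (2 * Real.pi) ^ (-2 : ℝ) *
      (C * ‖w‖ ^ 2) := by
    refine hd1.trans_eq ?_
    rw [show ∀ p b e e' : ℝ, p * (b * e) * e' = p * b * (e * e') by intros; ring, ← Real.exp_add,
      neg_add_cancel, Real.exp_zero, mul_one]
  calc (‖D.limitConst κ‖ + 1) * ‖D.dirichletTerm κ w‖
      ≤ (‖D.limitConst κ‖ + 1) * (D.conductor * (2 * Real.pi) ^ (-2 : ℝ) *
        (C * (4 * t) ^ 2)) := by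
        gcongr
        exact hd2.trans (by gcongr)
    _ = _ := by ring

end SelbergData

/-- Finite order implies the growth condition of the Phragmén–Lindelöf principle in a vertical
strip, where `|s|` and `|Im s|` are comparable. -/
lemma isBigO_strip {H : ℂ → ℂ} (hH : IsEntireOfFiniteOrder H) {c : ℝ} (hc : 0 < c) :
    H =O[comap (_root_.abs ∘ im) atTop ⊓ 𝓟 (re ⁻¹' Ioo (-1) 2)]
      fun z ↦ Real.exp (1 * Real.exp (c * |z.im|)) := by
  obtain ⟨-, A, hA⟩ := hH
  have hle : comap (_root_.abs ∘ im) atTop ⊓ 𝓟 (re ⁻¹' Ioo (-1) 2) ≤ cocompact ℂ := by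
    refine inf_le_left.trans ?_
    rw [← Metric.cobounded_eq_cocompact, ← comap_norm_atTop, ← tendsto_iff_comap]
    exact tendsto_atTop_mono (fun z => abs_im_le_norm z) tendsto_comap
  refine (hA.mono hle).trans ?_
  have him : Tendsto (fun z : ℂ => |z.im|)
      (comap (_root_.abs ∘ im) atTop ⊓ 𝓟 (re ⁻¹' Ioo (-1) 2)) atTop :=
    (tendsto_comap (f := _root_.abs ∘ im)).mono_left inf_le_left
  have hlim : Tendsto (fun x : ℝ => (3 * x) ^ |A| * Real.exp (-c * x)) atTop (𝓝 0) := by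
    have h1 := (tendsto_rpow_mul_exp_neg_mul_atTop_nhds_zero |A| c hc).const_mul (3 ^ |A|)
    rw [mul_zero] at h1
    refine h1.congr' ?_
    filter_upwards [eventually_ge_atTop 0] with x hx
    rw [Real.mul_rpow (by norm_num) hx, mul_assoc]
  refine Asymptotics.IsBigO.of_bound 1 ?_
  filter_upwards [him.eventually_ge_atTop 1, (hlim.comp him).eventually_le_const one_pos,
    mem_inf_of_right (mem_principal_self _)] with z hz1 hz2 hz3
  rw [Real.norm_of_nonneg (Real.exp_pos _).le, Real.norm_of_nonneg (Real.exp_pos _).le, one_mul,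
    one_mul]
  refine Real.exp_le_exp.2 ?_
  have hz : ‖z‖ ≤ 3 * |z.im| := by
    have h1 := norm_le_abs_re_add_abs_im z
    have h2 : |z.re| ≤ 2 := abs_le.2 ⟨by linarith [hz3.1], hz3.2.le⟩
    linarith
  have hz' : 1 ≤ ‖z‖ := hz1.trans (abs_im_le_norm z)
  simp only [Function.comp] at hz2
  rw [neg_mul, Real.exp_neg, ← div_eq_mul_inv, div_le_one (Real.exp_pos _)] at hz2
  calc ‖z‖ ^ A ≤ ‖z‖ ^ |A| := Real.rpow_le_rpow_of_exponent_le hz' (le_abs_self A)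
    _ ≤ (3 * |z.im|) ^ |A| := by gcongr
    _ ≤ _ := hz2

namespace IsExtendedSelberg

variable {a : ℕ → ℂ} {F : ℂ → ℂ} {D : SelbergData}

/-- Polynomial growth on the line `Re s = -1`, from the functional equation. -/
lemma exists_norm_le_of_re_eq_neg_one (hF : IsExtendedSelberg a F D) (hd : D.degree = 1) :
    ∃ C T : ℝ, 0 < C ∧ 1 ≤ T ∧ ∀ s : ℂ, s.re = -1 → T ≤ |s.im| → ‖F s‖ ≤ C * |s.im| ^ 2 := by
  obtain ⟨T₀, hT₀, hreg⟩ := D.exists_gammaRegularAt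
  obtain ⟨C₁, T₁, hC₁, hT₁, h₁⟩ := D.exists_norm_funRatio_le hd (κ := 1) (Or.inl rfl)
  obtain ⟨C₂, T₂, hC₂, hT₂, h₂⟩ := D.exists_norm_funRatio_le hd (κ := -1) (Or.inr rfl)
  set A := ∑' n, ‖LSeries.term a 2 n‖
  have hA : 0 ≤ A := tsum_nonneg fun n => norm_nonneg _
  refine ⟨(C₁ + C₂) * (A + 1), max T₀ (max T₁ T₂), by positivity,
    le_max_of_le_right (le_max_of_le_left hT₁), fun s hs hT => ?_⟩
  simp only [max_le_iff] at hT
  have him : s.im ≠ 0 := by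
    intro h
    rw [h, abs_zero] at hT
    linarith [hT.1]
  have h0 : (1 - s) ≠ 0 := by
    intro h
    have := congrArg re h
    simp [hs] at this
  have h1 : (1 - s) ≠ 1 := by
    intro h
    have := congrArg im h
    simp at this
    exact him this
  have hfe := hF.one_sub_eq (s := 1 - s) h0 h1 (hreg _ (by simpa using hT.1))
    (hreg _ (by simpa using hT.1))
  rw [sub_sub_cancel] at hfe
  have hFb : ‖starRingEnd ℂ (F (starRingEnd ℂ (1 - s)))‖ ≤ A + 1 := by
    rw [RCLike.norm_conj]
    have := hF.norm_le_of_re_eq_two (s := starRingEnd ℂ (1 - s)) (by simp [hs]; norm_num)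
    linarith
  rw [hfe, norm_mul]
  have hR : ‖D.funRatio (1 - s)‖ ≤ (C₁ + C₂) * |s.im| ^ 2 := by
    rcases le_total 0 s.im with h | h
    · have e : 1 - s = SelbergData.halfLine 1 |s.im| := by
        apply Complex.ext
        · simp [hs]; norm_num
        · simp [abs_of_nonneg h]
      rw [e]
      refine (h₁ _ hT.2.1).trans ?_
      gcongr
      linarith
    · have e : 1 - s = SelbergData.halfLine (-1) |s.im| := by
        apply Complex.ext
        · simp [hs]; norm_num
        · simp [abs_of_nonpos h]
      rw [e]
      refine (h₂ _ hT.2.2).trans ?_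
      gcongr
      linarith
  calc _ ≤ ((C₁ + C₂) * |s.im| ^ 2) * (A + 1) := by gcongr
    _ = _ := by ring

/-- Polynomial growth in the strip `-1 ≤ Re s ≤ 2`, by the Phragmén–Lindelöf principle. -/
lemma exists_norm_le_strip (hF : IsExtendedSelberg a F D) (hd : D.degree = 1) :
    ∃ (C : ℝ) (N : ℕ), 0 < C ∧ ∀ s : ℂ, -1 ≤ s.re → s.re ≤ 2 → 1 ≤ |s.im| →
      ‖F s‖ ≤ C * ‖s + 3‖ ^ N := by
  obtain ⟨m, H, hH, hHF⟩ := hF.continuation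
  obtain ⟨C₁, T, hC₁, hT, h₁⟩ := hF.exists_norm_le_of_re_eq_neg_one hd
  set A := ∑' n, ‖LSeries.term a 2 n‖
  have hA : 0 ≤ A := tsum_nonneg fun n => norm_nonneg _
  have hs3 : ∀ s : ℂ, -1 ≤ s.re → 2 ≤ ‖s + 3‖ := fun s hs => by
    refine le_trans ?_ (re_le_norm _)
    simp
    linarith
  have hs1 : ∀ s : ℂ, -1 ≤ s.re → ‖s - 1‖ ≤ ‖s + 3‖ := fun s hs => by
    rw [norm_eq_sqrt_sq_add_sq, norm_eq_sqrt_sq_add_sq]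
    refine Real.sqrt_le_sqrt ?_
    simp
    nlinarith
  -- `H(s) = (s - 1) ^ m F(s)` divided by a power of `s + 3` is holomorphic in the strip and bounded
  -- on its two edges
  set f : ℂ → ℂ := fun s => H s / (s + 3) ^ (m + 2) with hf
  have hfd : ∀ s : ℂ, -1 ≤ s.re → DifferentiableAt ℂ f s := fun s hs =>
    hH.1.differentiableAt.div (by fun_prop) (pow_ne_zero _
      (norm_pos_iff.1 (by linarith [hs3 s hs])))
  obtain ⟨B, hB⟩ : ∃ B, ∀ t ∈ Icc (-T) T, ‖f (-1 + t * I)‖ ≤ B := by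
    refine isCompact_Icc.exists_bound_of_continuousOn (f := fun t : ℝ => f (-1 + t * I)) ?_
    intro t _
    refine ContinuousAt.continuousWithinAt ?_
    exact ContinuousAt.comp (f := fun t : ℝ => (-1 + t * I : ℂ)) (g := f)
      (hfd _ (by simp)).continuousAt (by fun_prop)
  have hfF : ∀ s : ℂ, -1 ≤ s.re → s ≠ 1 → ‖f s‖ ≤ ‖F s‖ / ‖s + 3‖ ^ 2 := fun s hs hne => by
    rw [hf]
    simp only
    rw [hHF s hne, norm_div, norm_mul, norm_pow, norm_pow, pow_add]
    have h2 := hs3 s hs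
    rw [div_le_div_iff₀ (by positivity) (by positivity)]
    calc ‖s - 1‖ ^ m * ‖F s‖ * ‖s + 3‖ ^ 2 ≤ ‖s + 3‖ ^ m * ‖F s‖ * ‖s + 3‖ ^ 2 := by
          gcongr
          exact hs1 s hs
      _ = _ := by ring
  have hne : ∀ s : ℂ, s.re = -1 ∨ s.re = 2 → s ≠ 1 := by
    rintro s hs rfl
    norm_num at hs
  have key : ∀ s : ℂ, -1 ≤ s.re → s.re ≤ 2 → ‖f s‖ ≤ max B (C₁ + A) := by
    intro s hs hs'
    refine PhragmenLindelof.vertical_strip (a := -1) (b := 2) ?_ ⟨1, ?_, 1, ?_⟩ ?_ ?_ hs hs'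
    · refine ⟨fun z hz => (hfd z hz.1.le).differentiableWithinAt, fun z hz => ?_⟩
      have hz' : -1 ≤ z.re := by
        have : closure (re ⁻¹' Ioo (-1) 2) ⊆ {z : ℂ | -1 ≤ z.re} :=
          closure_minimal (fun z hz => hz.1.le) (isClosed_le continuous_const continuous_re)
        exact this hz
      exact (hfd z hz').continuousAt.continuousWithinAt
    · have := Real.pi_gt_three
      rw [lt_div_iff₀ (by norm_num)]
      linarith
    · refine (Asymptotics.IsBigO.of_bound 1 ?_).trans (isBigO_strip hH one_pos)
      filter_upwards [mem_inf_of_right (mem_principal_self _)] with z hz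
      rw [hf, one_mul]
      simp only
      rw [norm_div, norm_pow]
      refine div_le_self (norm_nonneg _) (one_le_pow₀ ?_)
      linarith [hs3 z hz.1.le]
    · intro z hz
      rcases le_total |z.im| T with h | h
      · refine le_max_of_le_left ?_
        have := hB z.im (abs_le.1 h)
        rwa [show (-1 + z.im * I : ℂ) = z by apply Complex.ext <;> simp [hz]] at this
      · refine le_max_of_le_right ?_
        refine (hfF z hz.ge (hne z (Or.inl hz))).trans ?_
        have h3 := hs3 z hz.ge
        rw [div_le_iff₀ (by positivity)]
        refine (h₁ z hz h).trans ?_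
        have : |z.im| ≤ ‖z + 3‖ := by
          have := abs_im_le_norm (z + 3)
          simpa using this
        gcongr
        linarith
    · intro z hz
      refine le_max_of_le_right ?_
      refine (hfF z (by linarith) (hne z (Or.inr hz))).trans ?_
      have h3 := hs3 z (by linarith)
      have h4 := hF.norm_le_of_re_eq_two hz
      have h5 : ‖F z‖ / ‖z + 3‖ ^ 2 ≤ ‖F z‖ :=
        div_le_self (norm_nonneg _) (one_le_pow₀ (by linarith))
      linarith
  refine ⟨max B (C₁ + A), m + 2, lt_max_of_lt_right (by positivity), fun s hs hs' him => ?_⟩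
  have hs1' : 1 ≤ ‖s - 1‖ := by
    have := abs_im_le_norm (s - 1)
    simp at this
    linarith
  have hne1 : s ≠ 1 := by
    rintro rfl
    simp at him
    norm_num at him
  have h := key s hs hs'
  have h3 := hs3 s hs
  rw [hf] at h
  simp only at h
  rw [norm_div, norm_pow, div_le_iff₀ (by positivity), hHF s hne1, norm_mul, norm_pow] at h
  refine le_trans ?_ h
  exact le_mul_of_one_le_left (norm_nonneg _) (one_le_pow₀ hs1')

end IsExtendedSelberg

/-! ### The exponential series and its Mellin representation -/

lemma pow_mul_exp_neg_le (n : ℕ) {δ x : ℝ} (hδ : 0 < δ) (hx : 0 ≤ x) :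
    (x + 5) ^ n * Real.exp (-(δ * x)) ≤ n.factorial * Real.exp (5 * δ) / δ ^ n := by
  have h := Real.pow_div_factorial_le_exp (δ * (x + 5)) (by positivity) n
  have hn : (0 : ℝ) < n.factorial := by exact_mod_cast n.factorial_pos
  rw [div_le_iff₀ hn, mul_pow] at h
  rw [le_div_iff₀ (by positivity)]
  calc (x + 5) ^ n * Real.exp (-(δ * x)) * δ ^ n
      = δ ^ n * (x + 5) ^ n * Real.exp (-(δ * x)) := by ring
    _ ≤ Real.exp (δ * (x + 5)) * n.factorial * Real.exp (-(δ * x)) := by gcongr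
    _ = n.factorial * (Real.exp (δ * (x + 5)) * Real.exp (-(δ * x))) := by ring
    _ = _ := by
      rw [← Real.exp_add]
      ring_nf

lemma norm_cpow_neg_eq {ρ : ℂ} (hρ : ρ ≠ 0) (s : ℂ) :
    ‖ρ ^ (-s)‖ = ‖ρ‖ ^ (-s.re) * Real.exp (arg ρ * s.im) := by
  rw [norm_cpow_of_ne_zero hρ, neg_re, neg_im, mul_neg, Real.exp_neg, div_inv_eq_mul]

lemma integrable_exp_neg_mul_abs {δ : ℝ} (hδ : 0 < δ) :
    Integrable fun t : ℝ => Real.exp (-(δ * |t|)) := by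
  have h1 : IntegrableOn (fun t : ℝ => Real.exp (-(δ * |t|))) (Ioi 0) := by
    refine (integrableOn_exp_mul_Ioi (neg_neg_of_pos hδ) 0).congr_fun (fun t ht => ?_)
      measurableSet_Ioi
    simp only
    rw [abs_of_pos ht, neg_mul]
  have h2 : IntegrableOn (fun t : ℝ => Real.exp (-(δ * |t|))) (Iic 0) := by
    refine (integrableOn_exp_mul_Iic hδ 0).congr_fun (fun t ht => ?_) measurableSet_Iic
    simp only
    rw [abs_of_nonpos ht, mul_neg, neg_neg]
  rw [← integrableOn_univ, ← Iic_union_Ioi (a := (0 : ℝ))]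
  exact h2.union h1

lemma continuous_Gamma_line : Continuous fun t : ℝ => Gamma (2 + t * I) := by
  refine continuous_iff_continuousAt.2 fun t => ?_
  refine ContinuousAt.comp (f := fun t : ℝ => (2 + t * I : ℂ)) (g := Gamma)
    (differentiableAt_Gamma _ fun m h => ?_).continuousAt (by fun_prop)
  have := congrArg re h
  simp at this
  have : (0 : ℝ) ≤ m := Nat.cast_nonneg m
  linarith

lemma abs_arg_lt_of_re_pos {ρ : ℂ} (hρ : 0 < ρ.re) : |arg ρ| < Real.pi / 2 :=
  abs_arg_lt_pi_div_two_iff.2 (Or.inl hρ)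

lemma integrable_Gamma_mul_cpow {ρ : ℂ} (hρ : 0 < ρ.re) :
    Integrable fun t : ℝ => Gamma (2 + t * I) * ρ ^ (-(2 + t * I)) := by
  obtain ⟨C, Y, hC, hY, hG⟩ := exists_norm_Gamma_le
  have hρ0 : ρ ≠ 0 := by
    rintro rfl
    simp at hρ
  have hρn : 0 < ‖ρ‖ := norm_pos_iff.2 hρ0
  set δ := Real.pi / 2 - |arg ρ| with hδdef
  have hδ : 0 < δ := sub_pos.2 (abs_arg_lt_of_re_pos hρ)
  have hcont : Continuous fun t : ℝ => Gamma (2 + t * I) * ρ ^ (-(2 + t * I)) := by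
    refine continuous_Gamma_line.mul ?_
    exact Continuous.const_cpow (by fun_prop) (Or.inl hρ0)
  obtain ⟨B, hB⟩ := isCompact_Icc.exists_bound_of_continuousOn (s := Icc (-Y) Y) hcont.continuousOn
  set K := C * ‖ρ‖ ^ (-2 : ℝ) * ((2 : ℕ).factorial * Real.exp (5 * (δ / 2)) / (δ / 2) ^ 2)
  refine Integrable.mono' (((integrable_exp_neg_mul_abs (half_pos hδ)).const_mul
    (max B 0 * Real.exp (δ / 2 * Y) + K))) hcont.aestronglyMeasurable
    (Eventually.of_forall fun t => ?_)
  have hK : 0 ≤ K := by positivity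
  rcases le_total |t| Y with h | h
  · have h1 := hB t (abs_le.1 h)
    calc _ ≤ max B 0 * 1 := by rw [mul_one]; exact h1.trans (le_max_left _ _)
      _ ≤ max B 0 * (Real.exp (δ / 2 * Y) * Real.exp (-(δ / 2 * |t|))) := by
        gcongr
        rw [← Real.exp_add]
        apply Real.one_le_exp
        have : δ / 2 * |t| ≤ δ / 2 * Y := by gcongr
        linarith
      _ = (max B 0 * Real.exp (δ / 2 * Y)) * Real.exp (-(δ / 2 * |t|)) := by ring
      _ ≤ _ := by
        gcongr
        linarith
  · have h1 := hG (2 + t * I) (by simp; norm_num) (by simp) (by simpa using h)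
    have h2 : ‖ρ ^ (-(2 + t * I) : ℂ)‖ ≤ ‖ρ‖ ^ (-2 : ℝ) * Real.exp (|arg ρ| * |t|) := by
      rw [norm_cpow_neg_eq hρ0]
      simp only [add_re, re_ofNat, mul_re, ofReal_re, I_re, mul_zero, ofReal_im, I_im, sub_self,
        add_zero, add_im, im_ofNat, mul_im, mul_one, zero_add]
      refine mul_le_mul_of_nonneg_left (Real.exp_le_exp.2 ?_) (by positivity)
      rw [← abs_mul]
      exact le_abs_self _
    have h3 : ‖(2 + t * I : ℂ)‖ ≤ |t| + 5 := by
      refine (norm_add_le _ _).trans ?_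
      simp
      linarith
    simp only [add_im, im_ofNat, mul_im, ofReal_re, I_im, mul_one, ofReal_im, I_re, mul_zero,
      add_zero, zero_add] at h1
    rw [norm_mul]
    calc _ ≤ (C * (|t| + 5) ^ 2 * Real.exp (-(Real.pi / 2 * |t|))) *
          (‖ρ‖ ^ (-2 : ℝ) * Real.exp (|arg ρ| * |t|)) := by
          gcongr
          exact h1.trans (by gcongr)
      _ = C * ‖ρ‖ ^ (-2 : ℝ) * ((|t| + 5) ^ 2 * Real.exp (-(δ / 2 * |t|))) *
          Real.exp (-(δ / 2 * |t|)) := by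
          have hE : Real.exp (-(Real.pi / 2 * |t|)) * Real.exp (|arg ρ| * |t|) =
              Real.exp (-(δ / 2 * |t|)) * Real.exp (-(δ / 2 * |t|)) := by
            rw [← Real.exp_add, ← Real.exp_add]
            congr 1
            rw [hδdef]
            ring
          linear_combination C * (|t| + 5) ^ 2 * ‖ρ‖ ^ (-2 : ℝ) * hE
      _ ≤ K * Real.exp (-(δ / 2 * |t|)) := by
          gcongr
          exact mul_le_mul_of_nonneg_left (pow_mul_exp_neg_le 2 (half_pos hδ) (abs_nonneg t))
            (by positivity)
      _ ≤ _ := by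
          gcongr
          have : 0 ≤ max B 0 * Real.exp (δ / 2 * Y) := by positivity
          linarith

/-- The inverse Mellin transform of the Gamma function, with complex scaling. -/
lemma integral_Gamma_mul_cpow {ρ : ℂ} (hρ : 0 < ρ.re) {x : ℝ} (hx : 0 < x) :
    ∫ t : ℝ, (x : ℂ) ^ (-(2 + t * I)) * (Gamma (2 + t * I) * ρ ^ (-(2 + t * I))) =
      2 * Real.pi * exp (-(ρ * x)) := by
  have hm : ∀ s : ℂ, 0 < s.re → mellin (fun u : ℝ => exp (-(ρ * u))) s = ρ ^ (-s) * Gamma s :=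
    fun s hs => integral_cpow_mul_exp_neg_mul hs hρ
  have hm2 : ∀ t : ℝ, mellin (fun u : ℝ => exp (-(ρ * u))) (2 + t * I) =
      Gamma (2 + t * I) * ρ ^ (-(2 + t * I)) := fun t => by
    rw [hm _ (by simp), mul_comm]
  have h := mellinInv_mellin_eq 2 (fun u : ℝ => exp (-(ρ * u))) hx
    (integrableOn_cpow_mul_exp_neg_mul (by simp) hρ) (by
      rw [Complex.VerticalIntegrable]
      simp only [ofReal_ofNat, hm2]
      exact integrable_Gamma_mul_cpow hρ) (by fun_prop)
  rw [mellinInv] at h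
  simp only [ofReal_ofNat, hm2, smul_eq_mul, real_smul] at h
  have hπ : (Real.pi : ℂ) ≠ 0 := ofReal_ne_zero.2 Real.pi_ne_zero
  have h2 : (2 * Real.pi : ℂ) * ((1 / (2 * Real.pi) : ℝ) : ℂ) = 1 := by
    push_cast
    field_simp
  rw [← h, ← mul_assoc, h2, one_mul]

/-- The exponential series `∑_{n ≥ 1} a(n) e(nz)` in the upper half-plane. -/
def expSeries (a : ℕ → ℂ) (z : ℂ) : ℂ :=
  ∑' n : ℕ, if n = 0 then 0 else a n * exp (2 * Real.pi * I * n * z)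

lemma expSeries_add_one (a : ℕ → ℂ) (z : ℂ) : expSeries a (z + 1) = expSeries a z := by
  refine tsum_congr fun n => ?_
  split_ifs
  · rfl
  · rw [mul_add, exp_add, mul_one, show 2 * Real.pi * I * n = n * (2 * Real.pi * I) by ring,
      exp_nat_mul_two_pi_mul_I, mul_one]

/-- The scaling parameter `-2πiz` of the Mellin representation of `expSeries`. -/
def scale (z : ℂ) : ℂ := -(2 * Real.pi * I * z)

lemma scale_re (z : ℂ) : (scale z).re = 2 * Real.pi * z.im := by
  simp [scale]

lemma log_scale {z : ℂ} (hz : 0 < z.im) :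
    log (scale z) = Real.log (2 * Real.pi) + log z - Real.pi / 2 * I := by
  have hz0 : z ≠ 0 := by
    rintro rfl
    simp at hz
  have hπ : 0 < 2 * Real.pi := by have := Real.pi_pos; linarith
  have h1 : 0 < arg z := by
    refine lt_of_le_of_ne (arg_nonneg_iff.2 hz.le) fun h => ?_
    have := (arg_eq_zero_iff.1 h.symm).2
    linarith
  have h2 := arg_le_pi z
  have h3 := Real.pi_pos
  have e : scale z = exp (Real.log (2 * Real.pi) + log z - Real.pi / 2 * I) := by
    rw [exp_sub, exp_add, exp_log hz0, exp_pi_div_two_mul_I, ← ofReal_exp, Real.exp_log hπ, scale,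
      div_I]
    push_cast
    ring
  rw [e, log_exp]
  · simp [log_im]
    linarith
  · simp [log_im]
    linarith

lemma arg_scale {z : ℂ} (hz : 0 < z.im) : arg (scale z) = arg z - Real.pi / 2 := by
  have := congrArg im (log_scale hz)
  simpa [log_im] using this

lemma norm_scale (z : ℂ) : ‖scale z‖ = 2 * Real.pi * ‖z‖ := by
  rw [scale, norm_neg]
  simp [abs_of_pos Real.pi_pos]

namespace IsExtendedSelberg

variable {a : ℕ → ℂ} {F : ℂ → ℂ} {D : SelbergData}

/-- The exponential series as an inverse Mellin transform of `Γ(s) F(s)` on the line `Re s = 2`. -/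
lemma integral_eq_expSeries (hF : IsExtendedSelberg a F D) {z : ℂ} (hz : 0 < z.im) :
    ∫ t : ℝ, F (2 + t * I) * (Gamma (2 + t * I) * scale z ^ (-(2 + t * I))) =
      2 * Real.pi * expSeries a z := by
  have hρ : 0 < (scale z).re := by
    rw [scale_re]
    have := Real.pi_pos
    positivity
  have hI := integrable_Gamma_mul_cpow hρ
  have hterm : ∀ (n : ℕ) (t : ℝ), ‖LSeries.term a (2 + t * I) n‖ = ‖LSeries.term a 2 n‖ :=
    fun n t => norm_term_of_re_eq a (by simp) n
  have hcont : ∀ n : ℕ, Continuous fun t : ℝ => LSeries.term a (2 + t * I) n := fun n => by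
    rcases eq_or_ne n 0 with rfl | hn
    · simpa using continuous_const
    · simp only [LSeries.term_of_ne_zero hn]
      have hn' : (n : ℂ) ≠ 0 := Nat.cast_ne_zero.2 hn
      refine continuous_const.div (Continuous.const_cpow (by fun_prop) (Or.inl hn'))
        fun t => by simp [cpow_eq_zero_iff, hn]
  have hint : ∀ n : ℕ, Integrable fun t : ℝ => LSeries.term a (2 + t * I) n *
      (Gamma (2 + t * I) * scale z ^ (-(2 + t * I))) := fun n =>
    hI.bdd_mul (c := ‖LSeries.term a 2 n‖) (hcont n).aestronglyMeasurable
      (Eventually.of_forall fun t => (hterm n t).le)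
  have hsum := hasSum_integral_of_summable_integral_norm hint (by
    have : ∀ n, ∫ t : ℝ, ‖LSeries.term a (2 + t * I) n *
        (Gamma (2 + t * I) * scale z ^ (-(2 + t * I)))‖ = ‖LSeries.term a 2 n‖ *
        ∫ t : ℝ, ‖Gamma (2 + t * I) * scale z ^ (-(2 + t * I))‖ := fun n => by
      rw [← integral_const_mul]
      refine integral_congr_ae (Eventually.of_forall fun t => ?_)
      simp only [norm_mul, hterm]
    simp_rw [this]
    exact hF.summable_norm_term.mul_right _)
  have e1 : ∀ t : ℝ, ∑' n, LSeries.term a (2 + t * I) n *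
      (Gamma (2 + t * I) * scale z ^ (-(2 + t * I))) =
      F (2 + t * I) * (Gamma (2 + t * I) * scale z ^ (-(2 + t * I))) := fun t => by
    rw [tsum_mul_right, hF.eq_LSeries _ (by simp), LSeries]
  simp_rw [e1] at hsum
  rw [← hsum.tsum_eq, expSeries, ← tsum_mul_left]
  refine tsum_congr fun n => ?_
  split_ifs with hn
  · simp [hn]
  · have hx : (0 : ℝ) < n := Nat.cast_pos.2 (Nat.pos_of_ne_zero hn)
    have h := integral_Gamma_mul_cpow hρ hx
    have e2 : exp (2 * Real.pi * I * n * z) = exp (-(scale z * (n : ℝ))) := by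
      rw [scale]
      congr 1
      push_cast
      ring
    rw [e2, mul_left_comm, ← h, ← integral_const_mul]
    refine integral_congr_ae (Eventually.of_forall fun t => ?_)
    simp only
    rw [LSeries.term_of_ne_zero hn, cpow_neg (((n : ℝ) : ℂ)), div_eq_mul_inv, ofReal_natCast]
    ring

end IsExtendedSelberg

/-! ### Shifting the line of integration -/

/-- The integrand of the Mellin representation of `expSeries`. -/
def mellinIntegrand (F : ℂ → ℂ) (z s : ℂ) : ℂ := F s * (Gamma s * scale z ^ (-s))

lemma rpow_le_of_mem_Icc {x u : ℝ} (hx : 0 < x) (h1 : -2 ≤ u) (h2 : u ≤ 1) :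
    x ^ u ≤ x ^ (-2 : ℝ) + x := by
  rcases le_total x 1 with h | h
  · have := Real.rpow_le_rpow_of_exponent_ge hx h h1
    linarith
  · have := Real.rpow_le_rpow_of_exponent_le h h2
    rw [Real.rpow_one] at this
    have := Real.rpow_pos_of_pos hx (-2)
    linarith

lemma arg_pos_of_im_pos {z : ℂ} (hz : 0 < z.im) : 0 < arg z := by
  refine lt_of_le_of_ne (arg_nonneg_iff.2 hz.le) fun h => ?_
  have := (arg_eq_zero_iff.1 h.symm).2
  linarith

namespace IsExtendedSelberg

variable {a : ℕ → ℂ} {F : ℂ → ℂ} {D : SelbergData}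

/-- In the lower part of the strip the decay of `Γ(s)` and the growth of `(-2πiz) ^ (-s)` leave, up
to powers of `|Im s|`, the factor `e ^ (-arg(z) |Im s|)`, uniformly in `z`. -/
lemma exists_norm_mellinIntegrand_le (hF : IsExtendedSelberg a F D) (hd : D.degree = 1) :
    ∃ (C Y : ℝ) (N : ℕ), 0 < C ∧ 1 ≤ Y ∧ ∀ z : ℂ, 0 < z.im → ∀ s : ℂ, -1 ≤ s.re → s.re ≤ 2 →
      s.im ≤ -Y → ‖mellinIntegrand F z s‖ ≤ C * (‖scale z‖ ^ (-2 : ℝ) + ‖scale z‖) *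
        ((-s.im + 5) ^ N * Real.exp (-(arg z * -s.im))) := by
  obtain ⟨C₁, Y, hC₁, hY, hG⟩ := exists_norm_Gamma_le
  obtain ⟨C₂, N, hC₂, hFs⟩ := hF.exists_norm_le_strip hd
  refine ⟨C₁ * C₂, Y, N + 2, by positivity, hY, fun z hz s hs1 hs2 him => ?_⟩
  have hz0 : z ≠ 0 := by
    rintro rfl
    simp at hz
  have hπ := Real.pi_pos
  have hsc : 0 < ‖scale z‖ := by
    rw [norm_scale]
    have := norm_pos_iff.2 hz0
    positivity
  have habs : |s.im| = -s.im := abs_of_nonpos (by linarith)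
  have h1 := hG s hs1 hs2 (by rw [habs]; linarith)
  have h2 := hFs s hs1 hs2 (by rw [habs]; linarith)
  have h3 := norm_cpow_neg_eq (norm_pos_iff.1 hsc) s
  have h4 := rpow_le_of_mem_Icc (u := -s.re) hsc (by linarith) (by linarith)
  have hre : |s.re| ≤ 2 := abs_le.2 ⟨by linarith, hs2⟩
  have hn := norm_le_abs_re_add_abs_im s
  rw [habs] at hn h1
  have h5 : ‖s‖ ≤ -s.im + 5 := by linarith
  have h6 : ‖s + 3‖ ≤ -s.im + 5 := by
    refine (norm_add_le _ _).trans ?_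
    norm_num
    linarith
  have hE : Real.exp (-(Real.pi / 2 * -s.im)) * Real.exp (arg (scale z) * s.im) =
      Real.exp (-(arg z * -s.im)) := by
    rw [← Real.exp_add, arg_scale hz]
    congr 1
    ring
  have hpos : 0 ≤ -s.im + 5 := by linarith
  rw [mellinIntegrand, norm_mul, norm_mul, h3]
  calc ‖F s‖ * (‖Gamma s‖ * (‖scale z‖ ^ (-s.re) * Real.exp (arg (scale z) * s.im)))
      ≤ (C₂ * (-s.im + 5) ^ N) * ((C₁ * (-s.im + 5) ^ 2 * Real.exp (-(Real.pi / 2 * -s.im))) *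
        ((‖scale z‖ ^ (-2 : ℝ) + ‖scale z‖) * Real.exp (arg (scale z) * s.im))) := by
        gcongr
        · exact h2.trans (by gcongr)
        · exact h1.trans (by gcongr)
    _ = _ := by
      rw [← hE]
      ring

lemma differentiableAt_mellinIntegrand (hF : IsExtendedSelberg a F D) {z s : ℂ} (hz : 0 < z.im)
    (hs : s.im ≠ 0) : DifferentiableAt ℂ (mellinIntegrand F z) s := by
  have h1 : s ≠ 1 := by
    rintro rfl
    simp at hs
  have hsc : scale z ≠ 0 := by
    intro h
    have := scale_re z
    rw [h, zero_re] at this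
    have := Real.pi_pos
    have : 0 < 2 * Real.pi * z.im := by positivity
    linarith
  refine (hF.differentiableAt h1).mul ((differentiableAt_Gamma s fun m h => ?_).mul ?_)
  · have := congrArg im h
    simp at this
    exact hs this
  · exact differentiableAt_id.neg.const_cpow (Or.inl hsc)

/-- Integrability of the Mellin integrand on downward half-lines, and the vanishing of the integral
over horizontal segments as they move down. -/
lemma mellinIntegrand_decay (hF : IsExtendedSelberg a F D) (hd : D.degree = 1) :
    ∃ Y : ℝ, 1 ≤ Y ∧ ∀ z : ℂ, 0 < z.im → ∀ T, Y ≤ T →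
      (∀ σ : ℝ, -1 ≤ σ → σ ≤ 2 →
        IntegrableOn (fun t : ℝ => mellinIntegrand F z (σ - t * I)) (Ioi T)) ∧
      Tendsto (fun R : ℝ => ∫ x in (-1 : ℝ)..2, mellinIntegrand F z (x - R * I)) atTop (𝓝 0) := by
  obtain ⟨C, Y, N, hC, hY, h⟩ := hF.exists_norm_mellinIntegrand_le hd
  refine ⟨Y, hY, fun z hz T hT => ?_⟩
  have hδ := arg_pos_of_im_pos hz
  set δ := arg z with hδdef
  set K := C * (‖scale z‖ ^ (-2 : ℝ) + ‖scale z‖) *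
    (N.factorial * Real.exp (5 * (δ / 2)) / (δ / 2) ^ N) with hK
  have hK0 : 0 ≤ K := by positivity
  have hb : ∀ s : ℂ, -1 ≤ s.re → s.re ≤ 2 → s.im ≤ -Y →
      ‖mellinIntegrand F z s‖ ≤ K * Real.exp (-(δ / 2 * -s.im)) := fun s h1 h2 h3 => by
    refine (h z hz s h1 h2 h3).trans ?_
    have h4 := pow_mul_exp_neg_le N (half_pos hδ) (x := -s.im) (by linarith)
    have h5 : Real.exp (-(δ * -s.im)) = Real.exp (-(δ / 2 * -s.im)) * Real.exp (-(δ / 2 * -s.im)) := by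
      rw [← Real.exp_add]
      congr 1
      ring
    rw [h5, ← mul_assoc, ← mul_assoc, mul_assoc (C * _), hK]
    gcongr
  refine ⟨fun σ h1 h2 => ?_, ?_⟩
  · have hexp : IntegrableOn (fun t : ℝ => K * Real.exp (-(δ / 2 * t))) (Ioi T) := by
      have := (integrableOn_exp_mul_Ioi (neg_neg_of_pos (half_pos hδ)) T).const_mul K
      simpa [neg_mul, IntegrableOn] using this
    refine Integrable.mono' hexp ?_ ?_
    · refine ContinuousOn.aestronglyMeasurable (fun t ht => ?_) measurableSet_Ioi
      have ht' : T < t := ht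
      refine ContinuousAt.continuousWithinAt ?_
      refine ContinuousAt.comp (f := fun t : ℝ => (σ - t * I : ℂ)) (g := mellinIntegrand F z)
        (hF.differentiableAt_mellinIntegrand hz ?_).continuousAt (by fun_prop)
      simp
      linarith
    · refine (ae_restrict_mem measurableSet_Ioi).mono fun t ht => ?_
      have ht' : T < t := ht
      have := hb (σ - t * I) (by simpa using h1) (by simpa using h2) (by simp; linarith)
      simpa using this
  · have hlim : Tendsto (fun R : ℝ => K * Real.exp (-(δ / 2 * R)) * |2 - (-1 : ℝ)|) atTop (𝓝 0) := by
      have := ((Real.tendsto_exp_neg_atTop_nhds_zero.comp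
        (tendsto_id.const_mul_atTop (half_pos hδ))).const_mul K).mul_const |2 - (-1 : ℝ)|
      rw [mul_zero, zero_mul] at this
      exact this
    refine squeeze_zero_norm' ?_ hlim
    filter_upwards [eventually_ge_atTop Y] with R hR
    refine intervalIntegral.norm_integral_le_of_norm_le_const fun x hx => ?_
    rw [uIoc_of_le (by norm_num)] at hx
    have := hb (x - R * I) (by simp; linarith [hx.1]) (by simpa using hx.2) (by simpa using hR)
    simpa using this

/-- The part of the Mellin integral below `Im s = -T` is moved from `Re s = 2` to `Re s = -1`. No
poles are met; the horizontal segment at height `-T` remains. -/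
lemma integral_shift (hF : IsExtendedSelberg a F D) (hd : D.degree = 1) :
    ∃ Y : ℝ, 1 ≤ Y ∧ ∀ z : ℂ, 0 < z.im → ∀ T, Y ≤ T →
      IntegrableOn (fun t : ℝ => mellinIntegrand F z (-1 - t * I)) (Ioi T) ∧
      ∫ t : ℝ in Ioi T, mellinIntegrand F z (2 - t * I) =
        (∫ t : ℝ in Ioi T, mellinIntegrand F z (-1 - t * I)) -
          I * ∫ x in (-1 : ℝ)..2, mellinIntegrand F z (x - T * I) := by
  obtain ⟨Y, hY, h⟩ := hF.mellinIntegrand_decay hd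
  refine ⟨Y, hY, fun z hz T hT => ?_⟩
  obtain ⟨hint, hlim⟩ := h z hz T hT
  have hi1 := hint (-1) le_rfl (by norm_num)
  have hi2 := hint 2 (by norm_num) le_rfl
  push_cast at hi1 hi2
  refine ⟨hi1, ?_⟩
  have hl1 := intervalIntegral_tendsto_integral_Ioi T hi1 tendsto_id
  have hl2 := intervalIntegral_tendsto_integral_Ioi T hi2 tendsto_id
  have key := (hlim.sub_const (∫ x in (-1 : ℝ)..2, mellinIntegrand F z (x - T * I))).add
    ((hl2.const_mul I).sub (hl1.const_mul I))
  have hzero : ∀ᶠ R : ℝ in atTop, (∫ x in (-1 : ℝ)..2, mellinIntegrand F z (x - R * I)) -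
      (∫ x in (-1 : ℝ)..2, mellinIntegrand F z (x - T * I)) +
      (I * (∫ t in T..id R, mellinIntegrand F z (2 - t * I)) -
        I * ∫ t in T..id R, mellinIntegrand F z (-1 - t * I)) = 0 := by
    filter_upwards [eventually_ge_atTop T] with R hR
    have hrect := integral_boundary_rect_eq_zero_of_differentiableOn (mellinIntegrand F z)
      (-1 - R * I) (2 - T * I) (fun s hs => by
        refine (hF.differentiableAt_mellinIntegrand hz ?_).differentiableWithinAt
        have := hs.2
        simp only [mem_preimage] at this
        rw [uIcc_of_le (by simpa using hR)] at this
        have h2 := this.2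
        simp at h2
        linarith)
    simp only [sub_re, neg_re, one_re, mul_re, ofReal_re, I_re, mul_zero, ofReal_im, I_im, sub_self,
      sub_zero, re_ofNat, sub_im, neg_im, one_im, neg_zero, mul_im, mul_one, add_zero, zero_sub,
      im_ofNat, smul_eq_mul] at hrect
    have e : ∀ c : ℂ, ∫ y in (-R)..(-T), mellinIntegrand F z (c + y * I) =
        ∫ t in T..R, mellinIntegrand F z (c - t * I) := fun c => by
      rw [← intervalIntegral.integral_comp_neg fun y : ℝ => mellinIntegrand F z (c + y * I)]
      refine intervalIntegral.integral_congr fun t _ => ?_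
      simp [sub_eq_add_neg]
    have e2 : ∀ R : ℝ, ∫ x in (-1 : ℝ)..2, mellinIntegrand F z (x + (-R : ℝ) * I) =
        ∫ x in (-1 : ℝ)..2, mellinIntegrand F z (x - R * I) := fun R => by
      refine intervalIntegral.integral_congr fun t _ => ?_
      simp [sub_eq_add_neg]
    rw [e2, e2] at hrect
    push_cast at hrect
    rw [e, e] at hrect
    rw [id, ← hrect]
    ring
  have h0 := tendsto_nhds_unique (key.congr' hzero) tendsto_const_nhds
  have hI := I_mul_I
  linear_combination (-I) * h0 + ((∫ t : ℝ in Ioi T, mellinIntegrand F z (2 - t * I)) -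
    (∫ t : ℝ in Ioi T, mellinIntegrand F z (-1 - t * I))) * hI

end IsExtendedSelberg

/-! ### Boundary behaviour of the exponential series -/

/-- The coefficients `conj (a(n) / n ^ 2)` of the Dirichlet series `conj (F (conj s))` on the line
`Re s = 2`. -/
def conjCoeff (a : ℕ → ℂ) (n : ℕ) : ℂ := starRingEnd ℂ (LSeries.term a 2 n)

/-- The Dirichlet series `conj (F (2 - it))` as a function of `t`. -/
def conjSeries (a : ℕ → ℂ) (t : ℝ) : ℂ :=
  ∑' n : ℕ, conjCoeff a n * exp (-(I * Real.log n * t))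

/-- The exponent `-i log (qz)` of the Mellin integrand on the left line. -/
def leftExponent (q : ℝ) (z : ℂ) : ℂ := -(I * (Real.log q + log z))

lemma conj_term (a : ℕ → ℂ) (t : ℝ) (n : ℕ) :
    starRingEnd ℂ (LSeries.term a (2 - t * I) n) =
      conjCoeff a n * exp (-(I * Real.log n * t)) := by
  rw [conjCoeff]
  rcases eq_or_ne n 0 with rfl | hn
  · simp
  · have hn' : (0 : ℝ) < n := Nat.cast_pos.2 (Nat.pos_of_ne_zero hn)
    rw [LSeries.term_of_ne_zero hn, LSeries.term_of_ne_zero hn, ← ofReal_natCast,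
      ofReal_cpow_eq_exp hn', ofReal_cpow_eq_exp hn', map_div₀, map_div₀, ← exp_conj, ← exp_conj,
      div_eq_mul_inv, div_eq_mul_inv, ← exp_neg, ← exp_neg, mul_assoc, ← exp_add]
    congr 2
    simp only [map_mul, map_sub, conj_ofReal, conj_I, map_ofNat]
    ring

lemma norm_conjCoeff (a : ℕ → ℂ) (n : ℕ) : ‖conjCoeff a n‖ = ‖LSeries.term a 2 n‖ := by
  rw [conjCoeff, RCLike.norm_conj]

lemma norm_exp_neg_I_mul (ρ t : ℝ) : ‖exp (-(I * ρ * t))‖ = 1 := by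
  rw [norm_exp]
  simp

lemma norm_ofReal_cpow_neg_I_mul {t : ℝ} (ht : 0 < t) (θ : ℝ) : ‖(t : ℂ) ^ (-(I * θ))‖ = 1 := by
  rw [norm_cpow_eq_rpow_re_of_pos ht]
  simp

lemma norm_ofReal_cpow_one_sub {y : ℝ} (hy : 0 < y) (θ : ℝ) : ‖(y : ℂ) ^ (1 - I * θ)‖ = y := by
  rw [norm_cpow_eq_rpow_re_of_pos hy]
  simp

lemma tendsto_cpow_mul_zero {θ : ℝ} {f : ℝ → ℂ}
    (h : Tendsto (fun y : ℝ => (y : ℂ) * f y) (𝓝[>] 0) (𝓝 0)) :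
    Tendsto (fun y : ℝ => (y : ℂ) ^ (1 - I * θ) * f y) (𝓝[>] 0) (𝓝 0) := by
  rw [tendsto_zero_iff_norm_tendsto_zero] at h ⊢
  refine h.congr' ?_
  filter_upwards [eventually_mem_nhdsWithin] with y (hy : 0 < y)
  rw [norm_mul, norm_mul, norm_ofReal_cpow_one_sub hy, norm_real, Real.norm_of_nonneg hy.le]

lemma tendsto_cpow_mul_zero_of_bounded {θ : ℝ} {f : ℝ → ℂ} {M : ℝ}
    (h : ∀ᶠ y : ℝ in 𝓝[>] (0 : ℝ), ‖f y‖ ≤ M) :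
    Tendsto (fun y : ℝ => (y : ℂ) ^ (1 - I * θ) * f y) (𝓝[>] 0) (𝓝 0) := by
  have h0 : Tendsto (fun y : ℝ => y * M) (𝓝[>] 0) (𝓝 0) := by
    have : Tendsto (fun y : ℝ => y * M) (𝓝 0) (𝓝 (0 * M)) := by
      exact (continuous_id.mul continuous_const).tendsto 0
    rw [zero_mul] at this
    exact this.mono_left nhdsWithin_le_nhds
  refine squeeze_zero_norm' ?_ h0
  filter_upwards [eventually_mem_nhdsWithin, h] with y (hy : 0 < y) hM
  rw [norm_mul, norm_ofReal_cpow_one_sub hy]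
  gcongr

namespace IsExtendedSelberg

variable {a : ℕ → ℂ} {F : ℂ → ℂ} {D : SelbergData}

lemma summable_norm_conjCoeff (hF : IsExtendedSelberg a F D) :
    Summable fun n => ‖conjCoeff a n‖ := by
  simpa only [norm_conjCoeff] using hF.summable_norm_term

lemma continuous_conjSeries (hF : IsExtendedSelberg a F D) : Continuous (conjSeries a) := by
  refine continuous_tsum (fun n => by fun_prop) hF.summable_norm_conjCoeff fun n t => ?_
  rw [norm_mul, norm_exp_neg_I_mul, mul_one]

lemma norm_conjSeries_le (hF : IsExtendedSelberg a F D) (t : ℝ) :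
    ‖conjSeries a t‖ ≤ ∑' n, ‖conjCoeff a n‖ := by
  refine tsum_of_norm_bounded hF.summable_norm_conjCoeff.hasSum fun n => ?_
  rw [norm_mul, norm_exp_neg_I_mul, mul_one]

lemma conj_apply_two_sub (hF : IsExtendedSelberg a F D) (t : ℝ) :
    starRingEnd ℂ (F (2 - t * I)) = conjSeries a t := by
  rw [hF.eq_LSeries _ (by simp), LSeries, conjSeries, conj_tsum]
  exact tsum_congr fun n => conj_term a t n

/-- The Mellin integrand on the line `Re s = -1`, far below the real axis, rewritten with the
functional equation. -/
lemma mellinIntegrand_left (hF : IsExtendedSelberg a F D) :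
    ∃ T : ℝ, 0 < T ∧ ∀ t, T ≤ t → ∀ z : ℂ, 0 < z.im →
      mellinIntegrand F z (-1 - t * I) = D.conductor * z * (D.oscFactor t *
        ((t : ℂ) ^ (-(I * D.theta)) * conjSeries a t * exp (-(leftExponent D.conductor z * t)))) := by
  obtain ⟨T, hT, hreg⟩ := D.exists_gammaRegularAt
  refine ⟨T, hT, fun t ht z hz => ?_⟩
  have ht0 : 0 < t := hT.trans_le ht
  have hz0 : z ≠ 0 := by
    rintro rfl
    simp at hz
  have hπ : 0 < 2 * Real.pi := by have := Real.pi_pos; linarith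
  have hsc : scale z ≠ 0 := by
    rw [scale]
    simp [hz0, Real.pi_ne_zero]
  have hhl : SelbergData.halfLine (-1) t = 2 + t * I := by simp [SelbergData.halfLine]
  have hFE := hF.one_sub_eq (s := 2 + t * I) (fun h => by have := congrArg re h; simp at this)
    (fun h => by have := congrArg re h; simp at this)
    (hreg _ (by simpa [abs_of_pos ht0] using ht)) (hreg _ (by simpa [abs_of_pos ht0] using ht))
  have e1 : (1 : ℂ) - (2 + t * I) = -1 - t * I := by ring
  have e2 : starRingEnd ℂ (2 + t * I) = 2 - t * I := by simp [sub_eq_add_neg, Complex.conj_ofNat]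
  rw [e1, e2, hF.conj_apply_two_sub] at hFE
  rw [mellinIntegrand, hFE, SelbergData.oscFactor, hhl]
  have e3 : (t : ℂ) ^ (I * D.theta) * (t : ℂ) ^ (-(I * D.theta)) = 1 := by
    rw [← cpow_add _ _ (ofReal_ne_zero.2 ht0.ne'), add_neg_cancel, cpow_zero]
  have e4 : scale z ^ (-(-1 - t * I)) = (-I * Real.exp (Real.pi / 2 * t)) *
      ((2 * Real.pi : ℝ) : ℂ) ^ (1 + t * I) * (D.conductor : ℂ) ^ (-(1 + t * I)) *
      (D.conductor * z * exp (-(leftExponent D.conductor z * t))) := by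
    rw [cpow_def_of_ne_zero hsc, log_scale hz, ofReal_cpow_eq_exp D.conductor_pos,
      ofReal_cpow_eq_exp hπ, leftExponent]
    have h1 : (-I : ℂ) = exp (-(Real.pi / 2 * I)) := by
      rw [exp_neg, exp_pi_div_two_mul_I, inv_I]
    have h2 : (D.conductor : ℂ) * z = exp (Real.log D.conductor + log z) := by
      rw [exp_add, exp_log hz0, ← ofReal_exp, Real.exp_log D.conductor_pos]
    rw [h1, h2]
    rw [ofReal_exp]
    simp only [← exp_add]
    congr 1
    push_cast
    have hI := I_mul_I
    linear_combination (-(t * Real.pi / 2 : ℂ)) * hI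
  rw [e4]
  linear_combination (-(D.funRatio (2 + t * I) * conjSeries a t * Gamma (-1 - t * I) *
    (-I * Real.exp (Real.pi / 2 * t)) *
      ((2 * Real.pi : ℝ) : ℂ) ^ (1 + t * I) * (D.conductor : ℂ) ^ (-(1 + t * I)) *
      (D.conductor * z * exp (-(leftExponent D.conductor z * t))))) * e3

lemma integrable_mellinIntegrand (hF : IsExtendedSelberg a F D) {z : ℂ} (hz : 0 < z.im) :
    Integrable fun t : ℝ => mellinIntegrand F z (2 + t * I) := by
  have hρ : 0 < (scale z).re := by
    rw [scale_re]
    have := Real.pi_pos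
    positivity
  refine (integrable_Gamma_mul_cpow hρ).bdd_mul (c := ∑' n, ‖LSeries.term a 2 n‖) ?_
    (Eventually.of_forall fun t => hF.norm_le_of_re_eq_two (by simp))
  refine (continuous_iff_continuousAt.2 fun t => ?_).aestronglyMeasurable
  refine ContinuousAt.comp (f := fun t : ℝ => (2 + t * I : ℂ)) (g := F)
    (hF.differentiableAt fun h => ?_).continuousAt (by fun_prop)
  have := congrArg re h
  simp at this

end IsExtendedSelberg

/-- As `z = α + iy` tends to `α`, the exponent `-i log (qz)` tends to `-i log (qα)` from within the
right half-plane, with speed `1/α`. -/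
lemma tendsto_leftExponent {q α : ℝ} (hq : 0 < q) (hα : 0 < α) :
    Tendsto (fun y : ℝ => (leftExponent q (α + y * I) + I * Real.log (q * α)) / y) (𝓝[>] 0)
      (𝓝 ((1 / α : ℝ) : ℂ)) := by
  have hd : HasDerivAt (fun y : ℝ => log (α + y * I)) (I / α) 0 := by
    have h1 : HasDerivAt (fun y : ℝ => (α + y * I : ℂ)) I 0 := by
      simpa using ((hasDerivAt_id (0 : ℝ)).ofReal_comp.mul_const I).const_add (α : ℂ)
    have := h1.clog_real (by simp [slitPlane, hα])
    simpa using this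
  have h2 := (hasDerivAt_iff_tendsto_slope.1 hd).mono_left
    (nhdsWithin_mono (0 : ℝ) (t := {0}ᶜ) (s := Ioi 0) fun x hx => ne_of_gt hx)
  refine tendsto_of_tendsto_of_eq ((h2.const_mul (-I)).congr' ?_) ?_
  · filter_upwards [eventually_mem_nhdsWithin] with y (hy : 0 < y)
    rw [slope_def_module, leftExponent, Real.log_mul hq.ne' hα.ne', real_smul, sub_zero]
    push_cast
    rw [zero_mul, add_zero, ← ofReal_log hα.le]
    have : (y : ℂ) ≠ 0 := ofReal_ne_zero.2 hy.ne'
    field_simp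
    ring
  · push_cast
    have := I_mul_I
    linear_combination (-(1 / α : ℂ)) * this

lemma integrable_norm_Gamma_line : Integrable fun t : ℝ => ‖Gamma (2 + t * I)‖ := by
  have := (integrable_Gamma_mul_cpow (ρ := 1) (by simp)).norm
  simpa using this

namespace IsExtendedSelberg

variable {a : ℕ → ℂ} {F : ℂ → ℂ} {D : SelbergData}

/-- The part of the Mellin integral with `Im s` bounded below stays bounded as `z` approaches the
positive real axis. -/
lemma exists_norm_integral_upper_le (hF : IsExtendedSelberg a F D) (T : ℝ) (hT : 0 < T) {α : ℝ}
    (hα : 0 < α) : ∃ M : ℝ, ∀ y : ℝ, 0 < y →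
      ‖∫ t : ℝ in Ioi (-T), mellinIntegrand F (α + y * I) (2 + t * I)‖ ≤ M := by
  set A := ∑' n, ‖LSeries.term a 2 n‖
  have hπ := Real.pi_pos
  refine ⟨∫ t : ℝ in Ioi (-T), A * (‖Gamma (2 + t * I)‖ *
    ((2 * Real.pi * α) ^ (-2 : ℝ) * Real.exp (Real.pi / 2 * T))), fun y hy => ?_⟩
  have hz : 0 < (α + y * I : ℂ).im := by simpa using hy
  have hsc : 2 * Real.pi * α ≤ ‖scale (α + y * I)‖ := by
    rw [norm_scale]
    gcongr
    have := abs_re_le_norm (α + y * I : ℂ)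
    simp only [add_re, ofReal_re, mul_re, I_re, mul_zero, ofReal_im, I_im, mul_one, sub_self,
      add_zero] at this
    exact (le_abs_self α).trans this
  have hsc0 : scale (α + y * I) ≠ 0 := norm_pos_iff.1 (lt_of_lt_of_le (by positivity) hsc)
  have harg1 : arg (scale (α + y * I)) ≤ 0 := by
    rw [arg_scale hz]
    have : |arg (α + y * I : ℂ)| < Real.pi / 2 := abs_arg_lt_of_re_pos (by simpa using hα)
    linarith [le_abs_self (arg (α + y * I : ℂ))]
  have harg2 : -(Real.pi / 2) ≤ arg (scale (α + y * I)) := by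
    rw [arg_scale hz]
    have := arg_pos_of_im_pos hz
    linarith
  have hA : 0 ≤ A := tsum_nonneg fun n => norm_nonneg _
  refine norm_integral_le_of_norm_le ((integrable_norm_Gamma_line.mul_const _).const_mul A).integrableOn
    ((ae_restrict_mem measurableSet_Ioi).mono fun t ht => ?_)
  have ht' : -T < t := ht
  rw [mellinIntegrand, norm_mul, norm_mul, norm_cpow_neg_eq hsc0]
  simp only [add_re, re_ofNat, mul_re, ofReal_re, I_re, mul_zero, ofReal_im, I_im, mul_one,
    sub_self, add_zero, add_im, im_ofNat, mul_im, zero_add]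
  have h1 : ‖scale (α + y * I)‖ ^ (-2 : ℝ) ≤ (2 * Real.pi * α) ^ (-2 : ℝ) :=
    Real.rpow_le_rpow_of_nonpos (by positivity) hsc (by norm_num)
  have h2 : arg (scale (α + y * I)) * t ≤ Real.pi / 2 * T := by
    rcases le_total 0 t with h | h
    · have := mul_nonpos_of_nonpos_of_nonneg harg1 h
      have : 0 ≤ Real.pi / 2 * T := by positivity
      linarith
    · nlinarith
  have h3 := hF.norm_le_of_re_eq_two (s := 2 + t * I) (by simp)
  have h4 := Real.exp_le_exp.2 h2
  gcongr

/-- The integral over the horizontal segment stays bounded as `z` approaches the positive real axis.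
-/
lemma exists_norm_integral_horizontal_le (hF : IsExtendedSelberg a F D) (hd : D.degree = 1) :
    ∃ Y : ℝ, ∀ T, Y ≤ T → ∀ {α : ℝ}, 0 < α → ∃ M : ℝ, ∀ y : ℝ, 0 < y → y ≤ 1 →
      ‖∫ x in (-1 : ℝ)..2, mellinIntegrand F (α + y * I) (x - T * I)‖ ≤ M := by
  obtain ⟨C, Y, N, hC, hY, h⟩ := hF.exists_norm_mellinIntegrand_le hd
  have hπ := Real.pi_pos
  refine ⟨Y, fun T hT α hα => ⟨C * ((2 * Real.pi * α) ^ (-2 : ℝ) + 2 * Real.pi * (α + 1)) *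
    ((T + 5) ^ N * 1) * |2 - (-1 : ℝ)|, fun y hy hy1 => ?_⟩⟩
  have hz : 0 < (α + y * I : ℂ).im := by simpa using hy
  refine intervalIntegral.norm_integral_le_of_norm_le_const fun x hx => ?_
  rw [uIoc_of_le (by norm_num)] at hx
  have h1 := h (α + y * I) hz (x - T * I) (by simp; linarith [hx.1]) (by simpa using hx.2)
    (by simpa using hT)
  refine h1.trans ?_
  have e : -(x - T * I : ℂ).im = T := by simp
  have hn : α ≤ ‖(α + y * I : ℂ)‖ := by
    have := abs_re_le_norm (α + y * I : ℂ)
    simp only [add_re, ofReal_re, mul_re, I_re, mul_zero, ofReal_im, I_im, mul_one, sub_self,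
      add_zero] at this
    exact (le_abs_self α).trans this
  have hn2 : ‖(α + y * I : ℂ)‖ ≤ α + 1 := by
    refine (norm_add_le _ _).trans ?_
    simp [abs_of_pos hα, abs_of_pos hy, hy1]
  have hT0 : 0 < T := by linarith
  have h2 : (2 * Real.pi * ‖(α + y * I : ℂ)‖) ^ (-2 : ℝ) ≤ (2 * Real.pi * α) ^ (-2 : ℝ) :=
    Real.rpow_le_rpow_of_nonpos (by positivity) (by gcongr) (by norm_num)
  have h3 : Real.exp (-(arg (α + y * I : ℂ) * T)) ≤ 1 := by
    apply Real.exp_le_one_iff.2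
    have := arg_pos_of_im_pos hz
    have : 0 ≤ arg (α + y * I : ℂ) * T := by positivity
    linarith
  rw [e, norm_scale]
  gcongr

/-- The boundary behaviour of the exponential series at a positive real point `α`:
only the term with `n = qα` of the dual series contributes. -/
lemma tendsto_expSeries (hF : IsExtendedSelberg a F D) (hd : D.degree = 1) {α : ℝ} (hα : 0 < α) :
    Tendsto (fun y : ℝ => (y : ℂ) ^ (1 - I * D.theta) * (2 * Real.pi * expSeries a (α + y * I)))
      (𝓝[>] 0) (𝓝 (D.conductor * α * (D.oscConst * (Gamma (1 - I * D.theta) *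
        ∑' n : ℕ, if Real.log n = Real.log (D.conductor * α) then
          conjCoeff a n * ((1 / α : ℝ) : ℂ) ^ (-(1 - I * D.theta)) else 0)))) := by
  set θ := D.theta
  set q := D.conductor
  have hq : 0 < q := D.conductor_pos
  obtain ⟨T₁, hT₁, hleft⟩ := hF.mellinIntegrand_left
  obtain ⟨T₂, hT₂, hshift⟩ := hF.integral_shift hd
  obtain ⟨T₃, hhor⟩ := hF.exists_norm_integral_horizontal_le hd
  have hosc := D.tendsto_oscFactor hd
  obtain ⟨T₄, hT₄⟩ := eventually_atTop.1 (Metric.tendsto_nhds.1 hosc 1 one_pos)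
  set T := max (max T₁ T₂) (max T₃ T₄)
  have h1T : T₁ ≤ T := (le_max_left _ _).trans (le_max_left _ _)
  have h2T : T₂ ≤ T := (le_max_right _ _).trans (le_max_left _ _)
  have h3T : T₃ ≤ T := (le_max_left _ _).trans (le_max_right _ _)
  have h4T : T₄ ≤ T := (le_max_right _ _).trans (le_max_right _ _)
  have hT : 0 < T := hT₁.trans_le h1T
  obtain ⟨M₁, hM₁⟩ := hF.exists_norm_integral_upper_le T hT hα
  obtain ⟨M₂, hM₂⟩ := hhor T h3T hα
  set B := ∑' n, ‖conjCoeff a n‖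
  have hB : 0 ≤ B := tsum_nonneg fun n => norm_nonneg _
  have hpos : ∀ᶠ y : ℝ in 𝓝[>] (0 : ℝ), 0 < y := eventually_mem_nhdsWithin
  have hle1 : ∀ᶠ y : ℝ in 𝓝[>] (0 : ℝ), y ≤ 1 :=
    mem_nhdsWithin_of_mem_nhds (Iic_mem_nhds one_pos)
  set P : ℝ → ℂ := fun y => leftExponent q (α + y * I)
  have hPlim := tendsto_leftExponent hq hα
  have hPre : ∀ᶠ y : ℝ in 𝓝[>] (0 : ℝ), 1 / (2 * α) * y ≤ (P y).re := by
    have h1 := (continuous_re.tendsto _).comp hPlim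
    have h2 : 1 / (2 * α) < (((1 / α : ℝ) : ℂ)).re := by
      rw [ofReal_re]
      exact one_div_lt_one_div_of_lt hα (by linarith)
    filter_upwards [hpos, h1.eventually_const_le h2] with y hy hle
    have e : ((leftExponent q (α + y * I) + I * Real.log (q * α)) / y).re = (P y).re / y := by
      rw [div_ofReal_re]
      simp [P]
    simp only [Function.comp_apply, e] at hle
    rwa [le_div_iff₀ hy] at hle
  -- the oscillation factor cut off at `T`; it may be replaced by its limit, since the Laplace mean
  -- of the difference tends to zero
  set ind : ℝ → ℂ := fun t => if T < t then D.oscFactor t else 0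
  have hind : Tendsto (fun t => ‖D.oscConst - ind t‖ * B) atTop (𝓝 0) := by
    have h1 : Tendsto ind atTop (𝓝 D.oscConst) := by
      refine hosc.congr' ?_
      filter_upwards [eventually_gt_atTop T] with t ht
      simp [ind, ht]
    have := (tendsto_const_nhds (x := D.oscConst)).sub h1
    rw [sub_self] at this
    simpa using this.norm.mul_const B
  have hindM : ∀ t, ‖D.oscConst - ind t‖ * B ≤ (‖D.oscConst‖ + 1) * B := fun t => by
    gcongr
    by_cases ht : T < t
    · have := hT₄ t (h4T.trans ht.le)
      rw [dist_comm, dist_eq_norm] at this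
      simp only [ind, ht, if_true]
      linarith [norm_nonneg D.oscConst]
    · simp [ind, ht]
  set G : ℝ → ℝ → ℂ := fun y t => (t : ℂ) ^ (-(I * θ)) * conjSeries a t * exp (-(P y * t))
  have hGn : ∀ y t : ℝ, 0 < t → ‖G y t‖ ≤ B * Real.exp (-((P y).re * t)) := fun y t ht => by
    simp only [G]
    rw [norm_mul, norm_mul, norm_ofReal_cpow_neg_I_mul ht, one_mul, norm_exp]
    simp only [neg_re, mul_re, ofReal_re, ofReal_im, mul_zero, sub_zero]
    gcongr
    exact hF.norm_conjSeries_le t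
  have herr : Tendsto (fun y : ℝ => (y : ℂ) ^ (1 - I * θ) *
      ∫ t in Ioi (0 : ℝ), (D.oscConst - ind t) * G y t) (𝓝[>] 0) (𝓝 0) := by
    refine tendsto_cpow_mul_zero ?_
    refine tendsto_mul_integral_of_le (c := 1 / (2 * α)) (by positivity)
      (fun t _ => hindM t) hind ?_
    filter_upwards [hPre, hpos] with y hy hy0 t ht
    rw [norm_mul, mul_assoc]
    gcongr
    refine (hGn y t ht).trans ?_
    gcongr
  have hmain : Tendsto (fun y : ℝ => (y : ℂ) ^ (1 - I * θ) * ∫ t in Ioi (0 : ℝ), G y t) (𝓝[>] 0)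
      (𝓝 (Gamma (1 - I * θ) * ∑' n : ℕ, if Real.log n = Real.log (q * α) then
          conjCoeff a n * ((1 / α : ℝ) : ℂ) ^ (-(1 - I * θ)) else 0)) := by
    have h := (tendsto_abel_sum θ hF.summable_norm_conjCoeff (fun n => Real.log n)
      (Real.log (q * α)) (P := P) (c := 1 / (2 * α)) (by positivity) hPre
      (v := ((1 / α : ℝ) : ℂ)) (by rw [ofReal_re]; positivity) hPlim).const_mul
        (Gamma (1 - I * θ))
    refine h.congr' ?_
    filter_upwards [hPre, hpos] with y hy hy0
    have := integral_abel_sum θ hF.summable_norm_conjCoeff (fun n => Real.log n) (P := P y)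
      (lt_of_lt_of_le (by positivity) hy)
    simp only [G, conjSeries]
    rw [this]
    ring
  -- the parts of the contour at bounded height are killed by `y ^ (1 - iθ)`
  have hup : Tendsto (fun y : ℝ => (y : ℂ) ^ (1 - I * θ) *
      ∫ t : ℝ in Ioi (-T), mellinIntegrand F (α + y * I) (2 + t * I)) (𝓝[>] 0) (𝓝 0) :=
    tendsto_cpow_mul_zero_of_bounded (M := M₁) (hpos.mono hM₁)
  have hho : Tendsto (fun y : ℝ => (y : ℂ) ^ (1 - I * θ) *
      ∫ x in (-1 : ℝ)..2, mellinIntegrand F (α + y * I) (x - T * I)) (𝓝[>] 0) (𝓝 0) := by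
    refine tendsto_cpow_mul_zero_of_bounded (M := M₂) ?_
    filter_upwards [hpos, hle1] with y h1 h2 using hM₂ y h1 h2
  have hz0 : Tendsto (fun y : ℝ => (q * (α + y * I) : ℂ)) (𝓝[>] 0) (𝓝 (q * α)) := by
    have : Continuous fun y : ℝ => (q * (α + y * I) : ℂ) := by fun_prop
    have := (this.tendsto 0).mono_left (nhdsWithin_le_nhds (s := Ioi 0))
    simpa using this
  have key := (hup.add (hz0.mul ((hmain.const_mul D.oscConst).sub herr))).sub (hho.const_mul I)
  rw [zero_add, sub_zero, mul_zero, sub_zero] at key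
  refine key.congr' ?_
  filter_upwards [hPre, hpos] with y hy hy0
  -- assemble the contour: upper part on `Re s = 2`, horizontal segment, lower part on `Re s = -1`
  have hz : 0 < (α + y * I : ℂ).im := by simpa using hy0
  have hPy : 0 < (P y).re := lt_of_lt_of_le (by positivity) hy
  obtain ⟨hintl, hsh⟩ := hshift (α + y * I) hz T h2T
  have hint := hF.integrable_mellinIntegrand hz
  have hzq : (q * (α + y * I) : ℂ) ≠ 0 := by
    intro h
    have := congrArg im h
    simp at this
    rcases this with h | h
    · exact hq.ne' h
    · exact hy0.ne' h
  have hGint : IntegrableOn (G y) (Ioi 0) := by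
    have hexp : IntegrableOn (fun t : ℝ => B * Real.exp (-((P y).re * t))) (Ioi 0) := by
      have := (integrableOn_exp_mul_Ioi (neg_neg_of_pos hPy) 0).const_mul B
      simpa [neg_mul, IntegrableOn] using this
    refine Integrable.mono' hexp ?_ ((ae_restrict_mem measurableSet_Ioi).mono fun t ht =>
      hGn y t ht)
    refine ContinuousOn.aestronglyMeasurable (fun t ht => ?_) measurableSet_Ioi
    refine ContinuousAt.continuousWithinAt (ContinuousAt.mul (ContinuousAt.mul ?_ ?_) (by fun_prop))
    · exact continuousAt_ofReal_cpow_const t _ (Or.inr (ne_of_gt ht))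
    · exact hF.continuous_conjSeries.continuousAt
  have hl : EqOn (fun t : ℝ => mellinIntegrand F (α + y * I) (-1 - t * I))
      (fun t => q * (α + y * I) * (D.oscFactor t * G y t)) (Ioi T) := fun t ht =>
    hleft t (h1T.trans (le_of_lt ht)) _ hz
  have hoG : IntegrableOn (fun t => D.oscFactor t * G y t) (Ioi T) := by
    have := (hintl.congr_fun hl measurableSet_Ioi).const_mul (q * (α + y * I) : ℂ)⁻¹
    refine Integrable.congr this (Eventually.of_forall fun t => ?_)
    simp only
    rw [← mul_assoc, inv_mul_cancel₀ hzq, one_mul]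
  have e0 : (fun t => ind t * G y t) = (Ioi T).indicator fun t => D.oscFactor t * G y t := by
    ext t
    by_cases ht : T < t <;> simp [ind, ht, indicator]
  have hindint : IntegrableOn (fun t => ind t * G y t) (Ioi 0) := by
    rw [e0]
    exact (hoG.integrable_indicator measurableSet_Ioi).integrableOn
  have e1 : ∫ t in Ioi (0 : ℝ), ind t * G y t = ∫ t in Ioi T, D.oscFactor t * G y t := by
    rw [e0, setIntegral_indicator measurableSet_Ioi]
    congr 2
    ext t
    simp only [mem_inter_iff, mem_Ioi]
    exact ⟨fun h => h.2, fun h => ⟨hT.trans h, h⟩⟩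
  have e2 : ∫ t in Ioi (0 : ℝ), (D.oscConst - ind t) * G y t =
      D.oscConst * (∫ t in Ioi (0 : ℝ), G y t) - ∫ t in Ioi T, D.oscFactor t * G y t := by
    rw [← e1, ← integral_const_mul, ← integral_sub (hGint.const_mul _) hindint]
    refine integral_congr_ae (Eventually.of_forall fun t => ?_)
    simp only
    ring
  have e3 : ∫ t : ℝ in Ioi T, mellinIntegrand F (α + y * I) (-1 - t * I) =
      q * (α + y * I) * ∫ t in Ioi T, D.oscFactor t * G y t := by
    rw [setIntegral_congr_fun measurableSet_Ioi hl, integral_const_mul]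
  have e4 : ∫ t : ℝ in Iic (-T), mellinIntegrand F (α + y * I) (2 + t * I) =
      ∫ t : ℝ in Ioi T, mellinIntegrand F (α + y * I) (2 - t * I) := by
    rw [← integral_comp_neg_Ioi]
    refine setIntegral_congr_fun measurableSet_Ioi fun t _ => ?_
    simp [sub_eq_add_neg]
  have e5 := intervalIntegral.integral_Iic_add_Ioi (b := -T) hint.integrableOn hint.integrableOn
  rw [e4, hsh, e3] at e5
  have e6 := hF.integral_eq_expSeries hz
  have e7 : ∫ t : ℝ, mellinIntegrand F (α + y * I) (2 + t * I) =
      2 * Real.pi * expSeries a (α + y * I) := e6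
  rw [← e7, ← e5, e2]
  ring

end IsExtendedSelberg

/-! ### Integrality of the conductor and periodicity of the twisted coefficients -/

/-- The coefficients `ã(n) = a(n) n ^ (iθ)`. -/
def twistedCoeff (a : ℕ → ℂ) (θ : ℝ) (n : ℕ) : ℂ := a n * (n : ℂ) ^ (I * (θ : ℂ))

/-- The constant in the boundary behaviour of the exponential series. -/
def SelbergData.boundaryConst (D : SelbergData) : ℂ :=
  D.oscConst * Gamma (1 - I * D.theta) * (D.conductor : ℂ) ^ (-(1 - I * D.theta))

lemma SelbergData.boundaryConst_ne_zero (D : SelbergData) : D.boundaryConst ≠ 0 := by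
  rw [boundaryConst, ofReal_cpow_eq_exp D.conductor_pos]
  exact mul_ne_zero (mul_ne_zero D.oscConst_ne_zero (Gamma_ne_zero_of_re_pos (by simp)))
    (exp_ne_zero _)

lemma log_natCast_eq_iff {n : ℕ} (hn : n ≠ 0) {x : ℝ} (hx : 0 < x) :
    Real.log n = Real.log x ↔ (n : ℝ) = x :=
  ⟨fun h => Real.log_injOn_pos (mem_Ioi.2 (Nat.cast_pos.2 (Nat.pos_of_ne_zero hn))) hx h, fun h => by rw [h]⟩

namespace IsExtendedSelberg

variable {a : ℕ → ℂ} {F : ℂ → ℂ} {D : SelbergData}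

/-- If `qα = m` is a positive integer, the leading coefficient of the exponential series at `α` is a
nonzero constant times the conjugate of `a(m) m ^ (iθ)`. -/
lemma tendsto_expSeries_of_eq (hF : IsExtendedSelberg a F D) (hd : D.degree = 1) {α : ℝ} {m : ℕ}
    (hm : m ≠ 0) (hα : D.conductor * α = m) :
    Tendsto (fun y : ℝ => (y : ℂ) ^ (1 - I * D.theta) * (2 * Real.pi * expSeries a (α + y * I)))
      (𝓝[>] 0) (𝓝 (D.boundaryConst * starRingEnd ℂ (twistedCoeff a D.theta m))) := by
  have hq := D.conductor_pos
  have hm' : (0 : ℝ) < m := Nat.cast_pos.2 (Nat.pos_of_ne_zero hm)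
  have hα0 : 0 < α := pos_of_mul_pos_right (hα ▸ hm') hq.le
  refine tendsto_of_tendsto_of_eq (hF.tendsto_expSeries hd hα0) ?_
  have hαm : 1 / α = D.conductor / m := by
    rw [← hα]
    field_simp
  rw [tsum_eq_single m fun n hn => ?_]
  · rw [if_pos (by rw [hα]), hαm, ← ofReal_mul, hα, SelbergData.boundaryConst, conjCoeff,
      twistedCoeff, LSeries.term_of_ne_zero hm, ← ofReal_natCast,
      ofReal_cpow_eq_exp hq, ofReal_cpow_eq_exp hm',
      ofReal_cpow_eq_exp hm', ofReal_cpow_eq_exp (by positivity),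
      map_div₀, map_mul, ← exp_conj, ← exp_conj, Real.log_div hq.ne' hm'.ne']
    have e1 : ((m : ℝ) : ℂ) = exp (Real.log m) := by rw [← ofReal_exp, Real.exp_log hm']
    have e2 : ((m : ℝ) : ℂ) * (exp ((Real.log D.conductor - Real.log m : ℝ) * -(1 - I * D.theta)) /
        exp (starRingEnd ℂ (Real.log m * 2))) =
        exp (Real.log D.conductor * -(1 - I * D.theta)) *
          exp (starRingEnd ℂ (Real.log m * (I * D.theta))) := by
      nth_rw 1 [e1]
      rw [← exp_sub, ← exp_add, ← exp_add]
      congr 1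
      simp only [map_mul, conj_ofReal, conj_I, Complex.conj_ofNat]
      push_cast
      ring
    linear_combination (D.oscConst * Gamma (1 - I * D.theta) * starRingEnd ℂ (a m)) * e2
  -- for `n = 0` the junk value `Real.log 0 = 0` is harmless, as `conjCoeff a 0 = 0`
  · rw [hα]
    rcases eq_or_ne n 0 with rfl | hn0
    · simp [conjCoeff]
    · rw [if_neg]
      rw [log_natCast_eq_iff hn0 hm']
      exact_mod_cast hn

/-- If `qα` is not an integer, the exponential series has no leading term at `α`. -/
lemma tendsto_expSeries_of_ne (hF : IsExtendedSelberg a F D) (hd : D.degree = 1) {α : ℝ}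
    (hα0 : 0 < α) (hα : ∀ m : ℕ, D.conductor * α ≠ m) :
    Tendsto (fun y : ℝ => (y : ℂ) ^ (1 - I * D.theta) * (2 * Real.pi * expSeries a (α + y * I)))
      (𝓝[>] 0) (𝓝 0) := by
  have hq := D.conductor_pos
  refine tendsto_of_tendsto_of_eq (hF.tendsto_expSeries hd hα0) ?_
  have : ∀ n : ℕ, (if Real.log n = Real.log (D.conductor * α) then
      conjCoeff a n * ((1 / α : ℝ) : ℂ) ^ (-(1 - I * D.theta)) else 0) = 0 := fun n => by
    rcases eq_or_ne n 0 with rfl | hn0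
    · simp [conjCoeff]
    · rw [if_neg]
      rw [log_natCast_eq_iff hn0 (mul_pos hq hα0)]
      exact (hα n).symm
  rw [tsum_congr this, tsum_zero]
  simp

lemma exists_coeff_ne_zero (hF : IsExtendedSelberg a F D) : ∃ m : ℕ, m ≠ 0 ∧ a m ≠ 0 := by
  by_contra! h
  obtain ⟨s, hs, hs0⟩ := hF.ne_zero
  refine hs0 ?_
  rw [hF.eq_LSeries s hs, LSeries]
  refine (tsum_congr fun n => ?_).trans tsum_zero
  rcases eq_or_ne n 0 with rfl | hn
  · simp
  · simp [LSeries.term_of_ne_zero hn, h n hn]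

lemma twistedCoeff_ne_zero {m : ℕ} (hm : m ≠ 0) (ha : a m ≠ 0) (θ : ℝ) :
    twistedCoeff a θ m ≠ 0 := by
  refine mul_ne_zero ha ?_
  simp [cpow_eq_zero_iff, hm]

/-- Invariance of the exponential series under `z ↦ z + 1`, read on the boundary. -/
lemma tendsto_expSeries_add_one {θ α : ℝ} {c : ℂ}
    (h : Tendsto (fun y : ℝ => (y : ℂ) ^ (1 - I * θ) * (2 * Real.pi * expSeries a (α + y * I)))
      (𝓝[>] 0) (𝓝 c)) :
    Tendsto (fun y : ℝ => (y : ℂ) ^ (1 - I * θ) *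
      (2 * Real.pi * expSeries a ((α + 1 : ℝ) + y * I))) (𝓝[>] 0) (𝓝 c) := by
  refine h.congr fun y => ?_
  rw [← expSeries_add_one]
  push_cast
  ring_nf

/-- The conductor is a positive integer: if `a(m) ≠ 0`, the exponential series has a leading term at
`m/q`, hence at `m/q + 1`, so that `q (m/q + 1) = m + q` is an integer. -/
theorem exists_natCast_eq_conductor (hF : IsExtendedSelberg a F D) (hd : D.degree = 1) :
    ∃ q : ℕ, 0 < q ∧ (q : ℝ) = D.conductor := by
  have hq := D.conductor_pos
  obtain ⟨m, hm, ha⟩ := hF.exists_coeff_ne_zero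
  have hm' : (0 : ℝ) < m := Nat.cast_pos.2 (Nat.pos_of_ne_zero hm)
  have h1 := hF.tendsto_expSeries_of_eq hd (α := m / D.conductor) hm (by field_simp)
  by_cases h : ∃ k : ℕ, D.conductor * (m / D.conductor + 1) = k
  · obtain ⟨k, hk⟩ := h
    have hk' : (m : ℝ) + D.conductor = k := by
      rw [← hk]
      field_simp
    have hlt : m < k := by
      have : (m : ℝ) < k := by linarith
      exact_mod_cast this
    refine ⟨k - m, Nat.sub_pos_of_lt hlt, ?_⟩
    rw [Nat.cast_sub hlt.le]
    linarith
  · push Not at h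
    have h2 := hF.tendsto_expSeries_of_ne hd (by positivity) h
    have := tendsto_nhds_unique (tendsto_expSeries_add_one h1) h2
    simp [D.boundaryConst_ne_zero, twistedCoeff_ne_zero hm ha] at this

/-- Periodicity of the twisted coefficients: compare the leading terms of the exponential series at
`n/q` and `n/q + 1`. -/
theorem twistedCoeff_add_conductor (hF : IsExtendedSelberg a F D) (hd : D.degree = 1) {q : ℕ}
    (hq : (q : ℝ) = D.conductor) {n : ℕ} (hn : n ≠ 0) :
    twistedCoeff a D.theta (n + q) = twistedCoeff a D.theta n := by
  have hq0 := D.conductor_pos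
  have h1 := hF.tendsto_expSeries_of_eq hd (α := n / D.conductor) hn (by field_simp)
  have h2 := hF.tendsto_expSeries_of_eq hd (α := n / D.conductor + 1) (m := n + q) (by omega) (by
    push_cast
    rw [hq]
    field_simp)
  have := tendsto_nhds_unique h2 (tendsto_expSeries_add_one h1)
  have := mul_left_cancel₀ D.boundaryConst_ne_zero this
  exact star_injective this

end IsExtendedSelberg

open ZMod

/-! ### The Dirichlet series as the L-function of a periodic function -/

lemma conj_LFunction_conj {q : ℕ} [NeZero q] (Φ : ZMod q → ℂ) {s : ℂ} (hs : 1 < s.re) :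
    starRingEnd ℂ (LFunction Φ (starRingEnd ℂ s)) =
      LFunction (fun x => starRingEnd ℂ (Φ x)) s := by
  rw [LFunction_eq_LSeries _ (by simpa using hs), LFunction_eq_LSeries _ hs, LSeries, LSeries,
    conj_tsum]
  refine tsum_congr fun n => ?_
  rcases eq_or_ne n 0 with rfl | hn
  · simp
  · have hn' : (0 : ℝ) < n := Nat.cast_pos.2 (Nat.pos_of_ne_zero hn)
    rw [LSeries.term_of_ne_zero hn, LSeries.term_of_ne_zero hn, ← ofReal_natCast,
      ofReal_cpow_eq_exp hn', ofReal_cpow_eq_exp hn', map_div₀, ← exp_conj,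
      map_mul, conj_ofReal, conj_conj]

lemma norm_LFunction_le {q : ℕ} [NeZero q] (Φ : ZMod q → ℂ) {s : ℂ} (hs : s.re = 2) :
    ‖LFunction Φ s‖ ≤ ∑' n, ‖LSeries.term (fun n : ℕ => Φ n) 2 n‖ := by
  have h : ∀ n, ‖LSeries.term (fun n : ℕ => Φ n) s n‖ = ‖LSeries.term (fun n : ℕ => Φ n) 2 n‖ :=
    fun n => norm_term_of_re_eq _ (by simpa using hs) n
  rw [LFunction_eq_LSeries _ (by linarith), LSeries]
  refine (norm_tsum_le_tsum_norm ?_).trans_eq (tsum_congr h)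
  have := (LSeriesSummable_of_one_lt_re Φ (s := s) (by linarith)).norm
  exact this

/-- A periodic function is determined by the asymptotic behaviour of its L-function along a vertical
half-line in the domain of absolute convergence. -/
lemma eq_zero_of_tendsto_LFunction {q : ℕ} [NeZero q] {Ψ : ZMod q → ℂ} {κ : ℝ} (hκ : κ ≠ 0)
    {w₀ : ℂ} (hw₀ : w₀.re = 2)
    (h : Tendsto (fun t : ℝ => LFunction Ψ (w₀ - κ * t * I)) atTop (𝓝 0)) (x : ZMod q) :
    Ψ x = 0 := by
  have hb := (LSeriesSummable_of_one_lt_re Ψ (s := w₀) (by linarith)).norm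
  set m := x.val + q
  have hm : m ≠ 0 := by
    have := NeZero.pos q
    omega
  have key := tsum_ite_eq_zero_of_tendsto_zero hb (fun n => -(κ * Real.log n)) (h.congr fun t => by
    rw [LFunction_eq_LSeries _ (by simp [hw₀]), LSeries]
    refine tsum_congr fun n => ?_
    rcases eq_or_ne n 0 with rfl | hn
    · simp
    · have hn' : (0 : ℝ) < n := Nat.cast_pos.2 (Nat.pos_of_ne_zero hn)
      rw [LSeries.term_of_ne_zero hn, LSeries.term_of_ne_zero hn, ← ofReal_natCast,
        ofReal_cpow_eq_exp hn', ofReal_cpow_eq_exp hn', div_eq_mul_inv,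
        div_eq_mul_inv, ← exp_neg, ← exp_neg, mul_assoc (Ψ _), ← exp_add]
      congr 2
      push_cast
      ring) (-(κ * Real.log m))
  rw [tsum_eq_single m fun n hn => ?_, if_pos rfl, LSeries.term_of_ne_zero hm] at key
  · have hx : ((m : ℕ) : ZMod q) = x := by simp [m]
    rw [hx, div_eq_zero_iff] at key
    refine key.resolve_right ?_
    simp only [cpow_eq_zero_iff, Nat.cast_eq_zero, hm, false_and, not_false_eq_true]
  · rcases eq_or_ne n 0 with rfl | hn0
    · simp
    · rw [if_neg]
      intro h
      have := mul_left_cancel₀ hκ (neg_injective h)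
      rw [log_natCast_eq_iff hn0 (Nat.cast_pos.2 (Nat.pos_of_ne_zero hm))] at this
      exact hn (by exact_mod_cast this)

/-- The twisted coefficients as a function on `ℤ/qℤ`. The shift by `q` avoids the coefficient of
index `0`, which carries no information. -/
def periodicCoeff (a : ℕ → ℂ) (θ : ℝ) (q : ℕ) (x : ZMod q) : ℂ := twistedCoeff a θ (x.val + q)

namespace IsExtendedSelberg

variable {a : ℕ → ℂ} {F : ℂ → ℂ} {D : SelbergData} {q : ℕ} [NeZero q]

lemma periodicCoeff_natCast (hF : IsExtendedSelberg a F D) (hd : D.degree = 1)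
    (hq : (q : ℝ) = D.conductor) {n : ℕ} (hn : n ≠ 0) :
    periodicCoeff a D.theta q n = twistedCoeff a D.theta n := by
  have hstep : ∀ m : ℕ, m ≠ 0 → ∀ k : ℕ,
      twistedCoeff a D.theta (m + q * k) = twistedCoeff a D.theta m := fun m hm k => by
    induction k with
    | zero => simp
    | succ k ih =>
      rw [mul_add, mul_one, ← add_assoc, hF.twistedCoeff_add_conductor hd hq (by omega), ih]
  have hq0 := NeZero.pos q
  rw [periodicCoeff, ZMod.val_natCast, ← hstep _ (by omega) (n / q),
    ← hF.twistedCoeff_add_conductor hd hq hn]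
  congr 1
  have := Nat.mod_add_div n q
  omega

lemma periodicCoeff_ne_zero (hF : IsExtendedSelberg a F D) (hd : D.degree = 1)
    (hq : (q : ℝ) = D.conductor) : ∃ x, periodicCoeff a D.theta q x ≠ 0 := by
  obtain ⟨m, hm, ha⟩ := hF.exists_coeff_ne_zero
  refine ⟨m, ?_⟩
  rw [hF.periodicCoeff_natCast hd hq hm]
  exact twistedCoeff_ne_zero hm ha _

lemma eq_LFunction_of_one_lt_re (hF : IsExtendedSelberg a F D) (hd : D.degree = 1)
    (hq : (q : ℝ) = D.conductor) {s : ℂ} (hs : 1 < s.re) :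
    F s = LFunction (periodicCoeff a D.theta q) (s + I * D.theta) := by
  rw [hF.eq_LSeries s hs, LFunction_eq_LSeries _ (by simpa using hs), LSeries, LSeries]
  refine tsum_congr fun n => ?_
  rcases eq_or_ne n 0 with rfl | hn
  · simp
  · have hn' : (n : ℂ) ≠ 0 := Nat.cast_ne_zero.2 hn
    rw [LSeries.term_of_ne_zero hn, LSeries.term_of_ne_zero hn, hF.periodicCoeff_natCast hd hq hn,
      twistedCoeff, cpow_add _ _ hn']
    have : (n : ℂ) ^ (I * (D.theta : ℂ)) ≠ 0 := by simp [cpow_eq_zero_iff, hn]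
    rw [mul_div_mul_right _ _ this]

/-- By analytic continuation, `F(s)` is the L-function of a periodic function at `s + iθ`, away from
the possible poles of both sides. -/
lemma eq_LFunction (hF : IsExtendedSelberg a F D) (hd : D.degree = 1)
    (hq : (q : ℝ) = D.conductor) {s : ℂ} (hs1 : s ≠ 1) (hs2 : s ≠ 1 - I * D.theta) :
    F s = LFunction (periodicCoeff a D.theta q) (s + I * D.theta) := by
  set U : Set ℂ := {1, 1 - I * (D.theta : ℂ)}ᶜ
  have hcount : ({1, 1 - I * (D.theta : ℂ)} : Set ℂ).Countable := (finite_singleton _).insert _ |>.countable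
  have hUo : IsOpen U := ((finite_singleton _).insert _).isClosed.isOpen_compl
  have hUc : IsPreconnected U :=
    (hcount.isConnected_compl_of_one_lt_rank (by simp)).isPreconnected
  have h1 : AnalyticOnNhd ℂ F U := DifferentiableOn.analyticOnNhd (fun s hs =>
    (hF.differentiableAt fun h => hs (by simp [h])).differentiableWithinAt) hUo
  have h2 : AnalyticOnNhd ℂ
      (fun s => LFunction (periodicCoeff a D.theta q) (s + I * D.theta)) U := by
    refine DifferentiableOn.analyticOnNhd (fun s hs => ?_) hUo
    refine DifferentiableAt.differentiableWithinAt ?_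
    refine DifferentiableAt.comp s (differentiableAt_LFunction _ _ (Or.inl fun h => hs ?_))
      (by fun_prop)
    right
    rw [← h]
    simp
  have h2U : (2 : ℂ) ∈ U := by
    simp only [U, mem_compl_iff, mem_insert_iff, mem_singleton_iff, not_or]
    constructor <;> intro h <;> have := congrArg re h <;> norm_num at this
  refine h1.eqOn_of_preconnected_of_eventuallyEq h2 hUc h2U ?_ (by simp [U, hs1, hs2])
  have hV : {z : ℂ | 1 < z.re} ∈ 𝓝 (2 : ℂ) :=
    (continuous_re.isOpen_preimage _ isOpen_Ioi).mem_nhds (by simp)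
  filter_upwards [hV] with z hz using hF.eq_LFunction_of_one_lt_re hd hq hz

/-- Comparison of the functional equation of `F` with that of the periodic L-function, in the region
where both are known to hold. -/
lemma funRatio_mul_LFunction (hF : IsExtendedSelberg a F D) (hd : D.degree = 1)
    (hq : (q : ℝ) = D.conductor) :
    ∃ T : ℝ, 0 < T ∧ ∀ s : ℂ, 1 < s.re → T ≤ |s.im| →
      D.funRatio s * LFunction (fun x => starRingEnd ℂ (periodicCoeff a D.theta q x))
        (s - I * D.theta) =
      D.dirichletTerm 1 (s - I * D.theta) *
          LFunction (𝓕 (periodicCoeff a D.theta q)) (s - I * D.theta) +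
        D.dirichletTerm (-1) (s - I * D.theta) *
          LFunction (𝓕 fun x => periodicCoeff a D.theta q (-x)) (s - I * D.theta) := by
  obtain ⟨T, hT, hreg⟩ := D.exists_gammaRegularAt
  refine ⟨T + |D.theta| + 1, by positivity, fun s hs him => ?_⟩
  have hθ0 := abs_nonneg D.theta
  have hθ := le_abs_self D.theta
  have hθ' := neg_abs_le D.theta
  have him0 : s.im ≠ 0 := fun h => by
    rw [h, abs_zero] at him
    linarith
  have himθ : s.im ≠ D.theta := fun h => by
    rw [h] at him
    linarith
  have hw : 1 < (s - I * D.theta).re := by simpa using hs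
  have hFE := hF.one_sub_eq (s := s) (fun h => him0 (by simp [h])) (fun h => him0 (by simp [h]))
    (hreg _ (by simp; linarith)) (hreg _ (by simp; linarith))
  have e1 : F (1 - s) = LFunction (periodicCoeff a D.theta q) (1 - (s - I * D.theta)) := by
    rw [hF.eq_LFunction hd hq]
    · congr 1
      ring
    · intro h
      have := congrArg im h
      simp at this
      exact him0 this
    · intro h
      have := congrArg im h
      simp at this
      exact himθ this
  have e2 : starRingEnd ℂ (F (starRingEnd ℂ s)) =
      LFunction (fun x => starRingEnd ℂ (periodicCoeff a D.theta q x)) (s - I * D.theta) := by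
    rw [hF.eq_LFunction_of_one_lt_re hd hq (by simpa using hs), ← conj_LFunction_conj _ hw]
    simp
  rw [e2, e1, LFunction_one_sub] at hFE
  · rw [← hFE, SelbergData.dirichletTerm, SelbergData.dirichletTerm, ← hq]
    push_cast
    ring_nf
  · intro n h
    have := congrArg re h
    rw [neg_re, natCast_re] at this
    have : (0 : ℝ) ≤ n := Nat.cast_nonneg n
    linarith
  · right
    intro h
    rw [h, one_re] at hw
    exact lt_irrefl _ hw

/-- The discrete Fourier transform of the periodic coefficients is a multiple of their complex
conjugate. On the half-line `Re s = 2`, `κ Im s < 0`, the term with `-κ` in the functional equation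
of the periodic L-function is exponentially smaller than the one with `κ`, while `funRatio` is
asymptotic to a multiple of `dirichletTerm`; the remaining relation between absolutely convergent
series holds coefficientwise. -/
lemma dft_eq (hF : IsExtendedSelberg a F D) (hd : D.degree = 1) (hq : (q : ℝ) = D.conductor) :
    ∀ κ : ℝ, κ = 1 ∨ κ = -1 → ∀ x : ZMod q,
      (if κ = 1 then 𝓕 (periodicCoeff a D.theta q) x
        else 𝓕 (fun x => periodicCoeff a D.theta q (-x)) x) =
      D.limitConst κ * starRingEnd ℂ (periodicCoeff a D.theta q x) := by
  obtain ⟨T, hT, h⟩ := hF.funRatio_mul_LFunction hd hq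
  set Φ := periodicCoeff a D.theta q
  set w : ℝ → ℝ → ℂ := fun κ t => SelbergData.halfLine κ t - I * D.theta
  set A : ℝ → ZMod q → ℂ := fun κ x => if κ = 1 then 𝓕 Φ x else 𝓕 (fun x => Φ (-x)) x
  set cΦ : ZMod q → ℂ := fun x => starRingEnd ℂ (Φ x)
  intro κ hκ x
  have hne : (-1 : ℝ) ≠ 1 := by norm_num
  have hwre : ∀ κ t, (w κ t).re = 2 := fun κ t => by simp [w]
  have h1 : ∀ᶠ t in atTop, D.funRatio (SelbergData.halfLine κ t) / D.dirichletTerm κ (w κ t) *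
      LFunction cΦ (w κ t) = LFunction (A κ) (w κ t) +
        exp (-(κ * Real.pi * I * w κ t)) * LFunction (A (-κ)) (w κ t) := by
    filter_upwards [eventually_ge_atTop T] with t ht
    have := h (SelbergData.halfLine κ t) (by simp) (by
      have : |κ| = 1 := by rcases hκ with rfl | rfl <;> simp
      rw [SelbergData.halfLine_im, abs_neg, abs_mul, this, one_mul]
      exact ht.trans (le_abs_self t))
    have hne0 := D.dirichletTerm_ne_zero κ (w := w κ t) (by rw [hwre]; norm_num)
    have hsw : D.dirichletTerm (-κ) (w κ t) =
        D.dirichletTerm κ (w κ t) * exp (-(κ * Real.pi * I * w κ t)) := by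
      rw [SelbergData.dirichletTerm, SelbergData.dirichletTerm, mul_assoc _ (exp _), ← exp_add]
      congr 2
      push_cast
      ring
    rw [div_mul_eq_mul_div, div_eq_iff hne0]
    refine this.trans ?_
    rcases hκ with rfl | rfl
    · simp only [A, if_true, if_neg hne]
      rw [hsw]
      ring
    · simp only [A, neg_neg, if_true, if_neg hne]
      rw [neg_neg] at hsw
      rw [show (SelbergData.halfLine (-1) t - I * D.theta : ℂ) = w (-1) t from rfl, hsw]
      ring
  have hexp : Tendsto (fun t => exp (-(κ * Real.pi * I * w κ t)) * LFunction (A (-κ)) (w κ t))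
      atTop (𝓝 0) := by
    obtain ⟨M, hM⟩ : ∃ M : ℝ, ∀ t, ‖LFunction (A (-κ)) (w κ t)‖ ≤ M :=
      ⟨_, fun t => norm_LFunction_le _ (hwre κ t)⟩
    have h3 : Tendsto (fun t : ℝ => Real.exp (-(Real.pi * t)) * (Real.exp (-(κ * Real.pi * D.theta)) * M))
        atTop (𝓝 0) := by
      have := (Real.tendsto_exp_neg_atTop_nhds_zero.comp
        (tendsto_id.const_mul_atTop Real.pi_pos)).mul_const (Real.exp (-(κ * Real.pi * D.theta)) * M)
      rw [zero_mul] at this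
      exact this
    refine squeeze_zero_norm (fun t => ?_) h3
    rw [norm_mul, norm_exp, ← mul_assoc, ← Real.exp_add]
    have e : (-(κ * Real.pi * I * w κ t)).re = -(Real.pi * t) + -(κ * Real.pi * D.theta) := by
      rcases hκ with rfl | rfl
      · simp [w]
        ring
      · simp [w]
        ring
    rw [e]
    gcongr
    exact hM t
  have hratio := D.tendsto_funRatio_div_dirichletTerm hd hκ
  have hbd : Tendsto (fun t => (D.funRatio (SelbergData.halfLine κ t) /
      D.dirichletTerm κ (w κ t) - D.limitConst κ) * LFunction cΦ (w κ t)) atTop (𝓝 0) := by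
    obtain ⟨M, hM⟩ : ∃ M : ℝ, ∀ t, ‖LFunction cΦ (w κ t)‖ ≤ M :=
      ⟨_, fun t => norm_LFunction_le _ (hwre κ t)⟩
    have h4 := (hratio.sub_const (D.limitConst κ)).norm.mul_const M
    rw [sub_self, norm_zero, zero_mul] at h4
    refine squeeze_zero_norm (fun t => ?_) h4
    rw [norm_mul]
    gcongr
    exact hM t
  have hlim := hbd.sub hexp
  rw [sub_zero] at hlim
  have hL : ∀ s, LFunction (fun x => A κ x - D.limitConst κ * cΦ x) s =
      LFunction (A κ) s - D.limitConst κ * LFunction cΦ s := fun s => by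
    simp only [LFunction, sub_mul, Finset.sum_sub_distrib, Finset.mul_sum, mul_sub]
    congr 1
    refine Finset.sum_congr rfl fun j _ => by ring
  have hfin := eq_zero_of_tendsto_LFunction (Ψ := fun x => A κ x - D.limitConst κ * cΦ x) (κ := κ)
    (by rcases hκ with rfl | rfl <;> norm_num) (w₀ := 2 - I * D.theta) (by simp) (hlim.congr' (by
      filter_upwards [h1] with t ht
      rw [hL]
      have e : (2 - I * D.theta - κ * t * I : ℂ) = w κ t := by
        simp only [w, SelbergData.halfLine]
        ring
      rw [e, sub_mul, ht]
      ring)) x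
  exact sub_eq_zero.1 hfin

end IsExtendedSelberg

/-! ### Parity and the exact shape of the functional equation -/

namespace SelbergData

lemma differentiableAt_funRatio (D : SelbergData) {s : ℂ} (hs : 0 < s.re) :
    DifferentiableAt ℂ D.funRatio s := by
  have h1 : DifferentiableAt ℂ
      (fun s : ℂ => ∏ j, Gamma (D.lam j * s + starRingEnd ℂ (D.mu j))) s := by
    refine DifferentiableAt.fun_finsetProd fun j _ => ?_
    refine DifferentiableAt.comp (g := Gamma) s (differentiableAt_Gamma _ fun m h => ?_)
      (by fun_prop)
    have := congrArg re h
    simp at this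
    have h1 := mul_pos (D.lam_pos j) hs
    have h2 := D.mu_re_nonneg j
    have : (0 : ℝ) ≤ m := Nat.cast_nonneg m
    linarith
  have h2 : DifferentiableAt ℂ (fun s : ℂ => ∏ j, (Gamma (D.lam j * (1 - s) + D.mu j))⁻¹) s := by
    refine DifferentiableAt.fun_finsetProd fun j _ => ?_
    exact DifferentiableAt.comp (g := fun z => (Gamma z)⁻¹) s (differentiable_one_div_Gamma _)
      (by fun_prop)
  have h3 : DifferentiableAt ℂ (fun s : ℂ => (D.Q : ℂ) ^ (2 * s - 1)) s :=
    DifferentiableAt.const_cpow (by fun_prop) (Or.inl D.Q_ne_zero)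
  have h4 := ((h3.const_mul D.omega).mul h1).mul h2
  refine h4.congr_of_eventuallyEq (Eventually.of_forall fun z => ?_)
  simp [funRatio, div_eq_mul_inv]

lemma differentiableAt_dirichletTerm (D : SelbergData) (κ : ℝ) {w : ℂ} (hw : 0 < w.re) :
    DifferentiableAt ℂ (D.dirichletTerm κ) w := by
  have hπ : ((2 * Real.pi : ℝ) : ℂ) ≠ 0 := by simp [Real.pi_ne_zero]
  have hq : (D.conductor : ℂ) ≠ 0 := ofReal_ne_zero.2 D.conductor_pos.ne'
  refine ((DifferentiableAt.mul ?_ ?_).mul (differentiableAt_Gamma _ fun m h => ?_)).mul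
    (by fun_prop)
  · exact DifferentiableAt.const_cpow (by fun_prop) (Or.inl hq)
  · exact DifferentiableAt.const_cpow (by fun_prop) (Or.inl hπ)
  · have := congrArg re h
    simp at this
    have : (0 : ℝ) ≤ m := Nat.cast_nonneg m
    linarith

/-- The sum of the two terms for coefficients of parity `𝔞`, as a quotient of Archimedean L-factors.
This is the reflection formula together with the duplication formula. -/
lemma dirichletTerm_add (D : SelbergData) {w : ℂ} (hw : 0 < w.re) {𝔞 : ℕ} (h𝔞 : 𝔞 = 0 ∨ 𝔞 = 1) :
    D.dirichletTerm 1 w + (-1) ^ 𝔞 * D.dirichletTerm (-1) w =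
      I ^ 𝔞 * (D.conductor : ℂ) ^ (w - 1) * (Gammaℝ (w + 𝔞) / Gammaℝ (1 - w + 𝔞)) := by
  have hreg : ∀ n : ℕ, w ≠ -n := fun n h => by
    have := congrArg re h
    simp at this
    have : (0 : ℝ) ≤ n := Nat.cast_nonneg n
    linarith
  have e1 : ((1 : ℝ) * Real.pi * I * w / 2 : ℂ) = Real.pi * w / 2 * I := by
    push_cast
    ring
  have e2 : ((-1 : ℝ) * Real.pi * I * w / 2 : ℂ) = -(Real.pi * w / 2) * I := by
    push_cast
    ring
  have e3 : ((2 * Real.pi : ℝ) : ℂ) = 2 * Real.pi := by push_cast; rfl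
  rw [dirichletTerm, dirichletTerm, e1, e2, e3]
  rcases h𝔞 with rfl | rfl
  · have h0 : Gammaℝ w ≠ 0 := Gammaℝ_ne_zero_of_re_pos hw
    have h1 := inv_Gammaℝ_one_sub hreg
    rw [Complex.cos, Gammaℂ_def] at h1
    rw [Nat.cast_zero, add_zero, add_zero, div_eq_mul_inv (Gammaℝ _), h1]
    field_simp
  · have h0 : Gammaℝ (w + 1) ≠ 0 := Gammaℝ_ne_zero_of_re_pos (by simp; linarith)
    have h1 := inv_Gammaℝ_two_sub hreg
    rw [Complex.sin, Gammaℂ_def] at h1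
    rw [Nat.cast_one, show 1 - w + 1 = 2 - w by ring, div_eq_mul_inv (Gammaℝ _), h1]
    have hI := I_mul_I
    generalize exp (Real.pi * w / 2 * I) = A
    generalize exp (-(Real.pi * w / 2) * I) = B
    generalize (D.conductor : ℂ) ^ (w - 1) = C
    generalize (2 * Real.pi : ℂ) ^ (-w) = E
    field_simp
    linear_combination (C * E * Gamma w * (A - B)) * hI

end SelbergData

namespace IsExtendedSelberg

variable {a : ℕ → ℂ} {F : ℂ → ℂ} {D : SelbergData} {q : ℕ} [NeZero q]

/-- The periodic coefficients are even or odd. -/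
lemma exists_parity (hF : IsExtendedSelberg a F D) (hd : D.degree = 1)
    (hq : (q : ℝ) = D.conductor) :
    ∃ 𝔞 : ℕ, (𝔞 = 0 ∨ 𝔞 = 1) ∧ D.limitConst (-1) = (-1) ^ 𝔞 * D.limitConst 1 ∧
      ∀ x : ZMod q, periodicCoeff a D.theta q (-x) = (-1) ^ 𝔞 * periodicCoeff a D.theta q x := by
  have h1 := hF.dft_eq hd hq 1 (Or.inl rfl)
  have h2 := hF.dft_eq hd hq (-1) (Or.inr rfl)
  obtain ⟨x₀, hx₀⟩ := hF.periodicCoeff_ne_zero hd hq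
  set Φ := periodicCoeff a D.theta q
  simp only [if_true, if_neg (show (-1 : ℝ) ≠ 1 by norm_num)] at h1 h2
  have hc1 := D.limitConst_ne_zero 1
  set ε := D.limitConst (-1) / D.limitConst 1 with hε
  have h3 : ∀ x, starRingEnd ℂ (Φ (-x)) = ε * starRingEnd ℂ (Φ x) := fun x => by
    have e := h2 x
    rw [dft_comp_neg] at e
    simp only at e
    rw [h1] at e
    rw [hε, div_mul_eq_mul_div, ← e]
    field_simp
  have hx₀' : starRingEnd ℂ (Φ x₀) ≠ 0 := by simpa using hx₀
  -- applying `x ↦ -x` twice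
  have h4 : ε ^ 2 = 1 := by
    have e := h3 (-x₀)
    rw [neg_neg, h3, ← mul_assoc] at e
    refine mul_right_cancel₀ hx₀' ?_
    rw [one_mul, sq]
    exact e.symm
  have h5 : ∃ 𝔞 : ℕ, (𝔞 = 0 ∨ 𝔞 = 1) ∧ (-1) ^ 𝔞 = ε := by
    rcases mul_eq_zero.1 (show (ε - 1) * (ε + 1) = 0 by linear_combination h4) with h | h
    · exact ⟨0, Or.inl rfl, by rw [sub_eq_zero.1 h, pow_zero]⟩
    · exact ⟨1, Or.inr rfl, by rw [eq_neg_of_add_eq_zero_left h, pow_one]⟩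
  obtain ⟨𝔞, h𝔞, he⟩ := h5
  refine ⟨𝔞, h𝔞, by rw [he, hε, div_mul_cancel₀ _ hc1], fun x => ?_⟩
  have := congrArg (starRingEnd ℂ) (h3 x)
  rw [← he] at this
  simpa using this

/-- The Gamma quotient of the functional equation is that of a Dirichlet L-function. -/
theorem funRatio_eq_dirichletTerm (hF : IsExtendedSelberg a F D) (hd : D.degree = 1)
    (hq : (q : ℝ) = D.conductor) {𝔞 : ℕ} (hc : D.limitConst (-1) = (-1) ^ 𝔞 * D.limitConst 1)
    {s : ℂ} (hs : 0 < s.re) :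
    D.funRatio s = D.limitConst 1 * (D.dirichletTerm 1 (s - I * D.theta) +
      (-1) ^ 𝔞 * D.dirichletTerm (-1) (s - I * D.theta)) := by
  obtain ⟨T, hT, h⟩ := hF.funRatio_mul_LFunction hd hq
  have h1 := hF.dft_eq hd hq 1 (Or.inl rfl)
  have h2 := hF.dft_eq hd hq (-1) (Or.inr rfl)
  obtain ⟨x₀, hx₀⟩ := hF.periodicCoeff_ne_zero hd hq
  set Φ := periodicCoeff a D.theta q
  simp only [if_true, if_neg (show (-1 : ℝ) ≠ 1 by norm_num)] at h1 h2
  set cΦ : ZMod q → ℂ := fun x => starRingEnd ℂ (Φ x)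
  have hL : ∀ (c s : ℂ) (Ψ : ZMod q → ℂ), (∀ x, Ψ x = c * cΦ x) →
      LFunction Ψ s = c * LFunction cΦ s := fun c s Ψ hΨ => by
    simp only [LFunction, hΨ, Finset.mul_sum]
    exact Finset.sum_congr rfl fun j _ => by ring
  set R : ℂ → ℂ := fun s => D.limitConst 1 * (D.dirichletTerm 1 (s - I * D.theta) +
      (-1) ^ 𝔞 * D.dirichletTerm (-1) (s - I * D.theta))
  have hRd : ∀ s : ℂ, 0 < s.re → DifferentiableAt ℂ R s := fun s hs => by
    have : ∀ κ, DifferentiableAt ℂ (fun s => D.dirichletTerm κ (s - I * D.theta)) s := fun κ =>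
      DifferentiableAt.comp (g := D.dirichletTerm κ) s
        (D.differentiableAt_dirichletTerm κ (by simpa using hs)) (by fun_prop)
    exact ((this 1).add ((this (-1)).const_mul _)).const_mul _
  -- in the quadrant `V` both functional equations hold; there the difference of the two sides,
  -- multiplied by the nonzero L-function of the conjugate coefficients, vanishes
  set V : Set ℂ := {s | 1 < s.re} ∩ {s | T < s.im}
  have hVo : IsOpen V := (continuous_re.isOpen_preimage _ isOpen_Ioi).inter
    (continuous_im.isOpen_preimage _ isOpen_Ioi)
  have hVc : IsPreconnected V :=
    ((convex_halfSpace_re_gt 1).inter (convex_halfSpace_im_gt T)).isPreconnected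
  have hd1 : AnalyticOnNhd ℂ (fun s => D.funRatio s - R s) V :=
    DifferentiableOn.analyticOnNhd (fun s hs => ((D.differentiableAt_funRatio
      (zero_lt_one.trans hs.1)).sub (hRd s (zero_lt_one.trans hs.1))).differentiableWithinAt) hVo
  have hd2 : AnalyticOnNhd ℂ (fun s => LFunction cΦ (s - I * D.theta)) V := by
    refine DifferentiableOn.analyticOnNhd (fun s hs => ?_) hVo
    refine DifferentiableAt.differentiableWithinAt ?_
    refine DifferentiableAt.comp s (differentiableAt_LFunction _ _ (Or.inl fun h => ?_))
      (by fun_prop)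
    have := congrArg re h
    have hs1 : 1 < s.re := hs.1
    simp at this
    linarith
  have hmul : ∀ s ∈ V, (D.funRatio s - R s) * LFunction cΦ (s - I * D.theta) = 0 := fun s hs => by
    have e := h s hs.1 ((le_of_lt hs.2).trans (le_abs_self _))
    rw [hL _ _ _ h1, hL _ _ _ h2, hc] at e
    rw [sub_mul, e]
    simp only [R]
    ring
  have hV0 : ∀ s ∈ V, D.funRatio s - R s = 0 := by
    refine (hd1.eq_zero_or_eq_zero_of_mul_eq_zero hd2 hmul hVc).resolve_right fun h0 => hx₀ ?_
    have := eq_zero_of_tendsto_LFunction (Ψ := cΦ) (κ := -1) (by norm_num)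
      (w₀ := 2 - I * D.theta) (by simp) (tendsto_const_nhds.congr' (by
        filter_upwards [eventually_gt_atTop T] with t ht
        have := h0 (2 + t * I) ⟨by simp, by simpa using ht⟩
        rw [← this]
        congr 1
        push_cast
        ring)) x₀
    simpa [cΦ] using this
  have hUo : IsOpen {s : ℂ | 0 < s.re} := continuous_re.isOpen_preimage _ isOpen_Ioi
  have hU1 : AnalyticOnNhd ℂ D.funRatio {s : ℂ | 0 < s.re} :=
    DifferentiableOn.analyticOnNhd (fun s hs =>
      (D.differentiableAt_funRatio hs).differentiableWithinAt) hUo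
  have hU2 : AnalyticOnNhd ℂ R {s : ℂ | 0 < s.re} :=
    DifferentiableOn.analyticOnNhd (fun s hs => (hRd s hs).differentiableWithinAt) hUo
  have hp : (2 + (T + 1 : ℝ) * I : ℂ) ∈ V := ⟨by simp, by simp⟩
  refine hU1.eqOn_of_preconnected_of_eventuallyEq hU2 (convex_halfSpace_re_gt 0).isPreconnected
    (z₀ := 2 + (T + 1 : ℝ) * I) (by simp) ?_ hs
  filter_upwards [hVo.mem_nhds hp] with z hz using sub_eq_zero.1 (hV0 z hz)

end IsExtendedSelberg

/-! ### Determination of the invariant `η` -/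

/-- A function on the right half-plane that tends to `0` at infinity and has a reflection symmetry
in the line `Re s = 1/2` extends to an entire function tending to `0`, hence vanishes. -/
lemma eq_zero_of_reflection {h : ℂ → ℂ} {K : ℂ} (hd : ∀ s : ℂ, 0 < s.re → DifferentiableAt ℂ h s)
    (hsymm : ∀ s : ℂ, 0 < s.re → s.re < 1 →
      h s = K * starRingEnd ℂ (h (1 - starRingEnd ℂ s)))
    (hlim : Tendsto h (atInftyHalfPlane 0) (𝓝 0)) {s : ℂ} (hs : 1 / 2 ≤ s.re) : h s = 0 := by
  -- `h` continued by reflection from `Re s ≥ 1/2`; the two formulas agree in the strip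
  -- `0 < Re s < 1`
  set E : ℂ → ℂ := fun s => if 1 / 2 ≤ s.re then h s else
    K * starRingEnd ℂ (h (1 - starRingEnd ℂ s)) with hE
  have hEd : Differentiable ℂ E := fun s => by
    rcases lt_or_ge 0 s.re with h0 | h0
    · refine (hd s h0).congr_of_eventuallyEq ?_
      filter_upwards [(continuous_re.isOpen_preimage _ isOpen_Ioi).mem_nhds
        (show s ∈ re ⁻¹' Ioi 0 from h0)] with z (hz : 0 < z.re)
      simp only [hE]
      split_ifs with h1
      · rfl
      · exact (hsymm z hz (by linarith)).symm
    · have h1 : DifferentiableAt ℂ (fun s => K * starRingEnd ℂ (h (1 - starRingEnd ℂ s))) s := by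
        have h2 : DifferentiableAt ℂ (fun u => h (1 - u)) (starRingEnd ℂ s) :=
          DifferentiableAt.comp (g := h) _ (hd _ (by simp; linarith)) (by fun_prop)
        have h3 := h2.conj_conj
        rw [conj_conj] at h3
        exact h3.const_mul K
      refine h1.congr_of_eventuallyEq ?_
      filter_upwards [(continuous_re.isOpen_preimage _ isOpen_Iio).mem_nhds
        (show s ∈ re ⁻¹' Iio (1 / 2) from by simp only [mem_preimage, mem_Iio]; linarith)]
        with z (hz : z.re < 1 / 2)
      simp only [hE]
      rw [if_neg (not_le.2 hz)]
  have hElim : Tendsto E (cocompact ℂ) (𝓝 0) := by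
    rw [← Metric.cobounded_eq_cocompact]
    refine Tendsto.if ?_ ?_
    · refine hlim.mono_left (inf_le_inf_left _ (principal_mono.2 fun z hz => ?_))
      have : 1 / 2 ≤ z.re := hz
      exact (show -0 ≤ z.re by linarith)
    · have h1 : Tendsto (fun s : ℂ => 1 - starRingEnd ℂ s)
          (Bornology.cobounded ℂ ⊓ 𝓟 {x | ¬1 / 2 ≤ x.re}) (atInftyHalfPlane 0) := by
        refine tendsto_atInftyHalfPlane ?_ ?_
        · refine tendsto_atTop_mono (fun s => ?_) (tendsto_atTop_add_const_right _ (-1)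
            (tendsto_norm_cobounded_atTop.mono_left inf_le_left))
          have := norm_sub_norm_le (starRingEnd ℂ s) 1
          rw [RCLike.norm_conj, norm_one, norm_sub_rev] at this
          linarith
        · refine eventually_inf_principal.2 (Eventually.of_forall fun z hz => ?_)
          have : ¬1 / 2 ≤ z.re := hz
          simp only [sub_re, one_re, conj_re]
          linarith
      have h2 := ((continuous_conj.tendsto _).comp (hlim.comp h1)).const_mul K
      rw [map_zero, mul_zero] at h2
      exact h2
  have := hEd.apply_eq_of_tendsto_cocompact s hElim
  simpa only [hE, if_pos hs] using this

namespace SelbergData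

/-- The quotient of the Gamma factor of `D` by the Gamma factor of a Dirichlet L-function of parity
`𝔞` and the same conductor, shifted by `iθ`. -/
def gammaQuot (D : SelbergData) (𝔞 : ℕ) (s : ℂ) : ℂ :=
  D.gammaFactor s / ((D.conductor : ℂ) ^ (s / 2) * Gammaℝ (s + I * D.theta + 𝔞))

lemma gammaRegularAt_of_re_pos (D : SelbergData) {s : ℂ} (hs : 0 < s.re) : D.GammaRegularAt s :=
  fun j k h => by
    have := congrArg re h
    simp at this
    have h1 := mul_pos (D.lam_pos j) hs
    have h2 := D.mu_re_nonneg j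
    have : (0 : ℝ) ≤ k := Nat.cast_nonneg k
    linarith

lemma gammaQuot_ne_zero (D : SelbergData) (𝔞 : ℕ) {s : ℂ} (hs : 0 < s.re) :
    D.gammaQuot 𝔞 s ≠ 0 := by
  refine div_ne_zero (D.gammaFactor_ne_zero (D.gammaRegularAt_of_re_pos hs)) (mul_ne_zero ?_ ?_)
  · rw [ofReal_cpow_eq_exp D.conductor_pos]
    exact exp_ne_zero _
  · refine Gammaℝ_ne_zero_of_re_pos ?_
    simp
    positivity

lemma differentiableAt_gammaQuot (D : SelbergData) (𝔞 : ℕ) {s : ℂ} (hs : 0 < s.re) :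
    DifferentiableAt ℂ (D.gammaQuot 𝔞) s := by
  have hq : (D.conductor : ℂ) ≠ 0 := ofReal_ne_zero.2 D.conductor_pos.ne'
  have h1 : DifferentiableAt ℂ D.gammaFactor s := by
    refine DifferentiableAt.mul (DifferentiableAt.const_cpow (by fun_prop) (Or.inl D.Q_ne_zero))
      (DifferentiableAt.fun_finsetProd fun j _ => ?_)
    exact DifferentiableAt.comp (g := Gamma) s
      (differentiableAt_Gamma _ fun m => D.gammaRegularAt_of_re_pos hs j m) (by fun_prop)
  have h2 : DifferentiableAt ℂ (fun s : ℂ => (D.conductor : ℂ) ^ (s / 2)) s :=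
    DifferentiableAt.const_cpow (by fun_prop) (Or.inl hq)
  have h3 : DifferentiableAt ℂ (fun s : ℂ => (Gammaℝ (s + I * D.theta + 𝔞))⁻¹) s :=
    DifferentiableAt.comp (g := fun z => (Gammaℝ z)⁻¹) s (differentiable_Gammaℝ_inv _)
      (by fun_prop)
  have hne : (D.conductor : ℂ) ^ (s / 2) ≠ 0 := by
    rw [ofReal_cpow_eq_exp D.conductor_pos]
    exact exp_ne_zero _
  refine ((h1.mul (h2.inv hne)).mul h3).congr_of_eventuallyEq (Eventually.of_forall fun z => ?_)
  simp only [gammaQuot, Pi.mul_apply, Pi.inv_apply, div_eq_mul_inv, mul_inv]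
  ring

/-- Stirling's formula for `gammaQuot`: it grows like `s ^ ((η + 1 - 𝔞) / 2)`. -/
lemma tendsto_gammaQuot (D : SelbergData) (hd : D.degree = 1) (𝔞 : ℕ) :
    ∃ c : ℂ, c ≠ 0 ∧ Tendsto (fun s : ℂ => D.gammaQuot 𝔞 s *
      exp (-(((D.eta + 1 - 𝔞) / 2 : ℝ) * log s))) (atInftyHalfPlane 0) (𝓝 c) := by
  have hπ := Real.pi_pos
  have hs2π : (Real.sqrt (2 * Real.pi) : ℂ) ≠ 0 :=
    ofReal_ne_zero.2 (Real.sqrt_pos.2 (by positivity)).ne'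
  have h1 := tendsto_prod_Gamma D.lam D.mu D.lam_pos 0
  have h2 := tendsto_prod_Gamma (r := 1) (fun _ => 1 / 2) (fun _ => (I * D.theta + 𝔞) / 2)
    (fun _ => by norm_num) 0
  have hlam : ∑ j, (D.lam j : ℂ) = 1 / 2 := by
    rw [degree] at hd
    rw [← ofReal_sum, show ∑ j, D.lam j = 1 / 2 by linarith]
    push_cast
    ring
  rw [hlam, D.sum_mu_sub_half] at h1
  simp only [Finset.univ_unique, Finset.prod_singleton, Finset.sum_singleton, pow_one] at h2
  set c₁ : ℂ := ∑ j, (D.mu j - 1 / 2) * Real.log (D.lam j)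
  set c₂ : ℂ := ((I * D.theta + 𝔞) / 2 - 1 / 2) * Real.log (1 / 2)
  set C : ℂ := Real.log Real.pi * (I * D.theta + 𝔞) / 2 - c₂ + c₁
  have hlim := (h1.div h2 hs2π).mul_const (exp C)
  refine ⟨_, ?_, hlim.congr' (Eventually.of_forall fun s => ?_)⟩
  · exact mul_ne_zero (div_ne_zero (pow_ne_zero _ hs2π) hs2π) (exp_ne_zero _)
  · have hΓ : ((1 / 2 : ℝ) : ℂ) * s + (I * D.theta + 𝔞) / 2 = (s + I * D.theta + 𝔞) / 2 := by
      push_cast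
      ring
    have hlq := congrArg (fun x : ℝ => (x : ℂ)) (D.log_conductor hd)
    have hl2 : Real.log (1 / 2) = -Real.log 2 := by rw [one_div, Real.log_inv]
    have hl2π : Real.log (2 * Real.pi) = Real.log 2 + Real.log Real.pi :=
      Real.log_mul (by norm_num) hπ.ne'
    rw [hl2π] at hlq
    push_cast at hlq
    simp only [Pi.div_apply]
    rw [hΓ, gammaQuot, gammaFactor, Gammaℝ_def, ofReal_cpow_eq_exp D.conductor_pos,
      ofReal_cpow_eq_exp D.Q_pos, ofReal_cpow_eq_exp hπ]
    generalize (∏ j, Gamma (D.lam j * s + D.mu j)) = P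
    generalize Gamma ((s + I * D.theta + 𝔞) / 2) = G
    have hcomb : ∀ A B A' B' X : ℂ, A - B + X = A' - B' →
        P * exp A / (G * exp B) * exp X = P / G * exp (A' - B') := fun A B A' B' X h => by
      rw [← h, exp_add, exp_sub]
      field_simp
    refine Eq.trans (hcomb _ _ (Real.log D.Q * s + -(((D.eta + 1 - 𝔞) / 2 : ℝ) * log s))
      (Real.log D.conductor * (s / 2) + Real.log Real.pi * (-(s + I * D.theta + 𝔞) / 2)) _ ?_) ?_
    · rw [hlq]
      simp only [C, c₂, hl2]
      push_cast
      ring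
    · simp only [exp_sub, exp_add]
      field_simp

end SelbergData

namespace IsExtendedSelberg

variable {a : ℕ → ℂ} {F : ℂ → ℂ} {D : SelbergData} {q : ℕ} [NeZero q]

/-- The identity of Gamma quotients, read as a symmetry of `gammaQuot` in the line `Re s = 1/2`. -/
lemma gammaQuot_reflection (hF : IsExtendedSelberg a F D) (hd : D.degree = 1)
    (hq : (q : ℝ) = D.conductor) {𝔞 : ℕ} (h𝔞 : 𝔞 = 0 ∨ 𝔞 = 1)
    (hc : D.limitConst (-1) = (-1) ^ 𝔞 * D.limitConst 1) :
    ∃ K : ℂ, ∀ s : ℂ, 0 < s.re → s.re < 1 →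
      D.gammaQuot 𝔞 s = K * starRingEnd ℂ (D.gammaQuot 𝔞 (1 - starRingEnd ℂ s)) := by
  have hω : D.omega ≠ 0 := norm_pos_iff.1 (by rw [D.norm_omega]; exact one_pos)
  have hc1 := D.limitConst_ne_zero 1
  set K' : ℂ := D.limitConst 1 * I ^ 𝔞 * (D.conductor : ℂ) ^ (-(1 / 2) - I * D.theta) / D.omega
  have hK' : K' ≠ 0 := by
    refine div_ne_zero (mul_ne_zero (mul_ne_zero hc1 (pow_ne_zero _ I_ne_zero)) ?_) hω
    rw [ofReal_cpow_eq_exp D.conductor_pos]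
    exact exp_ne_zero _
  -- the identity of Gamma quotients, evaluated at `1 - s`
  have key : ∀ s : ℂ, 0 < s.re → s.re < 1 →
      starRingEnd ℂ (D.gammaQuot 𝔞 (1 - starRingEnd ℂ s)) = K' * D.gammaQuot 𝔞 s := by
    intro s hs0 hs1
    have hs : 0 < (1 - s).re := by simp; linarith
    have h1 := hF.funRatio_eq_dirichletTerm hd hq hc hs
    rw [D.dirichletTerm_add (by simpa using hs) h𝔞, D.funRatio_eq, sub_sub_cancel] at h1
    have hγ := D.gammaFactor_ne_zero (D.gammaRegularAt_of_re_pos hs0)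
    rw [div_eq_iff hγ] at h1
    have hG : starRingEnd ℂ (Gammaℝ (1 - starRingEnd ℂ s + I * D.theta + 𝔞)) =
        Gammaℝ (1 - s - I * D.theta + 𝔞) := by
      rw [Gammaℝ_def, Gammaℝ_def, map_mul, ← Gamma_conj,
        ofReal_cpow_eq_exp Real.pi_pos, ofReal_cpow_eq_exp Real.pi_pos,
        ← exp_conj]
      simp [Complex.conj_ofNat, sub_eq_add_neg]
    have hG1 : Gammaℝ (1 - s - I * D.theta + 𝔞) ≠ 0 := Gammaℝ_ne_zero_of_re_pos (by
      simp
      have : (0 : ℝ) ≤ 𝔞 := Nat.cast_nonneg _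
      linarith)
    have hG2 : Gammaℝ (s + I * D.theta + 𝔞) ≠ 0 := Gammaℝ_ne_zero_of_re_pos (by
      simp
      positivity)
    have e1 : 1 - (1 - s - I * D.theta) + 𝔞 = s + I * D.theta + 𝔞 := by ring
    have e2 : starRingEnd ℂ (1 - s) = 1 - starRingEnd ℂ s := by simp
    rw [e1, e2] at h1
    have hcq : starRingEnd ℂ ((D.conductor : ℂ) ^ ((1 - starRingEnd ℂ s) / 2)) =
        (D.conductor : ℂ) ^ ((1 - s) / 2) := by
      rw [ofReal_cpow_eq_exp D.conductor_pos,
        ofReal_cpow_eq_exp D.conductor_pos, ← exp_conj]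
      simp [Complex.conj_ofNat]
    have hqe : (D.conductor : ℂ) ^ (1 - s - I * D.theta - 1) =
        (D.conductor : ℂ) ^ (-(1 / 2) - I * D.theta) * (D.conductor : ℂ) ^ ((1 - s) / 2) /
          (D.conductor : ℂ) ^ (s / 2) := by
      simp only [ofReal_cpow_eq_exp D.conductor_pos]
      rw [← exp_add, ← exp_sub]
      congr 1
      ring
    have hq1 : (D.conductor : ℂ) ^ ((1 - s) / 2) ≠ 0 := by
      rw [ofReal_cpow_eq_exp D.conductor_pos]
      exact exp_ne_zero _
    have hq2 : (D.conductor : ℂ) ^ (s / 2) ≠ 0 := by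
      rw [ofReal_cpow_eq_exp D.conductor_pos]
      exact exp_ne_zero _
    rw [SelbergData.gammaQuot, SelbergData.gammaQuot, map_div₀, map_mul, hG, hcq,
      div_eq_iff (mul_ne_zero hq1 hG1)]
    refine mul_left_cancel₀ hω ?_
    rw [h1, hqe]
    simp only [K']
    field_simp
  refine ⟨K'⁻¹, fun s h0 h1 => ?_⟩
  rw [key s h0 h1, inv_mul_cancel_left₀ hK']

lemma norm_exp_ofReal_mul_log (κ : ℝ) {s : ℂ} (hs : s ≠ 0) :
    ‖exp (κ * log s)‖ = ‖s‖ ^ κ := by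
  rw [norm_exp, re_ofReal_mul, log_re, Real.rpow_def_of_pos (norm_pos_iff.2 hs), mul_comm]

/-- The parity determines the invariant `η`. -/
theorem natCast_eq_eta_add_one (hF : IsExtendedSelberg a F D) (hd : D.degree = 1)
    (hq : (q : ℝ) = D.conductor) {𝔞 : ℕ} (h𝔞 : 𝔞 = 0 ∨ 𝔞 = 1)
    (hc : D.limitConst (-1) = (-1) ^ 𝔞 * D.limitConst 1) : (𝔞 : ℝ) = D.eta + 1 := by
  obtain ⟨K, hK⟩ := hF.gammaQuot_reflection hd hq h𝔞 hc
  obtain ⟨c, hc0, hlim⟩ := D.tendsto_gammaQuot hd 𝔞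
  set κ : ℝ := (D.eta + 1 - 𝔞) / 2
  have hn := tendsto_norm_atInftyHalfPlane 0
  have hne : ∀ᶠ s in atInftyHalfPlane 0, s ≠ 0 :=
    (hn.eventually_gt_atTop 0).mono fun s hs => norm_pos_iff.1 hs
  have hexp : ∀ κ : ℝ, κ < 0 →
      Tendsto (fun s => exp (κ * log s)) (atInftyHalfPlane 0) (𝓝 0) := fun κ hκ => by
    rw [tendsto_zero_iff_norm_tendsto_zero]
    have h1 := (tendsto_rpow_neg_atTop (neg_pos.2 hκ)).comp hn
    rw [neg_neg] at h1
    refine h1.congr' ?_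
    filter_upwards [hne] with s hs
    rw [norm_exp_ofReal_mul_log κ hs]
    rfl
  -- a negative exponent contradicts the reflection for `gammaQuot`, a positive one for its inverse
  rcases lt_trichotomy κ 0 with h | h | h
  · exfalso
    have h1 := hlim.mul (hexp κ h)
    rw [mul_zero] at h1
    have h2 : Tendsto (D.gammaQuot 𝔞) (atInftyHalfPlane 0) (𝓝 0) := h1.congr fun s => by
      rw [mul_assoc, ← exp_add, neg_add_cancel, exp_zero, mul_one]
    exact D.gammaQuot_ne_zero 𝔞 (s := 1) (by simp)
      (eq_zero_of_reflection (fun s hs => D.differentiableAt_gammaQuot 𝔞 hs) hK h2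
        (by norm_num))
  · have : D.eta + 1 - 𝔞 = 0 := by
      simp only [κ] at h
      linarith
    linarith
  · exfalso
    have h1 := (hlim.inv₀ hc0).mul (hexp (-κ) (neg_neg_of_pos h))
    rw [mul_zero] at h1
    have h2 : Tendsto (fun s => (D.gammaQuot 𝔞 s)⁻¹) (atInftyHalfPlane 0) (𝓝 0) :=
      h1.congr fun s => by
        rw [mul_inv, ← exp_neg, neg_neg, mul_assoc, ← exp_add]
        push_cast
        rw [neg_mul, add_neg_cancel, exp_zero, mul_one]
    refine inv_ne_zero (D.gammaQuot_ne_zero 𝔞 (s := 1) (by simp))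
      (eq_zero_of_reflection (K := K⁻¹) (fun s hs => (D.differentiableAt_gammaQuot 𝔞 hs).inv
        (D.gammaQuot_ne_zero 𝔞 hs)) (fun s h0 h1 => ?_) h2 (by norm_num))
    rw [Pi.inv_apply, Pi.inv_apply, hK s h0 h1, mul_inv, map_inv₀]

end IsExtendedSelberg

/-- With `η + 1 = 𝔞`, the exponential in `limitConst` becomes `i ^ (-𝔞)`. -/
lemma SelbergData.limitConst_one_eq {D : SelbergData} {𝔞 : ℕ} (h : (𝔞 : ℝ) = D.eta + 1) :
    D.limitConst 1 = D.rootNumber * (D.conductor : ℂ) ^ (1 / 2 : ℂ) / I ^ 𝔞 := by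
  have h' : (D.eta : ℂ) + 1 = 𝔞 := by
    rw [← ofReal_natCast, h]
    push_cast
    rfl
  rw [limitConst, h', div_eq_mul_inv]
  congr 1
  have hI : (I : ℂ) ^ 𝔞 = exp (𝔞 * (Real.pi / 2 * I)) := by
    rw [exp_nat_mul, exp_pi_div_two_mul_I]
  rw [hI, ← exp_neg]
  congr 1
  push_cast
  ring

/-! ### Linear twists and their functional equation -/

/-- A holomorphic function on a punctured plane with a finite limit of `(s - p) G(s)` at the
puncture continues its restriction to `Re s > 1`. -/
lemma IsContinuationWithSimplePole.of_tendsto {f G : ℂ → ℂ} {p c : ℂ}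
    (hf : ∀ s : ℂ, 1 < s.re → G s = f s) (hG : ∀ s, s ≠ p → DifferentiableAt ℂ G s)
    (hlim : Tendsto (fun s => (s - p) * G s) (𝓝[≠] p) (𝓝 c)) :
    IsContinuationWithSimplePole f G p := by
  set g : ℂ → ℂ := Function.update (fun s => (s - p) * G s) p c with hg
  have hgan : AnalyticAt ℂ g p := by
    refine analyticAt_of_differentiable_on_punctured_nhds_of_continuousAt ?_
      (continuousAt_update_same.2 hlim)
    filter_upwards [self_mem_nhdsWithin] with s hs
    have h1 : DifferentiableAt ℂ (fun s => (s - p) * G s) s :=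
      DifferentiableAt.mul (by fun_prop) (hG s hs)
    refine h1.congr_of_eventuallyEq ?_
    filter_upwards [isOpen_compl_singleton.mem_nhds hs] with z hz
    exact Function.update_of_ne hz _ _
  have hGg : G =ᶠ[𝓝[≠] p] (fun s => s - p)⁻¹ * g := by
    filter_upwards [self_mem_nhdsWithin] with s hs
    rw [Pi.mul_apply, Pi.inv_apply, hg, Function.update_of_ne hs,
      inv_mul_cancel_left₀ (sub_ne_zero.2 hs)]
  have hm : MeromorphicAt (fun s : ℂ => s - p)⁻¹ p := by
    have : AnalyticAt ℂ (fun s : ℂ => s - p) p := by fun_prop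
    exact this.meromorphicAt.inv
  refine ⟨hf, fun s hs => (hG s hs).differentiableWithinAt,
    (hm.mul hgan.meromorphicAt).congr hGg.symm, ?_⟩
  rw [meromorphicOrderAt_congr hGg, meromorphicOrderAt_mul hm hgan.meromorphicAt,
    meromorphicOrderAt_inv, meromorphicOrderAt_id_sub_const]
  have := hgan.meromorphicOrderAt_nonneg
  calc (-1 : WithTop ℤ) = -1 + 0 := (add_zero _).symm
    _ ≤ _ := by gcongr

/-- The exponential zeta function has at most a simple pole at `1`. -/
lemma exists_tendsto_expZeta (b : UnitAddCircle) :
    ∃ c, Tendsto (fun s => (s - 1) * HurwitzZeta.expZeta b s) (𝓝[≠] 1) (𝓝 c) := by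
  by_cases hb : b = 0
  · refine ⟨1, riemannZeta_residue_one.congr fun s => ?_⟩
    rw [hb, HurwitzZeta.expZeta_zero]
  · have := (HurwitzZeta.differentiable_expZeta_of_ne_zero hb).continuous
    have h2 : Continuous fun s => (s - 1) * HurwitzZeta.expZeta b s := by fun_prop
    exact ⟨_, (h2.tendsto 1).mono_left nhdsWithin_le_nhds⟩

/-- The Hurwitz zeta function as a series over all integers `m` with `m + b > 0`. -/
lemma hasSum_int_hurwitzZeta (b : ℝ) {w : ℂ} (hw : 1 < w.re) :
    HasSum (fun m : ℤ => if 0 < m + b then 1 / ((m + b : ℝ) : ℂ) ^ w else 0)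
      (HurwitzZeta.hurwitzZeta b w) := by
  have hw0 : w ≠ 0 := by
    rintro rfl
    norm_num at hw
  refine ((HurwitzZeta.hasSum_int_hurwitzZetaEven b hw).add
    (HurwitzZeta.hasSum_int_hurwitzZetaOdd b hw)).congr_fun fun m => ?_
  rcases lt_trichotomy (m + b) 0 with h | h | h
  · rw [if_neg (by linarith), sign_neg h, SignType.coe_neg_one]
    ring
  · rw [if_neg (by linarith), h]
    simp [hw0]
  · rw [if_pos h, sign_pos h, abs_of_pos h, SignType.coe_one]
    push_cast
    ring

/-- A Dirichlet series with periodic coefficients over the integers `n` with `n + β > 0`. -/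
lemma hasSum_periodic_shift {q : ℕ} [NeZero q] (Φ : ZMod q → ℂ) (β : ℝ) {w : ℂ} (hw : 1 < w.re) :
    HasSum (fun n : {n : ℤ // 0 < (n : ℝ) + β} =>
        Φ ((n : ℤ) : ZMod q) / ((((n : ℤ) : ℝ) + β : ℝ) : ℂ) ^ w)
      ((q : ℂ) ^ (-w) * ∑ k, Φ k *
        HurwitzZeta.hurwitzZeta (toAddCircle k + ((β / q : ℝ) : UnitAddCircle)) w) := by
  have hq : (0 : ℝ) < q := Nat.cast_pos.2 (NeZero.pos q)
  set f : ℤ → ℂ := fun n => if 0 < (n : ℝ) + β then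
    Φ (n : ZMod q) / (((n : ℝ) + β : ℝ) : ℂ) ^ w else 0 with hf
  suffices h : HasSum f ((q : ℂ) ^ (-w) * ∑ k, Φ k *
      HurwitzZeta.hurwitzZeta (toAddCircle k + ((β / q : ℝ) : UnitAddCircle)) w) by
    rw [← Subtype.val_injective.hasSum_iff (f := f)] at h
    · refine h.congr_fun fun n => ?_
      simp only [hf, Function.comp_apply, if_pos n.2]
    · intro n hn
      exact if_neg fun h => hn ⟨⟨n, h⟩, rfl⟩
  have hk : ∀ k : ZMod q, HasSum (fun n : ℤ => if (n : ZMod q) = k then f n else 0)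
      ((q : ℂ) ^ (-w) * (Φ k *
        HurwitzZeta.hurwitzZeta (toAddCircle k + ((β / q : ℝ) : UnitAddCircle)) w)) := by
    intro k
    have hinj : Function.Injective fun m : ℤ => (k.val : ℤ) + q * m := fun m m' h => by
      have := add_left_cancel h
      exact mul_left_cancel₀ (by exact_mod_cast NeZero.ne q) this
    have h1 := (hasSum_int_hurwitzZeta (k.val / q + β / q) hw).mul_left ((q : ℂ) ^ (-w) * Φ k)
    rw [AddCircle.coe_add, ← toAddCircle_apply, mul_assoc] at h1
    rw [← hinj.hasSum_iff]
    · refine h1.congr_fun fun m => ?_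
      have e : ((((k.val : ℤ) + q * m : ℤ) : ZMod q)) = k := by simp
      have e2 : ((((k.val : ℤ) + q * m : ℤ) : ℝ)) + β = q * (m + (k.val / q + β / q)) := by
        push_cast
        field_simp
        ring
      simp only [Function.comp_apply, hf]
      rw [if_pos e, e, e2]
      by_cases h : 0 < (m : ℝ) + (k.val / q + β / q)
      · rw [if_pos h, if_pos (mul_pos hq h), ofReal_mul, mul_cpow_ofReal_nonneg hq.le h.le,
          cpow_neg, ofReal_natCast]
        field_simp
      · rw [if_neg h, if_neg (by rwa [mul_pos_iff_of_pos_left hq]), mul_zero]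
    · intro n hn
      rw [if_neg]
      intro h
      apply hn
      have : (q : ℤ) ∣ n - k.val := by
        rw [← ZMod.intCast_zmod_eq_zero_iff_dvd]
        simp [h]
      obtain ⟨m, hm⟩ := this
      exact ⟨m, by simp only; linarith⟩
  have h := hasSum_sum (s := Finset.univ) fun k _ => hk k
  rw [Finset.mul_sum]
  refine h.congr_fun fun n => ?_
  simp

lemma expTwoPiI_zero : expTwoPiI 0 = 1 := by simp [expTwoPiI]

section

variable {q : ℕ} [NeZero q]

/-- The meromorphic continuation of the linear twist. -/
def twistContinuation (Φ : ZMod q → ℂ) (θ α : ℝ) (s : ℂ) : ℂ :=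
  (q : ℂ)⁻¹ * ∑ k, 𝓕 Φ k *
    HurwitzZeta.expZeta (toAddCircle k - (α : UnitAddCircle)) (s + I * θ)

/-- The meromorphic continuation of the conjugated series `conj (F_*(conj s, 0, β))`. -/
def starContinuation (Φ : ZMod q → ℂ) (θ β : ℝ) (s : ℂ) : ℂ :=
  (q : ℂ) ^ (-(s - I * θ)) * ∑ k, starRingEnd ℂ (Φ k) *
    HurwitzZeta.hurwitzZeta (toAddCircle k + ((β / q : ℝ) : UnitAddCircle)) (s - I * θ)

/-- Sorting the integers `n` with `n + β > 0` by residue classes modulo `q` expresses the series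
through Hurwitz zeta functions. -/
lemma starContinuation_eq (Φ : ZMod q → ℂ) (θ β : ℝ) {s : ℂ} (hs : 1 < s.re) :
    starContinuation Φ θ β s = starSeriesConj (fun n => Φ n) θ s 0 β := by
  have h := hasSum_periodic_shift (fun k => starRingEnd ℂ (Φ k)) β (w := s - I * θ)
    (by simpa using hs)
  rw [starContinuation, ← h.tsum_eq, starSeriesConj, starSeries, conj_tsum]
  refine tsum_congr fun n => ?_
  rw [starTerm, mul_zero, neg_zero, expTwoPiI_zero, mul_one, map_div₀,
    ofReal_cpow_eq_exp n.2, ofReal_cpow_eq_exp n.2, ← exp_conj]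
  congr 2
  simp [sub_eq_add_neg]

lemma summable_starTerm (Φ : ZMod q → ℂ) (θ β : ℝ) {s : ℂ} (hs : 1 < s.re) :
    Summable (starTerm (fun n => Φ n) θ s 0 β) := by
  refine (hasSum_periodic_shift Φ β (w := s + I * θ) (by simpa using hs)).summable.congr fun n => ?_
  rw [starTerm, mul_zero, neg_zero, expTwoPiI_zero, mul_one]

lemma isContinuation_star (Φ : ZMod q → ℂ) (θ β : ℝ) :
    IsContinuationWithSimplePole (fun s => starSeriesConj (fun n => Φ n) θ s 0 β)
      (starContinuation Φ θ β) (1 + I * θ) := by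
  have hq : (q : ℂ) ≠ 0 := NeZero.ne _
  have hpow : Differentiable ℂ fun s : ℂ => (q : ℂ) ^ (-(s - I * θ)) := fun s =>
    DifferentiableAt.const_cpow (by fun_prop) (Or.inl hq)
  refine IsContinuationWithSimplePole.of_tendsto
    (c := (q : ℂ) ^ (-(1 + I * θ - I * θ)) * ∑ k, starRingEnd ℂ (Φ k) * 1)
    (fun s hs => starContinuation_eq Φ θ β hs) (fun s hs => ?_) ?_
  · refine (hpow s).mul (DifferentiableAt.fun_sum fun k _ => ?_)
    refine DifferentiableAt.const_mul ?_ _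
    refine DifferentiableAt.comp s (HurwitzZeta.differentiableAt_hurwitzZeta _ fun h => hs ?_)
      (by fun_prop)
    rw [← h]
    ring
  · have hmap : Tendsto (fun s : ℂ => s - I * θ) (𝓝[≠] (1 + I * θ)) (𝓝[≠] 1) := by
      refine tendsto_nhdsWithin_iff.2 ⟨?_, ?_⟩
      · have : Continuous fun s : ℂ => s - I * θ := by fun_prop
        have := (this.tendsto (1 + I * θ)).mono_left (nhdsWithin_le_nhds (s := {1 + I * (θ : ℂ)}ᶜ))
        simpa using this
      · filter_upwards [self_mem_nhdsWithin] with s hs h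
        apply hs
        rw [mem_singleton_iff] at h ⊢
        rw [← h]
        ring
    have h1 := ((hpow.continuous.tendsto (1 + I * θ)).mono_left
      (nhdsWithin_le_nhds (s := {1 + I * (θ : ℂ)}ᶜ))).mul
      (tendsto_finsetSum Finset.univ fun k _ => ((HurwitzZeta.hurwitzZeta_residue_one
        (toAddCircle k + ((β / q : ℝ) : UnitAddCircle))).comp hmap).const_mul (starRingEnd ℂ (Φ k)))
    refine h1.congr fun s => ?_
    simp only [starContinuation, Finset.mul_sum, Function.comp_apply]
    refine Finset.sum_congr rfl fun k _ => ?_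
    ring

/-- The functional equation of the linear twist, from that of the exponential zeta functions and the
relation between the coefficients and their discrete Fourier transform. -/
lemma twistContinuation_one_sub {Φ : ZMod q → ℂ} {c : ℂ} {𝔞 : ℕ}
    (hdft : ∀ x, 𝓕 Φ x = c * starRingEnd ℂ (Φ x)) (hpar : ∀ x, Φ (-x) = (-1) ^ 𝔞 * Φ x)
    (θ α : ℝ) {s : ℂ} (hs1 : s ≠ 1 + I * (θ : ℂ)) (hs : ∀ k : ℕ, s - I * (θ : ℂ) ≠ -(k : ℂ)) :
    twistContinuation Φ θ α (1 - s) =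
      (q : ℂ) ^ (s - I * θ - 1) * c * (2 * Real.pi) ^ (-(s - I * θ)) * Gamma (s - I * θ) *
        (exp (Real.pi * I * (s - I * θ) / 2) * starContinuation Φ θ (-(α * q)) s +
          (-1) ^ 𝔞 * exp (-Real.pi * I * (s - I * θ) / 2) * starContinuation Φ θ (α * q) s) := by
  have hq : (q : ℂ) ≠ 0 := NeZero.ne _
  have hqr : (q : ℝ) ≠ 0 := NeZero.ne _
  have hw : ∀ n : ℕ, s - I * θ ≠ 1 - n := fun n h => by
    rcases n with _ | n
    · apply hs1
      rw [Nat.cast_zero, sub_zero] at h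
      rw [← h]
      ring
    · apply hs n
      rw [h]
      push_cast
      ring
  have e1 : -(α * q) / q = -α := by field_simp
  have e2 : α * q / q = α := by field_simp
  have e3 : 1 - s + I * θ = 1 - (s - I * θ) := by ring
  simp only [starContinuation, e1, e2, twistContinuation, e3, HurwitzZeta.expZeta_one_sub _ hw]
  generalize s - I * (θ : ℂ) = w
  set A := exp (Real.pi * I * w / 2)
  set B := exp (-Real.pi * I * w / 2)
  set E := (2 * Real.pi : ℂ) ^ (-w)
  -- the substitution `k ↦ -k` uses the parity
  have h1 : ∑ k : ZMod q, starRingEnd ℂ (Φ k) *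
      HurwitzZeta.hurwitzZeta (-(toAddCircle k - (α : UnitAddCircle))) w =
      (-1) ^ 𝔞 * ∑ k : ZMod q, starRingEnd ℂ (Φ k) *
        HurwitzZeta.hurwitzZeta (toAddCircle k + (α : UnitAddCircle)) w := by
    rw [← Equiv.sum_comp (Equiv.neg (ZMod q)), Finset.mul_sum]
    refine Finset.sum_congr rfl fun k _ => ?_
    rw [Equiv.neg_apply, hpar, map_mul, map_neg, neg_sub, sub_neg_eq_add, add_comm (α : UnitAddCircle)]
    simp only [map_pow, map_neg, map_one]
    ring
  have h2 : ∑ k : ZMod q, 𝓕 Φ k * (E * Gamma w *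
      (A * HurwitzZeta.hurwitzZeta (toAddCircle k - (α : UnitAddCircle)) w +
        B * HurwitzZeta.hurwitzZeta (-(toAddCircle k - (α : UnitAddCircle))) w)) =
      c * E * Gamma w * (A * (∑ k : ZMod q, starRingEnd ℂ (Φ k) *
        HurwitzZeta.hurwitzZeta (toAddCircle k - (α : UnitAddCircle)) w) +
        B * (∑ k : ZMod q, starRingEnd ℂ (Φ k) *
        HurwitzZeta.hurwitzZeta (-(toAddCircle k - (α : UnitAddCircle))) w)) := by
    simp only [Finset.mul_sum, ← Finset.sum_add_distrib]
    refine Finset.sum_congr rfl fun k _ => ?_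
    rw [hdft]
    ring
  have h3 : (q : ℂ) ^ (w - 1) * (q : ℂ) ^ (-w) = (q : ℂ)⁻¹ := by
    rw [← cpow_add _ _ hq, ← cpow_neg_one]
    congr 1
    ring
  rw [h2, h1, ← h3, AddCircle.coe_neg]
  simp only [sub_eq_add_neg]
  ring

end

namespace IsExtendedSelberg

variable {a : ℕ → ℂ} {F : ℂ → ℂ} {D : SelbergData} {q : ℕ} [NeZero q]

/-- By Fourier inversion modulo `q`, the twisted coefficients are combinations of additive
characters, so that the linear twist is a combination of exponential zeta functions. -/
lemma twistContinuation_eq (hF : IsExtendedSelberg a F D) (hd : D.degree = 1)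
    (hq : (q : ℝ) = D.conductor) (α : ℝ) {s : ℂ} (hs : 1 < s.re) :
    twistContinuation (periodicCoeff a D.theta q) D.theta α s = linearTwist a s α := by
  set Φ := periodicCoeff a D.theta q with hΦ
  have hw : 1 < (s + I * D.theta).re := by simpa using hs
  have h1 : ∀ k : ZMod q, HasSum (fun n : ℕ => 𝓕 Φ k *
      (exp (2 * Real.pi * I * (k.val / q - α : ℝ) * n) / (n : ℂ) ^ (s + I * D.theta)))
      (𝓕 Φ k * HurwitzZeta.expZeta (toAddCircle k - (α : UnitAddCircle)) (s + I * D.theta)) :=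
    fun k => by
      have := (HurwitzZeta.hasSum_expZeta_of_one_lt_re (k.val / q - α) hw).mul_left (𝓕 Φ k)
      rwa [AddCircle.coe_sub, ← toAddCircle_apply] at this
  have h2 := (hasSum_sum (s := Finset.univ) fun k _ => h1 k).mul_left ((q : ℂ)⁻¹)
  rw [twistContinuation, ← h2.tsum_eq, linearTwist, LSeries]
  refine tsum_congr fun n => ?_
  rcases eq_or_ne n 0 with rfl | hn
  · have : s + I * D.theta ≠ 0 := fun h => by
      rw [h, zero_re] at hw
      linarith
    simp [this]
  · have hn' : (n : ℂ) ≠ 0 := Nat.cast_ne_zero.2 hn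
    have h3 : (q : ℂ)⁻¹ * ∑ k : ZMod q, 𝓕 Φ k * exp (2 * Real.pi * I * (k.val / q : ℝ) * n) =
        Φ n := by
      have h4 : 𝓕⁻ (𝓕 Φ) n = Φ n := by rw [LinearEquiv.symm_apply_apply]
      rw [← h4, invDFT_apply, smul_eq_mul]
      congr 1
      refine Finset.sum_congr rfl fun k _ => ?_
      have h5 := stdAddChar_coe (N := q) (k.val * n)
      push_cast at h5
      rw [natCast_zmod_val] at h5
      rw [h5, smul_eq_mul, mul_comm]
      congr 2
      push_cast
      ring
    have h6 : ∀ k : ZMod q, exp (2 * Real.pi * I * (k.val / q - α : ℝ) * n) =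
        exp (2 * Real.pi * I * (k.val / q : ℝ) * n) * expTwoPiI (-(n * α)) := fun k => by
      rw [expTwoPiI, ← exp_add]
      congr 1
      push_cast
      ring
    have h7 : (n : ℂ) ^ (I * (D.theta : ℂ)) ≠ 0 := by simp [cpow_eq_zero_iff, hn]
    rw [LSeries.term_of_ne_zero hn]
    have h8 : ∑ k : ZMod q, 𝓕 Φ k * (exp (2 * Real.pi * I * (k.val / q - α : ℝ) * n) /
        (n : ℂ) ^ (s + I * D.theta)) =
        (∑ k : ZMod q, 𝓕 Φ k * exp (2 * Real.pi * I * (k.val / q : ℝ) * n)) *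
          (expTwoPiI (-(n * α)) / (n : ℂ) ^ (s + I * D.theta)) := by
      rw [Finset.sum_mul]
      refine Finset.sum_congr rfl fun k _ => ?_
      rw [h6]
      ring
    rw [h8, ← mul_assoc, h3, hΦ, hF.periodicCoeff_natCast hd hq hn, twistedCoeff, cpow_add _ _ hn']
    field_simp

lemma isContinuation_twist (hF : IsExtendedSelberg a F D) (hd : D.degree = 1)
    (hq : (q : ℝ) = D.conductor) (α : ℝ) :
    IsContinuationWithSimplePole (fun s => linearTwist a s α)
      (twistContinuation (periodicCoeff a D.theta q) D.theta α) (1 - I * D.theta) := by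
  set Φ := periodicCoeff a D.theta q
  choose c hc using exists_tendsto_expZeta
  refine IsContinuationWithSimplePole.of_tendsto
    (c := (q : ℂ)⁻¹ * ∑ k, 𝓕 Φ k * c (toAddCircle k - (α : UnitAddCircle)))
    (fun s hs => hF.twistContinuation_eq hd hq α hs) (fun s hs => ?_) ?_
  · refine DifferentiableAt.const_mul (DifferentiableAt.fun_sum fun k _ => ?_) _
    refine DifferentiableAt.const_mul ?_ _
    refine DifferentiableAt.comp s (HurwitzZeta.differentiableAt_expZeta _ _ (Or.inl fun h => hs ?_))
      (by fun_prop)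
    rw [← h]
    ring
  · have hmap : Tendsto (fun s : ℂ => s + I * D.theta) (𝓝[≠] (1 - I * D.theta)) (𝓝[≠] 1) := by
      refine tendsto_nhdsWithin_iff.2 ⟨?_, ?_⟩
      · have : Continuous fun s : ℂ => s + I * D.theta := by fun_prop
        have := (this.tendsto (1 - I * D.theta)).mono_left (nhdsWithin_le_nhds (s := {1 - I * D.theta}ᶜ))
        simpa using this
      · filter_upwards [self_mem_nhdsWithin] with s hs h
        apply hs
        rw [mem_singleton_iff] at h ⊢
        rw [← h]
        ring
    have h1 := (tendsto_finsetSum Finset.univ fun k _ =>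
      ((hc (toAddCircle k - (α : UnitAddCircle))).comp hmap).const_mul (𝓕 Φ k)).const_mul (q : ℂ)⁻¹
    refine h1.congr fun s => ?_
    simp only [twistContinuation, Finset.mul_sum, Function.comp_apply]
    refine Finset.sum_congr rfl fun k _ => ?_
    ring

end IsExtendedSelberg

end

theorem mainTheorem1 (a : ℕ → ℂ) (F : ℂ → ℂ) (D : SelbergData)
    (hF : IsExtendedSelberg a F D) (hd : D.degree = 1) :
    ∃ (q : ℕ) (𝔞 : ℕ) (ta : ℤ → ℂ),
      0 < q ∧ (q : ℝ) = D.conductor ∧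
      (𝔞 = 0 ∨ 𝔞 = 1) ∧ (𝔞 : ℝ) = D.eta + 1 ∧
      (∀ n : ℤ, ta (n + q) = ta n) ∧
      (∀ n : ℕ, 1 ≤ n → ta n = a n * (n : ℂ) ^ (I * (D.theta : ℂ))) ∧
      ∀ α : ℝ, 0 < α → α ≤ 1 →
        (∀ s : ℂ, 1 < s.re →
          Summable (starTerm ta D.theta s 0 (-(α * q))) ∧
          Summable (starTerm ta D.theta s 0 (α * q))) ∧
        ∃ G Hminus Hplus : ℂ → ℂ,
          IsContinuationWithSimplePole (fun s => linearTwist a s α) G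
            (1 - I * (D.theta : ℂ)) ∧
          IsContinuationWithSimplePole
            (fun s => starSeriesConj ta D.theta s 0 (-(α * q))) Hminus
            (1 + I * (D.theta : ℂ)) ∧
          IsContinuationWithSimplePole
            (fun s => starSeriesConj ta D.theta s 0 (α * q)) Hplus
            (1 + I * (D.theta : ℂ)) ∧
          ∀ s : ℂ, s ≠ 1 + I * (D.theta : ℂ) →
            (∀ k : ℕ, s - I * (D.theta : ℂ) ≠ -(k : ℂ)) →
            G (1 - s) =
              D.rootNumber * Complex.Gamma (s - I * (D.theta : ℂ)) *
                  (q : ℂ) ^ (s - I * (D.theta : ℂ) - 1 / 2) /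
                (I ^ 𝔞 * ((2 * Real.pi : ℝ) : ℂ) ^ (s - I * (D.theta : ℂ))) *
              (Complex.exp (I * (Real.pi / 2) * (s - I * (D.theta : ℂ))) * Hminus s +
                (-1) ^ 𝔞 *
                  Complex.exp (-(I * (Real.pi / 2) * (s - I * (D.theta : ℂ)))) * Hplus s) := by
  obtain ⟨q, hq0, hq⟩ := hF.exists_natCast_eq_conductor hd
  have : NeZero q := ⟨hq0.ne'⟩
  obtain ⟨𝔞, h𝔞, hc, hpar⟩ := hF.exists_parity hd hq
  have heta := hF.natCast_eq_eta_add_one hd hq h𝔞 hc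
  have hdft := hF.dft_eq hd hq 1 (Or.inl rfl)
  simp only [if_true] at hdft
  have hc1 := SelbergData.limitConst_one_eq heta
  refine ⟨q, 𝔞, fun n => periodicCoeff a D.theta q n, hq0, hq, h𝔞, heta, fun n => by simp,
    fun n hn => ?_, fun α _ _ => ⟨fun s hs => ⟨summable_starTerm _ _ _ hs,
      summable_starTerm _ _ _ hs⟩, _, _, _, hF.isContinuation_twist hd hq α,
      isContinuation_star _ _ _, isContinuation_star _ _ _,
      fun s hs1 hs => ?_⟩⟩
  · have := hF.periodicCoeff_natCast hd hq (n := n) (by omega)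
    simpa [twistedCoeff] using this
  · have hqc : (D.conductor : ℂ) = q := by rw [← hq, ofReal_natCast]
    have hqne : (q : ℂ) ≠ 0 := NeZero.ne _
    rw [twistContinuation_one_sub hdft hpar _ _ hs1 hs, hc1, hqc]
    generalize s - I * (D.theta : ℂ) = w
    have e1 : (q : ℂ) ^ (w - 1 / 2) = (q : ℂ) ^ (w - 1) * (q : ℂ) ^ (1 / 2 : ℂ) := by
      rw [← cpow_add _ _ hqne]
      congr 1
      ring
    have e2 : (Real.pi * I * w / 2 : ℂ) = I * (Real.pi / 2) * w := by ring
    have e3 : (-Real.pi * I * w / 2 : ℂ) = -(I * (Real.pi / 2) * w) := by ring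
    rw [e1, e2, e3, cpow_neg]
    push_cast
    simp only [div_eq_mul_inv, mul_inv]
    ring
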